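/- **Setting.** Processes have pids, messages have tags $\ell$, checkpoints have identifiers $\tau$; $\bot$ is a null state. Parallel composition $|$ is associative and commutative, and steps may be made in any context. *Rollback recovery systems* are compositions of process configurations $\langle\Delta,p,s\rangle$, messages $(C,p,p',\{\ell,v\})$ ($C$ a set of checkpoints, $p$ the sender, $p'$ the receiver) and notifications $\langle\!\langle p,p',n\rangle\!\rangle$. A history $\Delta$ (newest element first) consists of elements $check(\tau,s)$ (active checkpoint), $\overline{check}(\tau,s)$ (checkpoint with delayed commit), $send(p',\ell)$, $rec(C,p',p,\{\ell,v\})$, $spawn(p')$. A configuration that is rolling back carries superscripts $\tau,p_\tau,p_r,L,P$ (checkpoint, initiator, requester, tags of messages still to be deleted, processes still to roll back); one that waits to resume carries $\tau$. If $\tau$ is active in $\Delta=a_1{:}\dots{:}a_m{:}check(\tau,s_\tau){:}\Delta'$ (first occurrence), let $L,P,Ms$ be the tags sent, the processes spawned or addressed, and the messages received in $a_1,\dots,a_m$. Rules ($\tau\in\Delta$ means that $\tau$ is active in $\Delta$): * *Rollback*: $\langle\Delta,p,s\rangle\hookrightarrow\langle\Delta',p,s_\tau\rangle^{\tau,p,p,L,P}\,|\,\prod_{q\in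 P}\langle\!\langle p,q,\{p,roll,\tau\}\rangle\!\rangle\,|\,Ms$ if $s\xrightarrow{rollback(\tau)}s'$ for some $s'$ and $\tau\in\Delta$. * *Roll1*: $\langle\!\langle p',p,\{p_\tau,roll,\tau\}\rangle\!\rangle\,|\,\langle\Delta,p,s\rangle\hookrightarrow\langle\Delta',p,s_\tau\rangle^{\tau,p_\tau,p',L,P}\,|\,\prod_{q\in P}\langle\!\langle p,q,\{p_\tau,roll,\tau\}\rangle\!\rangle\,|\,Ms$ if $\tau\in\Delta$. *Roll2*: the same left-hand side becomes $\langle\Delta,p,s\rangle^{\tau,p_\tau,p',\emptyset,\emptyset}$ if $\tau\notin\Delta$. * *Roll3*: a process rolling back to $\tau'$ with remaining history $\Delta$ answers a request $roll,\tau$ from $p'$ by $\langle\!\langle p,p',\{done\text{-}async,\tau\}\rangle\!\rangle$, if $\tau'=\tau$ or $\tau\notin\Delta$. * *Undo-send*: a process $p$ rolling back deletes a message $(C,p,p',\{\ell,v\})$ with $\ell\in L$ and removes $\ell$ from $L$. *Undo-dep1/2*: if $L=\emptyset$, a process rolling back to $\tau$ consumes a notification $done\text{-}async,\tau$ (resp.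 $done\text{-}sync,\tau$) from $p'$ and removes $p'$ from $P$ (resp. and sends $resume,\tau$ to $p'$). * *Resume*: if $L=P=\emptyset$, the process becomes normal if $p=p_\tau$; otherwise, if its state is $\bot$ it is deleted and $done\text{-}async,\tau$ is sent to $p_r$; otherwise it becomes $\langle\Delta,p,s\rangle^\tau$ and $done\text{-}sync,\tau$ is sent to $p_r$. A process $\langle\Delta,p,s\rangle^\tau$ that receives $resume,\tau$ becomes normal. *Reversible systems* are compositions of messages $(p,p',\{\ell,v\})$ and configurations $[\![h,p,s]\!]_\varphi$, where $\varphi$ is a set of requests $\tau$, $\ell$ or $\mathsf{sp}$, and $\langle h,p,s\rangle$ means $[\![h,p,s]\!]_\emptyset$. The elements of $h$ are $\mathsf{seq}(s)$, $\mathsf{send}(s,p',\ell)$, $\mathsf{rec}(s,p',p,\{\ell,v\})$, $\mathsf{spawn}(s,p')$, $\mathsf{check}(\tau,s)$, each storing the previous state. The *controlled backward semantics* $\looparrowright$ of a rollback to $\tau$ lets a process with $\varphi\neq\emptyset$ undo its newest element and restore the state stored there: $\mathsf{seq}$ unconditionally; $\mathsf{check}(\tau',s)$, removing $\tau'$ from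 $\varphi$; $\mathsf{rec}$, putting the message back on the network and removing $\ell$ from $\varphi$; $\mathsf{spawn}(s,p')$ if $p'$ has empty history and no requests, deleting $p'$; $\mathsf{send}(s,p',\ell)$ if the message is on the network, deleting it. If $p'$ has a nonempty history (resp. if the message is not on the network) a $\mathsf{spawn}$ (resp. $\mathsf{send}$) to be undone adds instead the requests $\tau,\mathsf{sp}$ (resp. $\tau,\ell$) to process $p'$. A process with empty history may drop $\mathsf{sp}$. $S\approx R$ means that $R$ has no requests and that $S$ and $R$ coincide after deleting, in $S$, notifications, superscripts, the sets $C$ and delayed checkpoints, and, in $R$, $\mathsf{seq}$ elements and the states stored in $\mathsf{send},\mathsf{rec},\mathsf{spawn}$. **Statement.** Let $S_0=\langle\Delta,p,s\rangle\,|\,S_1$ ($s\ne\bot$) be a rollback recovery system, $S_0'=\langle h,p,s\rangle\,|\,S_1'$ a reversible system with $S_0\approx S_0'$, and $\tau$ a checkpoint. Assume: (A) There is no ongoing rollback (no superscripts, all notifications concern commits) and a rollback of $p$ to $\tau$ is requested: either $s\xrightarrow{rollback(\tau)}s'$ for some $s'$, or there is, in addition to the above, exactly one notification $\langle\!\langle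 p_r,p,\{p_\tau,roll,\tau\}\rangle\!\rangle$, where $p_\tau$ is not a process of $S_1$ (no process of $S_1$ is rolling back). (B) The histories of $S_0$ are a consistent and complete record for this rollback. Say that $q$ recorded an element *since $\tau$* if it is newer than an active $check(\tau,\cdot)$ in the history of $q$. Then: pids of processes, tags of recorded sends, tags of messages (on the network or recorded as received) and pids of recorded spawns are unique; each history contains $\tau$ at most once as an active checkpoint; current states are not $\bot$; each process records only messages addressed to it; the recorded actions admit times compatible with Lamport's happened-before relation; each message sent since $\tau$ is addressed to a process of $S_0$ and is on the network or recorded since $\tau$ by its receiver; each process spawned since $\tau$ is a process of $S_0$ other than $p$ whose history contains $check(\tau,\bot)$ with only checkpoints below it; only such processes, and possibly $p$, contain an active $check(\tau,\bot)$; and every process in which $\tau$ is active causally depends on $p$, that is, is reached from $p$ through recorded spawns, and recorded sends and receipts of messages, since $\tau$. Then: 1. For every derivation $$d:\quad S_0\hookrightarrow\langle\Delta',p,s_\tau\rangle^{\tau,p_\tau,p_r,L,P}\,|\,T\hookrightarrow^*\langle\Delta',p,s_\tau\rangle^{\tau,p_\tau,p_r,\emptyset,\emptyset}\,|\,S_2,$$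 whose first step uses *Rollback* or *Roll1* and whose other steps use any of the rules above except *Rollback*, there is a derivation $$d':\quad [\![h,p,s]\!]_{\{\tau\}}\,|\,S_1'\looparrowright^*[\![h',p,s_\tau]\!]_\emptyset\,|\,S_2'$$ with $\langle\Delta',p,s_\tau\rangle^{\tau,p_\tau,p_r,\emptyset,\emptyset}\,|\,S_2\approx\langle h',p,s_\tau\rangle\,|\,S_2'$. 2. Conversely, for every derivation $d'$ of this form there is a derivation $d$ of this form, with the same $s_\tau$; and if no request is pending in $S_2'$, then $d$ can be chosen with $\langle\Delta',p,s_\tau\rangle^{\tau,p_\tau,p_r,\emptyset,\emptyset}\,|\,S_2\approx\langle h',p,s_\tau\rangle\,|\,S_2'$. In particular, a derivation $d$ exists if and only if a derivation $d'$ exists. -/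

import Mathlib

/-! Rollback recovery for message-passing processes: the rollback rules of the checkpoint-based
rollback recovery semantics, the controlled backward (reversible) semantics, and the relation
between systems of the two. Systems are multisets of components, so that parallel composition is
associative and commutative. -/

namespace RollbackRecovery

/-- Process identifiers. -/
abbrev Pid := ℕ

/-- Message tags. -/
abbrev Tag := ℕ

/-- Checkpoint identifiers. -/
abbrev Chk := ℕ

/-! ### Systems of the rollback recovery semantics -/

/-- Elements of a history. A saved state is `none` when it is the null state `⊥`, which marks a
process that has to be deleted when it is rolled back to that checkpoint; `delayed` is a
checkpoint whose commit has been delayed and which is no longer active. -/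
inductive Item (St V : Type*) where
  | check (τ : Chk) (s : Option St)
  | delayed (τ : Chk) (s : Option St)
  | send (dst : Pid) (ℓ : Tag)
  | recv (C : Finset Chk) (src dst : Pid) (ℓ : Tag) (v : V)
  | spawn (q : Pid)

/-- Contents of system notifications. -/
inductive Note where
  | roll (pτ : Pid) (τ : Chk)
  | doneAsync (τ : Chk)
  | doneSync (τ : Chk)
  | resume (τ : Chk)
  | commit (τ : Chk)

/-- The superscripts of a process configuration: none (the process computes normally);
`τ, pτ, pr, L, P` (it is rolling back to `τ`; the rollback was started by `pτ` and requested by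
`pr`; the messages tagged in `L` have to be deleted and the processes in `P` have to roll back);
or `τ` (its rollback is done and it waits for the notification to resume). -/
inductive Mode where
  | normal
  | rolling (τ : Chk) (pτ pr : Pid) (L : Finset Tag) (P : Finset Pid)
  | waiting (τ : Chk)

/-- Components of a system: extended process configurations (newest history element first),
extended messages and system notifications. -/
inductive Comp (St V : Type*) where
  | proc (Δ : List (Item St V)) (p : Pid) (s : Option St) (m : Mode)
  | msg (C : Finset Chk) (src dst : Pid) (ℓ : Tag) (v : V)
  | note (src dst : Pid) (n : Note)

abbrev Sys (St V : Type*) := Multiset (Comp St V)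

/-- The active checkpoints of a history. -/
def chks {St V : Type*} : List (Item St V) → Finset Chk
  | [] => ∅
  | .check τ _ :: Δ => insert τ (chks Δ)
  | .delayed _ _ :: Δ => chks Δ
  | .send _ _ :: Δ => chks Δ
  | .recv _ _ _ _ _ :: Δ => chks Δ
  | .spawn _ :: Δ => chks Δ

/-- What a rollback to a checkpoint extracts from a history: the history before the checkpoint,
the saved state, the tags of the messages sent since then, the processes spawned or addressed
since then, and the messages received since then. -/
structure Extract (St V : Type*) where
  hist : List (Item St V)
  state : Option St
  tags : Finset Tag
  deps : Finset Pid
  msgs : Sys St V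

/-- `chk τ Δ` is defined iff `τ` is an active checkpoint of `Δ`. -/
def chk {St V : Type*} (τ : Chk) : List (Item St V) → Option (Extract St V)
  | [] => none
  | .check τ' s :: Δ => if τ' = τ then some ⟨Δ, s, ∅, ∅, 0⟩ else chk τ Δ
  | .delayed _ _ :: Δ => chk τ Δ
  | .spawn q :: Δ => (chk τ Δ).map fun e => { e with deps := insert q e.deps }
  | .send q ℓ :: Δ =>
      (chk τ Δ).map fun e => { e with tags := insert ℓ e.tags, deps := insert q e.deps }
  | .recv C q q' ℓ v :: Δ =>
      (chk τ Δ).map fun e => { e with msgs := .msg C q q' ℓ v ::ₘ e.msgs }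

/-- The notifications by which `p` asks the processes in `P` to roll back to `τ`. -/
def rollNotes {St V : Type*} (p pτ : Pid) (τ : Chk) (P : Finset Pid) : Sys St V :=
  P.val.map fun q => Comp.note p q (.roll pτ τ)

/-- Rule Rollback: a process calls `rollback(τ)`. The relation `rollbackStep s τ s'` is the local
transition from `s` to `s'` labelled with `rollback(τ)`. The process resumes in the saved state. -/
inductive RollbackRule {St V : Type*} (rollbackStep : St → Chk → St → Prop) :
    Sys St V → Sys St V → Prop
  | rollback {Δ p s s' τ e} : rollbackStep s τ s' → chk τ Δ = some e →
      RollbackRule rollbackStep {.proc Δ p (some s) .normal}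
        (.proc e.hist p e.state (.rolling τ p p e.tags e.deps) ::ₘ
          (rollNotes p p τ e.deps + e.msgs))

/-- Rule Roll1: a process holding the checkpoint `τ` is asked to roll back to it. -/
inductive Roll1Rule {St V : Type*} : Sys St V → Sys St V → Prop
  | roll1 {Δ p s p' pτ τ e} : chk τ Δ = some e →
      Roll1Rule {.note p' p (.roll pτ τ), .proc Δ p s .normal}
        (.proc e.hist p e.state (.rolling τ pτ p' e.tags e.deps) ::ₘ
          (rollNotes p pτ τ e.deps + e.msgs))

/-- The remaining rules of a rollback. In `roll3`, `Δ` is the history left by the ongoing rollback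
to `τ'`, so the checkpoint `τ` is older than `τ'` iff `τ ≠ τ'` and `τ` is still active in `Δ`. -/
inductive UndoRule {St V : Type*} : Sys St V → Sys St V → Prop
  | roll2 {Δ p s p' pτ τ} : τ ∉ chks Δ →
      UndoRule {.note p' p (.roll pτ τ), .proc Δ p s .normal}
        {.proc Δ p s (.rolling τ pτ p' ∅ ∅)}
  | roll3 {Δ p s p' pτ τ τ' p₁ p₂ L P} : (τ' = τ ∨ τ ∉ chks Δ) →
      UndoRule {.note p' p (.roll pτ τ), .proc Δ p s (.rolling τ' p₁ p₂ L P)}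
        {.proc Δ p s (.rolling τ' p₁ p₂ L P), .note p p' (.doneAsync τ)}
  | undoSend {Δ p s p' C ℓ v τ pτ pr L P} : ℓ ∈ L →
      UndoRule {.msg C p p' ℓ v, .proc Δ p s (.rolling τ pτ pr L P)}
        {.proc Δ p s (.rolling τ pτ pr (L.erase ℓ) P)}
  | undoDep1 {Δ p s p' τ pτ pr P} :
      UndoRule {.note p' p (.doneAsync τ), .proc Δ p s (.rolling τ pτ pr ∅ P)}
        {.proc Δ p s (.rolling τ pτ pr ∅ (P.erase p'))}
  | undoDep2 {Δ p s p' τ pτ pr P} :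
      UndoRule {.note p' p (.doneSync τ), .proc Δ p s (.rolling τ pτ pr ∅ P)}
        {.proc Δ p s (.rolling τ pτ pr ∅ (P.erase p')), .note p p' (.resume τ)}
  | resume1 {Δ p s τ pr} :
      UndoRule {.proc Δ p s (.rolling τ p pr ∅ ∅)} {.proc Δ p s .normal}
  | resume2 {Δ p τ pτ pr} : p ≠ pτ →
      UndoRule {.proc Δ p none (.rolling τ pτ pr ∅ ∅)} {.note p pr (.doneAsync τ)}
  | resume3 {Δ p s τ pτ pr} : p ≠ pτ → s ≠ none →
      UndoRule {.proc Δ p s (.rolling τ pτ pr ∅ ∅)}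
        {.proc Δ p s (.waiting τ), .note p pr (.doneSync τ)}
  | resume4 {Δ p s p' τ} :
      UndoRule {.note p' p (.resume τ), .proc Δ p s (.waiting τ)} {.proc Δ p s .normal}

/-- First step of a rollback, in the context of a whole system: rule Rollback or Roll1. -/
def InitStep {St V : Type*} (rollbackStep : St → Chk → St → Prop) (S S' : Sys St V) : Prop :=
  ∃ A B T, (RollbackRule rollbackStep A B ∨ Roll1Rule A B) ∧ S = A + T ∧ S' = B + T

/-- Subsequent steps of a rollback, in the context of a whole system: any rollback rule except
Rollback, which would start another rollback. -/
def PropStep {St V : Type*} (S S' : Sys St V) : Prop :=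
  ∃ A B T, (Roll1Rule A B ∨ UndoRule A B) ∧ S = A + T ∧ S' = B + T

/-- The derivations
`S₀ ↪ ⟨Δ',p,sτ⟩^{τ,pτ,pr,L,P} | S₁ ↪* ⟨Δ',p,sτ⟩^{τ,pτ,pr,∅,∅} | S₂`. -/
def RollbackDerivation {St V : Type*} (rollbackStep : St → Chk → St → Prop) (S₀ : Sys St V)
    (τ : Chk) (Δ' : List (Item St V)) (p : Pid) (sτ : Option St) (pτ pr : Pid)
    (S₂ : Sys St V) : Prop :=
  ∃ L P S₁, InitStep rollbackStep S₀ (.proc Δ' p sτ (.rolling τ pτ pr L P) ::ₘ S₁) ∧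
    Relation.ReflTransGen PropStep (.proc Δ' p sτ (.rolling τ pτ pr L P) ::ₘ S₁)
      (.proc Δ' p sτ (.rolling τ pτ pr ∅ ∅) ::ₘ S₂)

/-! ### Systems of the reversible semantics and the controlled backward semantics -/

/-- Elements of a history of the reversible semantics; each one stores the previous state. -/
inductive RItem (St V : Type*) where
  | seq (s : Option St)
  | send (s : Option St) (dst : Pid) (ℓ : Tag)
  | recv (s : Option St) (src dst : Pid) (ℓ : Tag) (v : V)
  | spawn (s : Option St) (q : Pid)
  | check (τ : Chk) (s : Option St)

/-- Rollback requests: up to a checkpoint, up to the receiving of a message, or up to the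
beginning of the process (`sp`). -/
inductive Request where
  | chk (τ : Chk)
  | tag (ℓ : Tag)
  | sp

/-- Components of a system: a process configuration with a set `φ` of rollback requests (with
`φ = ∅` it is an ordinary configuration of the reversible semantics) and messages. -/
inductive RComp (St V : Type*) where
  | proc (h : List (RItem St V)) (p : Pid) (s : Option St) (φ : Set Request)
  | msg (src dst : Pid) (ℓ : Tag) (v : V)

abbrev RSys (St V : Type*) := Multiset (RComp St V)

/-- Steps of the controlled backward semantics during a rollback to `τ`, in the context `T` of a
whole system. Only processes with a request go backwards. A process is asked to roll back by
`spawn2` (`send2`) only if it is not in its initial state (the message is not on the network), since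
`spawn1` (`send1`) has priority. -/
inductive ControlledStep {St V : Type*} (τ : Chk) : RSys St V → RSys St V → Prop
  | seq {s' h p s φ T} : φ.Nonempty →
      ControlledStep τ (.proc (.seq s' :: h) p s φ ::ₘ T) (.proc h p s' φ ::ₘ T)
  | check {τ' s' h p s φ T} : φ.Nonempty →
      ControlledStep τ (.proc (.check τ' s' :: h) p s φ ::ₘ T)
        (.proc h p s' (φ \ {.chk τ'}) ::ₘ T)
  | sp {p s φ T} : Request.sp ∈ φ →
      ControlledStep τ (.proc [] p s φ ::ₘ T) (.proc [] p s (φ \ {.sp}) ::ₘ T)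
  | receive {s' p' ℓ v h p s φ T} : φ.Nonempty →
      ControlledStep τ (.proc (.recv s' p' p ℓ v :: h) p s φ ::ₘ T)
        (.proc h p s' (φ \ {.tag ℓ}) ::ₘ .msg p' p ℓ v ::ₘ T)
  | spawn1 {s'' p' h p s φ s' T} : φ.Nonempty →
      ControlledStep τ (.proc (.spawn s'' p' :: h) p s φ ::ₘ .proc [] p' s' ∅ ::ₘ T)
        (.proc h p s'' φ ::ₘ T)
  | spawn2 {s'' p' h p s φ h' s' φ' T} : φ.Nonempty → h' ≠ [] →
      ControlledStep τ (.proc (.spawn s'' p' :: h) p s φ ::ₘ .proc h' p' s' φ' ::ₘ T)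
        (.proc (.spawn s'' p' :: h) p s φ ::ₘ .proc h' p' s' (φ' ∪ {.chk τ, .sp}) ::ₘ T)
  | send1 {s'' p' ℓ v h p s φ T} : φ.Nonempty →
      ControlledStep τ (.proc (.send s'' p' ℓ :: h) p s φ ::ₘ .msg p p' ℓ v ::ₘ T)
        (.proc h p s'' φ ::ₘ T)
  | send2 {s'' p' ℓ h p s φ h' s' φ' T} : φ.Nonempty → (∀ v, RComp.msg p p' ℓ v ∉ T) →
      ControlledStep τ (.proc (.send s'' p' ℓ :: h) p s φ ::ₘ .proc h' p' s' φ' ::ₘ T)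
        (.proc (.send s'' p' ℓ :: h) p s φ ::ₘ .proc h' p' s' (φ' ∪ {.chk τ, .tag ℓ}) ::ₘ T)

/-- No process has a pending rollback request. -/
def NoRequests {St V : Type*} (R : RSys St V) : Prop :=
  ∀ h p s φ, RComp.proc h p s φ ∈ R → φ = ∅

/-! ### The relation between the two kinds of systems -/

/-- Common image of the two kinds of history elements. -/
inductive EItem (St V : Type*) where
  | send (dst : Pid) (ℓ : Tag)
  | recv (src dst : Pid) (ℓ : Tag) (v : V)
  | spawn (q : Pid)
  | check (τ : Chk) (s : Option St)

/-- Common image of the two kinds of components. -/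
inductive EComp (St V : Type*) where
  | proc (h : List (EItem St V)) (p : Pid) (s : Option St)
  | msg (src dst : Pid) (ℓ : Tag) (v : V)

def Item.erase {St V : Type*} : Item St V → Option (EItem St V)
  | .check τ s => some (.check τ s)
  | .delayed _ _ => none
  | .send q ℓ => some (.send q ℓ)
  | .recv _ q q' ℓ v => some (.recv q q' ℓ v)
  | .spawn q => some (.spawn q)

def RItem.erase {St V : Type*} : RItem St V → Option (EItem St V)
  | .seq _ => none
  | .send _ q ℓ => some (.send q ℓ)
  | .recv _ q q' ℓ v => some (.recv q q' ℓ v)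
  | .spawn _ q => some (.spawn q)
  | .check τ s => some (.check τ s)

def Comp.erase {St V : Type*} : Comp St V → Option (EComp St V)
  | .proc Δ p s _ => some (.proc (Δ.filterMap Item.erase) p s)
  | .msg _ q q' ℓ v => some (.msg q q' ℓ v)
  | .note _ _ _ => none

def RComp.erase {St V : Type*} : RComp St V → EComp St V
  | .proc h p s _ => .proc (h.filterMap RItem.erase) p s
  | .msg q q' ℓ v => .msg q q' ℓ v

/-- The relation `S ≈ R` between a system of the rollback recovery semantics and a system of the
reversible semantics (in which, therefore, no rollback request is pending). -/
def Approx {St V : Type*} (S : Sys St V) (R : RSys St V) : Prop :=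
  NoRequests R ∧ S.filterMap Comp.erase = R.map RComp.erase

/-! ### Standing assumptions -/

def Comp.pid? {St V : Type*} : Comp St V → Option Pid
  | .proc _ p _ _ => some p
  | _ => none

/-- The pids of the processes of a system. -/
def pids {St V : Type*} (S : Sys St V) : Multiset Pid := S.filterMap Comp.pid?

/-- No process is adorned, and all notifications (if any) belong to commits. -/
def NoOngoingRollback {St V : Type*} (S : Sys St V) : Prop :=
  (∀ Δ q s m, Comp.proc Δ q s m ∈ S → m = .normal) ∧
  (∀ q q' n, Comp.note q q' n ∈ S → ∃ τ, n = .commit τ)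

/-- There is no ongoing rollback in `⟨Δ,p,s⟩ | S₁`, and `p` is requested to roll back to `τ`: either
its state `s` calls `rollback(τ)`, or `S₁` contains a request addressed to `p`, made by some
`pr` on behalf of some `pτ` (which is `p` itself or is not one of the processes of `S₁`, as none of
these is rolling back). -/
inductive RollbackRequested {St V : Type*} (rollbackStep : St → Chk → St → Prop) (p : Pid)
    (τ : Chk) (s : St) : Sys St V → Prop
  | user {S₁ s'} : rollbackStep s τ s' → NoOngoingRollback S₁ →
      RollbackRequested rollbackStep p τ s S₁
  | propagated {T pr pτ} : NoOngoingRollback T → pτ ∉ pids T →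
      RollbackRequested rollbackStep p τ s (.note pr p (.roll pτ τ) ::ₘ T)

/-- `Δ` is the history of the process `q` of `S`. -/
def HistOf {St V : Type*} (S : Sys St V) (q : Pid) (Δ : List (Item St V)) : Prop :=
  ∃ s m, Comp.proc Δ q s m ∈ S

/-- `Δ` holds the active checkpoint `τ`, with saved state `s`, the elements recorded since then are
those of `newer`, and the ones recorded before are those of `older`. -/
def Holds {St V : Type*} (τ : Chk) (Δ newer : List (Item St V)) (s : Option St)
    (older : List (Item St V)) : Prop :=
  Δ = newer ++ .check τ s :: older ∧ τ ∉ chks newer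

/-- Process `q` of `S` recorded `a` since it holds the checkpoint `τ`. -/
def Since {St V : Type*} (S : Sys St V) (τ : Chk) (q : Pid) (a : Item St V) : Prop :=
  ∃ Δ newer s older, HistOf S q Δ ∧ Holds τ Δ newer s older ∧ a ∈ newer

/-- The processes that causally depend on `p` since checkpoint `τ`: `p`, and every process which was
spawned by, or has received a message from, a process of this kind (with all these actions
recorded since `τ`). -/
inductive DependsOn {St V : Type*} (S : Sys St V) (τ : Chk) (p : Pid) : Pid → Prop
  | refl : DependsOn S τ p p
  | spawn {y q} : DependsOn S τ p y → Since S τ y (.spawn q) → DependsOn S τ p q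
  | message {y q ℓ C v} : DependsOn S τ p y → Since S τ y (.send q ℓ) →
      Since S τ q (.recv C y q ℓ v) → DependsOn S τ p q

def Item.sendTag? {St V : Type*} : Item St V → Option Tag
  | .send _ ℓ => some ℓ
  | _ => none

def Item.recvTag? {St V : Type*} : Item St V → Option Tag
  | .recv _ _ _ ℓ _ => some ℓ
  | _ => none

def Item.spawned? {St V : Type*} : Item St V → Option Pid
  | .spawn q => some q
  | _ => none

def Comp.hist {St V : Type*} : Comp St V → Multiset (Item St V)
  | .proc Δ _ _ _ => ↑Δ
  | _ => 0

def Comp.msgTag? {St V : Type*} : Comp St V → Option Tag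
  | .msg _ _ _ ℓ _ => some ℓ
  | _ => none

/-- All elements of all histories of a system. -/
def items {St V : Type*} (S : Sys St V) : Multiset (Item St V) := S.bind Comp.hist

/-- The actions recorded in the histories can be given times that respect Lamport's "happened
before": `t q i` is the time of the `i`-th oldest element of the history of `q`. -/
def Causal {St V : Type*} (S : Sys St V) : Prop :=
  ∃ t : Pid → ℕ → ℕ, (∀ q, StrictMono (t q)) ∧
    (∀ y q Δ Δ' i j ℓ C v, HistOf S y Δ → HistOf S q Δ' →
      Δ.reverse[i]? = some (.send q ℓ) → Δ'.reverse[j]? = some (.recv C y q ℓ v) →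
      t y i < t q j) ∧
    (∀ y q Δ Δ' i j, HistOf S y Δ → HistOf S q Δ' →
      Δ.reverse[i]? = some (.spawn q) → j < Δ'.length → t y i < t q j)

/-- The histories of `S` are the consistent and complete record that is needed to roll back process
`p` to checkpoint `τ`. -/
structure CompleteHistories {St V : Type*} (p : Pid) (τ : Chk) (S : Sys St V) : Prop where
  /-- Identifiers are unique: pids of processes, tags of recorded sends, tags of messages (on the
  network or recorded as received), and pids of recorded spawns. -/
  nodup_pids : (pids S).Nodup
  nodup_sends : ((items S).filterMap Item.sendTag?).Nodup
  nodup_messages : (S.filterMap Comp.msgTag? + (items S).filterMap Item.recvTag?).Nodup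
  nodup_spawns : ((items S).filterMap Item.spawned?).Nodup
  /-- A process holds `τ` at most once. -/
  holds_once : ∀ q Δ newer s older, HistOf S q Δ → Holds τ Δ newer s older → τ ∉ chks older
  /-- The current state of a process is a proper state. -/
  state_ne_bot : ∀ Δ q s m, Comp.proc Δ q s m ∈ S → s ≠ none
  /-- A process only records messages that are addressed to it. -/
  recv_dst : ∀ q Δ C y z ℓ v, HistOf S q Δ → Item.recv C y z ℓ v ∈ Δ → z = q
  causal : Causal S
  /-- A message sent since `τ` is addressed to a process of the system, and either is on the network
  or has been recorded, since `τ`, by its receiver. -/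
  sends : ∀ y q ℓ, Since S τ y (.send q ℓ) → q ∈ pids S ∧
    ((∃ C v, Comp.msg C y q ℓ v ∈ S) ∨ ∃ C v, Since S τ q (.recv C y q ℓ v))
  /-- A process spawned since `τ` is a process of the system other than `p`, and it started with the
  forced checkpoint `τ`, possibly among other ones. -/
  spawns : ∀ y q, Since S τ y (.spawn q) → q ≠ p ∧ ∃ Δ newer older, HistOf S q Δ ∧
    Holds τ Δ newer none older ∧
    ∀ a ∈ older, ∃ τ' s, a = Item.check τ' s ∨ a = Item.delayed τ' s
  /-- Only processes spawned since `τ` have no state saved in `τ`. -/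
  bot_spawned : ∀ q Δ newer older, HistOf S q Δ → Holds τ Δ newer none older → q ≠ p →
    ∃ y, Since S τ y (.spawn q)
  /-- Every process that holds `τ` does so because it causally depends on `p` since `τ`. -/
  depends : ∀ q Δ newer s older, HistOf S q Δ → Holds τ Δ newer s older → DependsOn S τ p q

end RollbackRecovery

open RollbackRecovery

namespace RollbackRecovery

/-! Neither semantics is simulated step by step in the other. Both initial systems have the same
erased image `E`, and `E` alone determines where a finished rollback ends: `p` has the history and
state given by `restore`, and the rest is `undoneSys p τ E E`. There every other process is cut at
`τ`, processes spawned since `τ` are gone, messages received since `τ` are back on the network, and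
messages sent since `τ` are deleted. So it suffices to show, for each semantics, that a finished
derivation ends there and that one exists.

The end. A rule touches few components, so invariants are inequalities between additive weights
`wsum`, checked on the components that the rule consumes and produces. The central one is a
conservation law: `undoneSys p τ E` has the same value on the current system as on `E`
(`undoneSys_rule`, `RBalance.undone`). On a system with nothing left to undo it merely drops `p`
(`undoneSys_eq_of_done`). In the rollback semantics, the processes rolling back form a forest of
requests below `p` (`Inv.tok`, `Inv.rank`), so when `p` waits for nobody no other process is
rolling; `Inv.edge` then carries the absence of `τ` from `p` along causal dependency to all
processes (`Inv.final`). In the reversible semantics, an undone spawn leaves no spawned process and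
an undone send leaves no message, neither on the network nor recorded; hence the receiver has gone
backwards too, and it can be free of requests only after undoing `τ` (`RInv.depends`, `RInv.final`).

Existence. In the rollback semantics all requests are delivered first, while nobody resumes
(`Driven.deliver`). Then no process holds `τ`, every message still to be deleted is on the network,
and acyclicity of the requests excludes deadlock (`Driven.finish`). In the reversible semantics a
blocked process waits for one whose newest action is later in the happened-before order, so some
step is always possible (`RInv.exists_step`, `RInv.noRequests`), provided that a spawned process
undoes `τ` only once it has been asked to disappear.

For the converse direction, `p` can lose its request only by undoing an active `τ`
(`unfinished_of_not_holds`), so a backward derivation supplies the checkpoint that the rollback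
rules need. -/

variable {α β St V : Type*}

/-! ### Weights of multisets -/

/-- The sum of the values of `f` on a multiset. -/
def wsum (f : α → ℕ) (M : Multiset α) : ℕ := (M.map f).sum

@[simp] theorem wsum_zero (f : α → ℕ) : wsum f 0 = 0 := by simp [wsum]
@[simp] theorem wsum_cons (f : α → ℕ) (a : α) (M : Multiset α) :
    wsum f (a ::ₘ M) = f a + wsum f M := by simp [wsum]
@[simp] theorem wsum_add (f : α → ℕ) (M N : Multiset α) :
    wsum f (M + N) = wsum f M + wsum f N := by simp [wsum]
@[simp] theorem wsum_singleton (f : α → ℕ) (a : α) : wsum f {a} = f a := by simp [wsum]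

theorem wsum_map (f : β → ℕ) (g : α → β) (M : Multiset α) :
    wsum f (M.map g) = wsum (fun a => f (g a)) M := by simp [wsum]

theorem le_wsum {f : α → ℕ} {M : Multiset α} {a : α} (h : a ∈ M) : f a ≤ wsum f M := by
  obtain ⟨T, rfl⟩ := Multiset.exists_cons_of_mem h
  simp

theorem wsum_eq_zero_iff {f : α → ℕ} {M : Multiset α} : wsum f M = 0 ↔ ∀ a ∈ M, f a = 0 := by
  induction M using Multiset.induction with
  | empty => simp
  | cons a M ih => simp [ih]

theorem exists_of_wsum_pos {f : α → ℕ} {M : Multiset α} (h : 0 < wsum f M) :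
    ∃ a ∈ M, 0 < f a := by
  by_contra! hc
  have := (wsum_eq_zero_iff (f := f) (M := M)).2 fun a ha => by have := hc a ha; omega
  omega

theorem wsum_mono {f g : α → ℕ} {M : Multiset α} (h : ∀ a ∈ M, f a ≤ g a) :
    wsum f M ≤ wsum g M := by
  induction M using Multiset.induction with
  | empty => simp
  | cons a M ih =>
    have h1 := h a (Multiset.mem_cons_self a M)
    have h2 := ih fun b hb => h b (Multiset.mem_cons_of_mem hb)
    simp only [wsum_cons]
    omega

/-- Uniqueness of identifiers is expressed by weights bounded by 1; this is how such a bound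
identifies two components. -/
theorem eq_of_wsum_le_one {f : α → ℕ} {M : Multiset α} (h : wsum f M ≤ 1) {a b : α}
    (ha : a ∈ M) (hb : b ∈ M) (h1 : 0 < f a) (h2 : 0 < f b) : a = b := by
  obtain ⟨T, rfl⟩ := Multiset.exists_cons_of_mem ha
  rcases Multiset.mem_cons.1 hb with h3 | h3
  · exact h3.symm
  · have := le_wsum (f := f) h3
    simp only [wsum_cons] at h
    omega

theorem count_filterMap_eq_wsum [DecidableEq β] (f : α → Option β) (b : β) (M : Multiset α) :
    (M.filterMap f).count b = wsum (fun a => if f a = some b then 1 else 0) M := by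
  induction M using Multiset.induction with
  | empty => simp
  | cons a M ih =>
    rw [Multiset.filterMap_cons, Multiset.count_add, ih, wsum_cons]
    cases h : f a with
    | none => simp
    | some c => simp [Multiset.count_singleton, eq_comm]

theorem count_bind_eq_wsum [DecidableEq β] (f : α → Multiset β) (b : β) (M : Multiset α) :
    (M.bind f).count b = wsum (fun a => (f a).count b) M := by
  rw [Multiset.count_bind, wsum]

theorem wsum_filterMap (f : α → Option β) (g : β → ℕ) (M : Multiset α) :
    wsum g (M.filterMap f) = wsum (fun a => (f a).elim 0 g) M := by
  induction M using Multiset.induction with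
  | empty => simp
  | cons a M ih =>
    rw [Multiset.filterMap_cons, wsum_add, ih, wsum_cons]
    cases h : f a <;> simp

/-! ### Cutting erased histories at a checkpoint -/

/-- The elements newer than the newest checkpoint `τ`, the state saved in this checkpoint, and the
elements older than it. -/
def back (τ : Chk) : List (EItem St V) → Option (List (EItem St V) × Option St × List (EItem St V))
  | [] => none
  | .check τ' s :: e =>
      if τ' = τ then some ([], s, e) else (back τ e).map fun r => (.check τ' s :: r.1, r.2)
  | .send q ℓ :: e => (back τ e).map fun r => (.send q ℓ :: r.1, r.2)
  | .recv q q' ℓ v :: e => (back τ e).map fun r => (.recv q q' ℓ v :: r.1, r.2)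
  | .spawn q :: e => (back τ e).map fun r => (.spawn q :: r.1, r.2)

theorem back_check (τ : Chk) (s : Option St) (e : List (EItem St V)) :
    back τ (.check τ s :: e) = some ([], s, e) := by simp [back]

theorem back_cons {τ : Chk} {a : EItem St V} (h : ∀ s, a ≠ .check τ s) (e : List (EItem St V)) :
    back τ (a :: e) = (back τ e).map fun r => (a :: r.1, r.2) := by
  cases a with
  | check τ' s =>
    have : τ' ≠ τ := by rintro rfl; exact h s rfl
    simp [back, this]
  | _ => rfl

theorem back_eq_some_iff {τ : Chk} {e n o : List (EItem St V)} {s : Option St} :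
    back τ e = some (n, s, o) ↔ e = n ++ .check τ s :: o ∧ ∀ s', EItem.check τ s' ∉ n := by
  induction e generalizing n with
  | nil => simp [back]
  | cons a e ih =>
    by_cases h : ∃ s', a = .check τ s'
    · obtain ⟨s', rfl⟩ := h
      rw [back_check]
      constructor
      · rintro h
        simp only [Option.some.injEq, Prod.mk.injEq] at h
        obtain ⟨rfl, rfl, rfl⟩ := h
        simp
      · rintro ⟨h1, h2⟩
        cases n with
        | nil => simpa using h1
        | cons b n =>
          simp only [List.cons_append, List.cons.injEq] at h1
          exact absurd (by simp [← h1.1]) (h2 s')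
    · push Not at h
      rw [back_cons h, Option.map_eq_some_iff]
      constructor
      · rintro ⟨⟨n', s', o'⟩, h1, h2⟩
        simp only [Prod.mk.injEq] at h2
        obtain ⟨rfl, rfl, rfl⟩ := h2
        obtain ⟨rfl, h3⟩ := ih.1 h1
        exact ⟨rfl, by simpa [h3] using fun s => (h s).symm⟩
      · rintro ⟨h1, h2⟩
        cases n with
        | nil =>
          simp only [List.nil_append, List.cons.injEq] at h1
          exact absurd h1.1 (h s)
        | cons b n =>
          simp only [List.cons_append, List.cons.injEq] at h1
          obtain ⟨rfl, h1⟩ := h1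
          exact ⟨(n, s, o), ih.2 ⟨h1, fun s' hs => h2 s' (by simp [hs])⟩, rfl⟩

/-- A history holds the checkpoint `τ`. -/
def EHolds (τ : Chk) (e : List (EItem St V)) : Prop := ∃ s, EItem.check τ s ∈ e

theorem back_eq_none_iff {τ : Chk} {e : List (EItem St V)} : back τ e = none ↔ ¬ EHolds τ e := by
  induction e with
  | nil => simp [back, EHolds]
  | cons a e ih =>
    by_cases h : ∃ s', a = .check τ s'
    · obtain ⟨s', rfl⟩ := h
      simp only [back_check, reduceCtorEq, false_iff, not_not]
      exact ⟨s', by simp⟩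
    · push Not at h
      rw [back_cons h, Option.map_eq_none_iff, ih, EHolds, EHolds, not_iff_not]
      constructor
      · rintro ⟨s, hs⟩; exact ⟨s, by simp [hs]⟩
      · rintro ⟨s, hs⟩
        rcases List.mem_cons.1 hs with h1 | h1
        · exact absurd h1.symm (h s)
        · exact ⟨s, h1⟩

theorem EHolds.exists_back {τ : Chk} {e : List (EItem St V)} (h : EHolds τ e) :
    ∃ n s o, back τ e = some (n, s, o) := by
  cases hb : back τ e with
  | none => exact absurd h (back_eq_none_iff.1 hb)
  | some r => exact ⟨r.1, r.2.1, r.2.2, rfl⟩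

theorem eholds_of_back {τ : Chk} {e n o : List (EItem St V)} {s : Option St}
    (h : back τ e = some (n, s, o)) : EHolds τ e := by
  by_contra hc
  rw [back_eq_none_iff.2 hc] at h
  cases h

/-- The elements recorded since `τ`. -/
def since (τ : Chk) (e : List (EItem St V)) : List (EItem St V) := (back τ e).elim [] fun r => r.1

/-- The history and the state to which a rollback to `τ` leads. -/
def restore (τ : Chk) (e : List (EItem St V)) (s : Option St) : List (EItem St V) × Option St :=
  (back τ e).elim (e, s) fun r => (r.2.2, r.2.1)

theorem since_of_not {τ : Chk} {e : List (EItem St V)} (h : ¬ EHolds τ e) : since τ e = [] := by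
  simp [since, back_eq_none_iff.2 h]

theorem restore_of_not {τ : Chk} {e : List (EItem St V)} (h : ¬ EHolds τ e) (s : Option St) :
    restore τ e s = (e, s) := by
  simp [restore, back_eq_none_iff.2 h]

theorem since_of_back {τ : Chk} {e n o : List (EItem St V)} {s : Option St}
    (h : back τ e = some (n, s, o)) : since τ e = n := by simp [since, h]

theorem restore_of_back {τ : Chk} {e n o : List (EItem St V)} {s : Option St}
    (h : back τ e = some (n, s, o)) (s' : Option St) : restore τ e s' = (o, s) := by
  simp [restore, h]

theorem since_subset (τ : Chk) (e : List (EItem St V)) : (since τ e).Sublist e := by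
  by_cases h : EHolds τ e
  · obtain ⟨n, s, o, hb⟩ := h.exists_back
    rw [since_of_back hb, (back_eq_some_iff.1 hb).1]
    simp
  · simp [since_of_not h]

theorem eholds_cons {τ : Chk} {a : EItem St V} {e : List (EItem St V)} :
    EHolds τ (a :: e) ↔ (∃ s, a = .check τ s) ∨ EHolds τ e := by
  simp only [EHolds, List.mem_cons]
  constructor
  · rintro ⟨s, h | h⟩
    · exact .inl ⟨s, h.symm⟩
    · exact .inr ⟨s, h⟩
  · rintro (⟨s, h⟩ | ⟨s, h⟩)
    · exact ⟨s, .inl h.symm⟩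
    · exact ⟨s, .inr h⟩

theorem since_cons {τ : Chk} {a : EItem St V} {e : List (EItem St V)} (ha : ∀ s, a ≠ .check τ s)
    (h : EHolds τ e) : since τ (a :: e) = a :: since τ e := by
  obtain ⟨n, s, o, hb⟩ := h.exists_back
  simp [since, back_cons ha, hb]

theorem restore_cons {τ : Chk} {a : EItem St V} {e : List (EItem St V)}
    (ha : ∀ s, a ≠ .check τ s) (h : EHolds τ e) (s s' : Option St) :
    restore τ (a :: e) s = restore τ e s' := by
  obtain ⟨n, s, o, hb⟩ := h.exists_back
  simp [restore, back_cons ha, hb]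

theorem since_check (τ : Chk) (s : Option St) (e : List (EItem St V)) :
    since τ (.check τ s :: e) = [] := by simp [since, back_check]

theorem restore_check (τ : Chk) (s s' : Option St) (e : List (EItem St V)) :
    restore τ (.check τ s :: e) s' = (e, s) := by simp [restore, back_check]

theorem restore_indep {τ : Chk} {e : List (EItem St V)} (h : EHolds τ e) (s s' : Option St) :
    restore τ e s = restore τ e s' := by
  obtain ⟨n, s, o, hb⟩ := h.exists_back
  simp [restore, hb]

/-- If `u` contained a checkpoint `τ`, the cut would be there and the `τ` of `e` would survive below
it, against `h1`. So when `τ` is active only once, the cut does not depend on newer elements. -/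
theorem since_append {τ : Chk} {u e : List (EItem St V)} (s : Option St) (h : EHolds τ e)
    (h1 : ¬ EHolds τ (restore τ (u ++ e) s).1) : since τ (u ++ e) = u ++ since τ e := by
  induction u with
  | nil => rfl
  | cons a u ih =>
    have h2 : EHolds τ (u ++ e) := by
      obtain ⟨s, hs⟩ := h
      exact ⟨s, by simp [hs]⟩
    by_cases ha : ∃ s, a = .check τ s
    · obtain ⟨s', rfl⟩ := ha
      rw [List.cons_append, restore_check] at h1
      exact absurd h2 h1
    · push Not at ha
      rw [List.cons_append, restore_cons ha h2 s s] at h1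
      rw [List.cons_append, since_cons ha h2, ih h1, List.cons_append]

theorem restore_append {τ : Chk} {u e : List (EItem St V)} (s s' : Option St) (h : EHolds τ e)
    (h1 : ¬ EHolds τ (restore τ (u ++ e) s).1) : restore τ (u ++ e) s = restore τ e s' := by
  induction u with
  | nil => exact restore_indep h _ _
  | cons a u ih =>
    have h2 : EHolds τ (u ++ e) := by
      obtain ⟨s, hs⟩ := h
      exact ⟨s, by simp [hs]⟩
    by_cases ha : ∃ s, a = .check τ s
    · obtain ⟨s', rfl⟩ := ha
      rw [List.cons_append, restore_check] at h1
      exact absurd h2 h1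
    · push Not at ha
      rw [List.cons_append, restore_cons ha h2 s s] at h1 ⊢
      exact ih h1

/-! ### Weights of erased components -/

def EItem.recvTag? : EItem St V → Option Tag
  | .recv _ _ ℓ _ => some ℓ
  | _ => none

def EItem.recvKey? : EItem St V → Option (Pid × Pid × Tag)
  | .recv y q ℓ _ => some (y, q, ℓ)
  | _ => none

def EItem.sendKey? : EItem St V → Option (Pid × Tag)
  | .send q ℓ => some (q, ℓ)
  | _ => none

def EItem.spawned? : EItem St V → Option Pid
  | .spawn q => some q
  | _ => none

def EItem.recvMsg? : EItem St V → Option (EComp St V)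
  | .recv y q ℓ v => some (.msg y q ℓ v)
  | _ => none

def pidW (z : Pid) : EComp St V → ℕ
  | .proc _ z' _ => if z' = z then 1 else 0
  | .msg _ _ _ _ => 0

/-- Number of messages with tag `ℓ`, on the network or recorded as received. -/
def tagW (ℓ : Tag) : EComp St V → ℕ
  | .proc e _ _ => (e.filterMap EItem.recvTag?).count ℓ
  | .msg _ _ ℓ' _ => if ℓ' = ℓ then 1 else 0

/-- Number of messages of a kind, on the network or recorded as received since `τ`. -/
def msgW (τ : Chk) (y q : Pid) (ℓ : Tag) : EComp St V → ℕ
  | .proc e _ _ => ((since τ e).filterMap EItem.recvKey?).count (y, q, ℓ)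
  | .msg y' q' ℓ' _ => if (y', q', ℓ') = (y, q, ℓ) then 1 else 0

def sendW (τ : Chk) (y q : Pid) (ℓ : Tag) : EComp St V → ℕ
  | .proc e z _ => if z = y then ((since τ e).filterMap EItem.sendKey?).count (q, ℓ) else 0
  | .msg _ _ _ _ => 0

def spawnW (τ : Chk) (q : Pid) : EComp St V → ℕ
  | .proc e _ _ => ((since τ e).filterMap EItem.spawned?).count q
  | .msg _ _ _ _ => 0

/-- Unlike `spawnW`, this fixes the spawner, so that a spawned process can be shown to be gone once
its own spawner has undone the spawn. -/
def spawnOfW (τ : Chk) (y q : Pid) : EComp St V → ℕ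
  | .proc e z _ => if z = y then ((since τ e).filterMap EItem.spawned?).count q else 0
  | .msg _ _ _ _ => 0

open Classical in
noncomputable def holdW (τ : Chk) (z : Pid) : EComp St V → ℕ
  | .proc e z' _ => if z' = z ∧ EHolds τ e then 1 else 0
  | .msg _ _ _ _ => 0

/-! ### Complete records -/

/-- Process `q` of `E` recorded `a` since it holds the checkpoint `τ`. -/
def ESince (E : Multiset (EComp St V)) (τ : Chk) (q : Pid) (a : EItem St V) : Prop :=
  ∃ e s, EComp.proc e q s ∈ E ∧ a ∈ since τ e

inductive EDependsOn (E : Multiset (EComp St V)) (τ : Chk) (p : Pid) : Pid → Prop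
  | refl : EDependsOn E τ p p
  | spawn {y q} : EDependsOn E τ p y → ESince E τ y (.spawn q) → EDependsOn E τ p q
  | message {y q ℓ v} : EDependsOn E τ p y → ESince E τ y (.send q ℓ) →
      ESince E τ q (.recv y q ℓ v) → EDependsOn E τ p q

/-- The image of `CompleteHistories` on erased systems. -/
structure CompleteRecord (p : Pid) (τ : Chk) (E : Multiset (EComp St V)) : Prop where
  pid_le : ∀ z, wsum (pidW z) E ≤ 1
  tag_le : ∀ ℓ, wsum (tagW ℓ) E ≤ 1
  send_le : ∀ y q ℓ, wsum (sendW τ y q ℓ) E ≤ 1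
  spawn_le : ∀ q, wsum (spawnW τ q) E ≤ 1
  holds_once : ∀ e q s, EComp.proc e q s ∈ E → EHolds τ e → ¬ EHolds τ (restore τ e s).1
  state_ne : ∀ e q s, EComp.proc e q s ∈ E → s ≠ none
  recv_dst : ∀ e q s y z ℓ v, EComp.proc e q s ∈ E → EItem.recv y z ℓ v ∈ e → z = q
  causal : ∃ t : Pid → ℕ → ℕ,
    (∀ e q s, EComp.proc e q s ∈ E → ∀ i j, i < j → j < e.length → t q i < t q j) ∧
    (∀ e y s e' q s' u v u' v' ℓ w, EComp.proc e y s ∈ E → EComp.proc e' q s' ∈ E →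
      e = u ++ .send q ℓ :: v → e' = u' ++ .recv y q ℓ w :: v' → t y v.length < t q v'.length) ∧
    (∀ e y s e' q s' u v j, EComp.proc e y s ∈ E → EComp.proc e' q s' ∈ E →
      e = u ++ .spawn q :: v → j < e'.length → t y v.length < t q j)
  sends : ∀ y q ℓ, ESince E τ y (.send q ℓ) → (∃ e s, EComp.proc e q s ∈ E) ∧
    0 < wsum (msgW τ y q ℓ) E
  spawns : ∀ y q, ESince E τ y (.spawn q) → q ≠ p ∧ ∃ e s, EComp.proc e q s ∈ E ∧
    EHolds τ e ∧ (restore τ e s).2 = none ∧ ∀ a ∈ (restore τ e s).1, ∃ τ' s, a = .check τ' s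
  bot_spawned : ∀ e q s, EComp.proc e q s ∈ E → EHolds τ e → (restore τ e s).2 = none → q ≠ p →
    ∃ y, ESince E τ y (.spawn q)
  depends : ∀ e q s, EComp.proc e q s ∈ E → EHolds τ e → EDependsOn E τ p q

/-! ### Transfer of the assumptions to erased systems -/

/-- The erased history. -/
abbrev eraseHist (Δ : List (Item St V)) : List (EItem St V) := Δ.filterMap Item.erase

theorem mem_chks_iff {τ : Chk} {Δ : List (Item St V)} : τ ∈ chks Δ ↔ EHolds τ (eraseHist Δ) := by
  induction Δ with
  | nil => simp [chks, EHolds]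
  | cons a Δ ih =>
    cases a with
    | check τ' s =>
      simp only [chks, Finset.mem_insert, ih, eraseHist, Item.erase, List.filterMap_cons,
        eholds_cons, EItem.check.injEq]
      constructor
      · rintro (rfl | h)
        · exact .inl ⟨s, rfl, rfl⟩
        · exact .inr h
      · rintro (⟨_, rfl, _⟩ | h)
        · exact .inl rfl
        · exact .inr h
    | delayed τ' s => simpa [chks, List.filterMap_cons, Item.erase] using ih
    | send => simpa [chks, eraseHist, Item.erase, eholds_cons] using ih
    | recv => simpa [chks, eraseHist, Item.erase, eholds_cons] using ih
    | spawn => simpa [chks, eraseHist, Item.erase, eholds_cons] using ih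

theorem chk_eq_none_iff {τ : Chk} {Δ : List (Item St V)} :
    chk τ Δ = none ↔ ¬ EHolds τ (eraseHist Δ) := by
  induction Δ with
  | nil => simp [chk, EHolds]
  | cons a Δ ih =>
    cases a with
    | check τ' s =>
      simp only [chk, eraseHist, Item.erase, List.filterMap_cons, eholds_cons, EItem.check.injEq]
      split_ifs with h
      · subst h
        simp
      · rw [ih]
        simp [h]
    | delayed τ' s => simpa [chk, List.filterMap_cons, Item.erase] using ih
    | send => simpa [chk, eraseHist, Item.erase, eholds_cons] using ih
    | recv => simpa [chk, eraseHist, Item.erase, eholds_cons] using ih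
    | spawn => simpa [chk, eraseHist, Item.erase, eholds_cons] using ih

/-- The bridge between `chk`, which the rollback rules use, and `back`, which sees only erased
histories. Delayed checkpoints contribute nothing to either. -/
theorem back_eraseHist_of_chk {τ : Chk} {Δ : List (Item St V)} {x : Extract St V}
    (h : chk τ Δ = some x) : ∃ n, back τ (eraseHist Δ) = some (n, x.state, eraseHist x.hist) ∧
      (∀ ℓ, ℓ ∈ x.tags ↔ ∃ q, EItem.send q ℓ ∈ n) ∧
      (∀ q, q ∈ x.deps ↔ (∃ ℓ, EItem.send q ℓ ∈ n) ∨ EItem.spawn q ∈ n) ∧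
      x.msgs.filterMap Comp.erase = (n.filterMap EItem.recvMsg? : List (EComp St V)) ∧
      ∀ c ∈ x.msgs, ∃ C y q ℓ v, c = Comp.msg C y q ℓ v := by
  induction Δ generalizing x with
  | nil => simp [chk] at h
  | cons a Δ ih =>
    cases a with
    | check τ' s =>
      simp only [chk] at h
      split_ifs at h with h1
      · subst h1
        simp only [Option.some.injEq] at h
        subst h
        exact ⟨[], by simp [eraseHist, Item.erase, back_check], by simp, by simp, by simp, by simp⟩
      · obtain ⟨n, hn, h2, h3, h4, h5⟩ := ih h
        refine ⟨.check τ' s :: n, ?_, by simpa using h2, by simpa using h3, ?_, h5⟩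
        · have : ∀ s', EItem.check τ' s ≠ .check (St := St) (V := V) τ s' := by
            intro s' hs; simp only [EItem.check.injEq] at hs; exact h1 hs.1
          simp only [eraseHist, Item.erase, List.filterMap_cons] at hn ⊢
          rw [back_cons this, hn]; rfl
        · rw [h4]; simp [List.filterMap_cons, EItem.recvMsg?]
    | delayed τ' s => exact ih h
    | send q ℓ =>
      simp only [chk, Option.map_eq_some_iff] at h
      obtain ⟨x, h, rfl⟩ := h
      obtain ⟨n, hn, h2, h3, h4, h5⟩ := ih h
      refine ⟨.send q ℓ :: n, ?_, ?_, ?_, ?_, h5⟩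
      · simp only [eraseHist, Item.erase, List.filterMap_cons] at hn ⊢
        rw [back, hn]; rfl
      · intro ℓ'
        simp [h2, exists_or]
      · intro q'
        simp [h3, exists_or, or_assoc]
      · rw [h4]; simp [List.filterMap_cons, EItem.recvMsg?]
    | recv C y q ℓ v =>
      simp only [chk, Option.map_eq_some_iff] at h
      obtain ⟨x, h, rfl⟩ := h
      obtain ⟨n, hn, h2, h3, h4, h5⟩ := ih h
      refine ⟨.recv y q ℓ v :: n, ?_, by simpa using h2, by simpa using h3, ?_, ?_⟩
      · simp only [eraseHist, Item.erase, List.filterMap_cons] at hn ⊢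
        rw [back, hn]; rfl
      · change (Comp.msg C y q ℓ v ::ₘ x.msgs).filterMap Comp.erase = _
        rw [Multiset.filterMap_cons_some Comp.erase _ _ (b := EComp.msg y q ℓ v) rfl, h4]
        simp [EItem.recvMsg?]
      · intro c hc
        rcases Multiset.mem_cons.1 hc with rfl | hc
        · exact ⟨_, _, _, _, _, rfl⟩
        · exact h5 c hc
    | spawn q =>
      simp only [chk, Option.map_eq_some_iff] at h
      obtain ⟨x, h, rfl⟩ := h
      obtain ⟨n, hn, h2, h3, h4, h5⟩ := ih h
      refine ⟨.spawn q :: n, ?_, by simpa using h2, ?_, ?_, h5⟩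
      · simp only [eraseHist, Item.erase, List.filterMap_cons] at hn ⊢
        rw [back, hn]; rfl
      · intro q'
        simp only [Finset.mem_insert, h3, List.mem_cons, reduceCtorEq, false_or,
          EItem.spawn.injEq]
        tauto
      · rw [h4]; simp [List.filterMap_cons, EItem.recvMsg?]

theorem erase_eq_check {a : Item St V} {τ : Chk} {s : Option St}
    (h : a.erase = some (.check τ s)) : a = .check τ s := by
  cases a <;> simp_all [Item.erase]

theorem erase_eq_send {a : Item St V} {q : Pid} {ℓ : Tag}
    (h : a.erase = some (.send q ℓ)) : a = .send q ℓ := by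
  cases a <;> simp_all [Item.erase]

theorem erase_eq_spawn {a : Item St V} {q : Pid}
    (h : a.erase = some (.spawn q)) : a = .spawn q := by
  cases a <;> simp_all [Item.erase]

theorem erase_eq_recv {a : Item St V} {y q : Pid} {ℓ : Tag} {v : V}
    (h : a.erase = some (.recv y q ℓ v)) : ∃ C, a = .recv C y q ℓ v := by
  cases a <;> simp_all [Item.erase]

theorem Holds.back_eraseHist {τ : Chk} {Δ newer older : List (Item St V)} {s : Option St}
    (h : Holds τ Δ newer s older) :
    back τ (eraseHist Δ) = some (eraseHist newer, s, eraseHist older) := by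
  rw [back_eq_some_iff]
  refine ⟨by simp [h.1, eraseHist, Item.erase], fun s' hs => h.2 ?_⟩
  exact mem_chks_iff.2 ⟨s', hs⟩

/-- Erasure keeps active checkpoints as they are, so the cut lifts; the delayed checkpoints directly
above it are put into the newer part. -/
theorem exists_holds_of_back {τ : Chk} {Δ : List (Item St V)} {n o : List (EItem St V)}
    {s : Option St} (h : back τ (eraseHist Δ) = some (n, s, o)) :
    ∃ newer older, Holds τ Δ newer s older ∧ eraseHist newer = n ∧ eraseHist older = o := by
  obtain ⟨h1, h2⟩ := back_eq_some_iff.1 h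
  obtain ⟨l₁, l₂, rfl, h3, h4⟩ := List.filterMap_eq_append_iff.1 h1
  obtain ⟨l₃, a, l₄, rfl, h5, h6, h7⟩ := List.filterMap_eq_cons_iff.1 h4
  obtain rfl := erase_eq_check h6
  refine ⟨l₁ ++ l₃, l₄, ⟨by simp, fun hc => ?_⟩, ?_, h7⟩
  · obtain ⟨s', hs⟩ := mem_chks_iff.1 hc
    simp only [eraseHist, List.filterMap_append, h3] at hs
    rw [List.filterMap_eq_nil_iff.2 h5, List.append_nil] at hs
    exact h2 s' hs
  · simp only [eraseHist, List.filterMap_append, h3]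
    rw [List.filterMap_eq_nil_iff.2 h5, List.append_nil]

theorem proc_mem_erase {S : Sys St V} {e : List (EItem St V)} {q : Pid} {s : Option St} :
    EComp.proc e q s ∈ S.filterMap Comp.erase ↔
      ∃ Δ m, Comp.proc Δ q s m ∈ S ∧ eraseHist Δ = e := by
  rw [Multiset.mem_filterMap]
  constructor
  · rintro ⟨c, hc, h⟩
    cases c with
    | proc Δ z s' m =>
      simp only [Comp.erase, Option.some.injEq, EComp.proc.injEq] at h
      obtain ⟨h1, rfl, rfl⟩ := h
      exact ⟨Δ, m, hc, h1⟩
    | msg => simp [Comp.erase] at h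
    | note => simp [Comp.erase] at h
  · rintro ⟨Δ, m, h, rfl⟩
    exact ⟨_, h, rfl⟩

theorem Since.erased {S : Sys St V} {τ : Chk} {q : Pid} {a : Item St V} {b : EItem St V}
    (h : Since S τ q a) (hb : a.erase = some b) : ESince (S.filterMap Comp.erase) τ q b := by
  obtain ⟨Δ, n, s, o, ⟨s', m, hm⟩, h1, h2⟩ := h
  refine ⟨_, _, proc_mem_erase.2 ⟨Δ, m, hm, rfl⟩, ?_⟩
  rw [since_of_back h1.back_eraseHist]
  exact List.mem_filterMap.2 ⟨a, h2, hb⟩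

theorem ESince.exists_since {S : Sys St V} {τ : Chk} {q : Pid} {b : EItem St V}
    (h : ESince (S.filterMap Comp.erase) τ q b) : ∃ a, a.erase = some b ∧ Since S τ q a := by
  obtain ⟨e, s, h1, h2⟩ := h
  obtain ⟨Δ, m, hm, rfl⟩ := proc_mem_erase.1 h1
  by_cases hh : EHolds τ (eraseHist Δ)
  · obtain ⟨n, s', o, hb⟩ := hh.exists_back
    obtain ⟨n', o', hn, rfl, rfl⟩ := exists_holds_of_back hb
    rw [since_of_back hb] at h2
    obtain ⟨a, ha, hab⟩ := List.mem_filterMap.1 h2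
    exact ⟨a, hab, Δ, n', s', o', ⟨s, m, hm⟩, hn, ha⟩
  · simp [since_of_not hh] at h2

/-- The position, counted from the oldest element, of the element of `Δ` that becomes the `k`-th
oldest element of the erased history. -/
def erasedIndex : List (Item St V) → ℕ → ℕ
  | [], _ => 0
  | _ :: Δ, k => if k < (eraseHist Δ).length then erasedIndex Δ k else Δ.length

theorem erasedIndex_eq {u v : List (Item St V)} {a : Item St V} {b : EItem St V}
    (h : a.erase = some b) : erasedIndex (u ++ a :: v) (eraseHist v).length = v.length := by
  induction u with
  | nil => simp [erasedIndex]
  | cons c u ih =>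
    rw [List.cons_append, erasedIndex, if_pos, ih]
    simp only [eraseHist, List.filterMap_append, List.filterMap_cons, h, List.length_append,
      List.length_cons]
    omega

theorem exists_split_of_lt {Δ : List (Item St V)} {k : ℕ} (h : k < (eraseHist Δ).length) :
    ∃ u a v b, Δ = u ++ a :: v ∧ a.erase = some b ∧ (eraseHist v).length = k := by
  induction Δ with
  | nil => simp at h
  | cons c Δ ih =>
    by_cases hk : k < (eraseHist Δ).length
    · obtain ⟨u, a, v, b, rfl, h1, h2⟩ := ih hk
      exact ⟨c :: u, a, v, b, rfl, h1, h2⟩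
    · cases hc : c.erase with
      | none =>
        simp only [eraseHist, List.filterMap_cons, hc] at h hk
        omega
      | some b =>
        refine ⟨[], c, Δ, b, rfl, hc, ?_⟩
        simp only [eraseHist, List.filterMap_cons, hc, List.length_cons] at h hk ⊢
        omega

theorem exists_split_of_eraseHist {Δ : List (Item St V)} {u v : List (EItem St V)}
    {b : EItem St V} (h : eraseHist Δ = u ++ b :: v) :
    ∃ u' a v', Δ = u' ++ a :: v' ∧ a.erase = some b ∧ eraseHist v' = v := by
  obtain ⟨l₁, l₂, rfl, h3, h4⟩ := List.filterMap_eq_append_iff.1 h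
  obtain ⟨l₃, a, l₄, rfl, h5, h6, h7⟩ := List.filterMap_eq_cons_iff.1 h4
  exact ⟨l₁ ++ l₃, a, l₄, by simp, h6, h7⟩

theorem erasedIndex_lt {Δ : List (Item St V)} {i j : ℕ} (hij : i < j)
    (hj : j < (eraseHist Δ).length) : erasedIndex Δ i < erasedIndex Δ j := by
  induction Δ with
  | nil => simp at hj
  | cons c Δ ih =>
    by_cases h : j < (eraseHist Δ).length
    · simpa [erasedIndex, h, hij.trans h] using ih h
    · have hi : i < (eraseHist Δ).length := by
        cases hc : c.erase with
        | none => simp only [eraseHist, List.filterMap_cons, hc] at hj h ⊢; omega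
        | some b =>
          simp only [eraseHist, List.filterMap_cons, hc, List.length_cons] at hj h ⊢
          omega
      obtain ⟨u, a, v, b, rfl, h1, h2⟩ := exists_split_of_lt hi
      rw [erasedIndex, if_pos hi, erasedIndex, if_neg h, ← h2, erasedIndex_eq h1]
      simp only [List.length_append, List.length_cons]
      omega

theorem reverse_getElem?_append {α : Type*} (u : List α) (a : α) (v : List α) :
    (u ++ a :: v).reverse[v.length]? = some a := by
  simp

theorem histOf_unique {p : Pid} {τ : Chk} {S : Sys St V} (hS : CompleteHistories p τ S)
    {q : Pid} {Δ Δ' : List (Item St V)} (h : HistOf S q Δ) (h' : HistOf S q Δ') : Δ = Δ' := by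
  obtain ⟨s, m, h⟩ := h
  obtain ⟨s', m', h'⟩ := h'
  have h1 : wsum (fun c : Comp St V => if c.pid? = some q then 1 else 0) S ≤ 1 := by
    rw [← count_filterMap_eq_wsum]
    exact Multiset.nodup_iff_count_le_one.1 hS.nodup_pids q
  have := eq_of_wsum_le_one h1 h h' (by simp [Comp.pid?]) (by simp [Comp.pid?])
  simp only [Comp.proc.injEq] at this
  exact this.1

/-- Erasing delayed checkpoints shifts positions, so the given times are reindexed by `erasedIndex`,
which is strictly increasing on each history. The choice `H` of one history per pid is harmless
because pids are unique. -/
theorem CompleteHistories.causal_erased {p : Pid} {τ : Chk} {S : Sys St V}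
    (hS : CompleteHistories p τ S) :
    ∃ t : Pid → ℕ → ℕ,
    (∀ e q s, EComp.proc e q s ∈ S.filterMap Comp.erase →
      ∀ i j, i < j → j < e.length → t q i < t q j) ∧
    (∀ e y s e' q s' u v u' v' ℓ w, EComp.proc e y s ∈ S.filterMap Comp.erase →
      EComp.proc e' q s' ∈ S.filterMap Comp.erase →
      e = u ++ .send q ℓ :: v → e' = u' ++ .recv y q ℓ w :: v' → t y v.length < t q v'.length) ∧
    (∀ e y s e' q s' u v j, EComp.proc e y s ∈ S.filterMap Comp.erase →
      EComp.proc e' q s' ∈ S.filterMap Comp.erase →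
      e = u ++ .spawn q :: v → j < e'.length → t y v.length < t q j) := by
  classical
  obtain ⟨t, t1, t2, t3⟩ := hS.causal
  let H : Pid → List (Item St V) := fun q => if h : ∃ Δ, HistOf S q Δ then h.choose else []
  have hH : ∀ q Δ, HistOf S q Δ → H q = Δ := by
    intro q Δ h
    have h' : ∃ Δ, HistOf S q Δ := ⟨Δ, h⟩
    simp only [H, dif_pos h']
    exact histOf_unique hS h'.choose_spec h
  refine ⟨fun q k => t q (erasedIndex (H q) k), ?_, ?_, ?_⟩
  · intro e q s he i j hij hj
    obtain ⟨Δ, m, hm, rfl⟩ := proc_mem_erase.1 he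
    dsimp only
    rw [hH q Δ ⟨_, _, hm⟩]
    exact t1 q (erasedIndex_lt hij hj)
  · intro e y s e' q s' u v u' v' ℓ w he he' h1 h2
    obtain ⟨Δ, m, hm, rfl⟩ := proc_mem_erase.1 he
    obtain ⟨Δ', m', hm', rfl⟩ := proc_mem_erase.1 he'
    obtain ⟨u₁, a, v₁, rfl, ha, rfl⟩ := exists_split_of_eraseHist h1
    obtain ⟨u₂, b, v₂, rfl, hb, rfl⟩ := exists_split_of_eraseHist h2
    obtain rfl := erase_eq_send ha
    obtain ⟨C, rfl⟩ := erase_eq_recv hb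
    dsimp only
    rw [hH y _ ⟨_, _, hm⟩, hH q _ ⟨_, _, hm'⟩, erasedIndex_eq ha, erasedIndex_eq hb]
    exact t2 y q _ _ _ _ ℓ C w ⟨_, _, hm⟩ ⟨_, _, hm'⟩ (reverse_getElem?_append _ _ _)
      (reverse_getElem?_append _ _ _)
  · intro e y s e' q s' u v j he he' h1 hj
    obtain ⟨Δ, m, hm, rfl⟩ := proc_mem_erase.1 he
    obtain ⟨Δ', m', hm', rfl⟩ := proc_mem_erase.1 he'
    obtain ⟨u₁, a, v₁, rfl, ha, rfl⟩ := exists_split_of_eraseHist h1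
    obtain rfl := erase_eq_spawn ha
    obtain ⟨u₂, b, v₂, c, rfl, hb, rfl⟩ := exists_split_of_lt hj
    dsimp only
    rw [hH y _ ⟨_, _, hm⟩, hH q _ ⟨_, _, hm'⟩, erasedIndex_eq ha, erasedIndex_eq hb]
    exact t3 y q _ _ _ _ ⟨_, _, hm⟩ ⟨_, _, hm'⟩ (reverse_getElem?_append _ _ _)
      (by simp only [List.length_append, List.length_cons]; omega)

/-- By `hfg`, `f` sees nothing that erasure forgets. This turns the `Nodup` assumptions on
identifiers into bounds on weights of the erased system. -/
theorem count_filterMap_items {β : Type*} [DecidableEq β] (f : Item St V → Option β)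
    (g : EItem St V → Option β) (hfg : ∀ a, f a = a.erase.bind g) (S : Sys St V) (b : β) :
    ((items S).filterMap f).count b =
      wsum (fun c => match c with
        | .proc e _ _ => (e.filterMap g).count b
        | .msg _ _ _ _ => 0) (S.filterMap Comp.erase) := by
  rw [items, Multiset.filterMap_bind, count_bind_eq_wsum, wsum_filterMap]
  congr 1
  funext c
  cases c with
  | proc Δ z s m =>
    have : f = fun a => a.erase.bind g := funext hfg
    simp [Comp.hist, Comp.erase, this, List.filterMap_filterMap]
  | _ => simp [Comp.hist, Comp.erase]

theorem DependsOn.erased {S : Sys St V} {τ : Chk} {p q : Pid} (h : DependsOn S τ p q) :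
    EDependsOn (S.filterMap Comp.erase) τ p q := by
  induction h with
  | refl => exact .refl
  | spawn _ h ih => exact .spawn ih (h.erased rfl)
  | message _ h h' ih => exact .message ih (h.erased rfl) (h'.erased rfl)

theorem count_since_le {β : Type*} [BEq β] (g : EItem St V → Option β) (τ : Chk)
    (e : List (EItem St V)) (b : β) :
    ((since τ e).filterMap g).count b ≤ (e.filterMap g).count b :=
  ((since_subset τ e).filterMap g).count_le b

theorem CompleteHistories.completeRecord {p : Pid} {τ : Chk} {S : Sys St V}
    (hS : CompleteHistories p τ S) : CompleteRecord p τ (S.filterMap Comp.erase) where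
  pid_le z := by
    have := Multiset.nodup_iff_count_le_one.1 hS.nodup_pids z
    rw [pids, count_filterMap_eq_wsum] at this
    rw [wsum_filterMap]
    refine le_trans (wsum_mono fun c _ => ?_) this
    cases c <;> simp [Comp.erase, pidW, Comp.pid?]
  tag_le ℓ := by
    have := Multiset.nodup_iff_count_le_one.1 hS.nodup_messages ℓ
    rw [Multiset.count_add, count_filterMap_items _ EItem.recvTag?, count_filterMap_eq_wsum] at this
    · refine le_trans (le_of_eq ?_) this
      rw [wsum_filterMap, wsum_filterMap, wsum, wsum, wsum, ← Multiset.sum_map_add]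
      congr 2
      funext c
      cases c <;> simp [Comp.erase, tagW, Comp.msgTag?]
    · intro a
      cases a <;> rfl
  send_le y q ℓ := by
    have := Multiset.nodup_iff_count_le_one.1 hS.nodup_sends ℓ
    rw [count_filterMap_items _ (fun a => a.sendKey?.map Prod.snd)] at this
    · refine le_trans (wsum_mono fun c _ => ?_) this
      cases c with
      | msg => simp [sendW]
      | proc e z s =>
        simp only [sendW]
        split_ifs
        · refine (count_since_le EItem.sendKey? _ _ _).trans ?_
          rw [← List.map_filterMap]
          exact List.count_le_count_map (f := (Prod.snd : Pid × Tag → Tag)) (x := (q, ℓ))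
        · omega
    · intro a
      cases a <;> rfl
  spawn_le q := by
    have := Multiset.nodup_iff_count_le_one.1 hS.nodup_spawns q
    rw [count_filterMap_items _ EItem.spawned?] at this
    · refine le_trans (wsum_mono fun c _ => ?_) this
      cases c with
      | msg => simp [spawnW]
      | proc e z s => exact count_since_le _ _ _ _
    · intro a
      cases a <;> rfl
  holds_once e q s he hh := by
    obtain ⟨Δ, m, hm, rfl⟩ := proc_mem_erase.1 he
    obtain ⟨n, s', o, hb⟩ := hh.exists_back
    obtain ⟨n', o', hn, rfl, rfl⟩ := exists_holds_of_back hb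
    rw [restore_of_back hb, ← mem_chks_iff]
    exact hS.holds_once q _ _ _ _ ⟨s, m, hm⟩ hn
  state_ne e q s he := by
    obtain ⟨Δ, m, hm, rfl⟩ := proc_mem_erase.1 he
    exact hS.state_ne_bot _ _ _ _ hm
  recv_dst e q s y z ℓ v he hr := by
    obtain ⟨Δ, m, hm, rfl⟩ := proc_mem_erase.1 he
    obtain ⟨a, ha, hab⟩ := List.mem_filterMap.1 hr
    obtain ⟨C, rfl⟩ := erase_eq_recv hab
    exact hS.recv_dst q _ _ _ _ _ _ ⟨s, m, hm⟩ ha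
  causal := hS.causal_erased
  sends y q ℓ h := by
    obtain ⟨a, ha, h⟩ := h.exists_since
    obtain rfl := erase_eq_send ha
    obtain ⟨h1, h2⟩ := hS.sends y q ℓ h
    refine ⟨?_, ?_⟩
    · obtain ⟨c, hc, h3⟩ := (Multiset.mem_filterMap _ _).1 h1
      cases c with
      | proc Δ z s m =>
        simp only [Comp.pid?, Option.some.injEq] at h3
        subst h3
        exact ⟨_, _, proc_mem_erase.2 ⟨_, _, hc, rfl⟩⟩
      | _ => simp [Comp.pid?] at h3
    · rcases h2 with ⟨C, v, h2⟩ | ⟨C, v, h2⟩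
      · have h3 : EComp.msg y q ℓ v ∈ S.filterMap Comp.erase :=
          (Multiset.mem_filterMap _ _).2 ⟨_, h2, rfl⟩
        have := le_wsum (f := msgW τ y q ℓ) h3
        simp only [msgW, if_true] at this
        omega
      · obtain ⟨e, s, h3, h4⟩ := h2.erased (b := .recv y q ℓ v) rfl
        have := le_wsum (f := msgW τ y q ℓ) h3
        refine lt_of_lt_of_le ?_ this
        simp only [msgW, List.count_pos_iff, List.mem_filterMap]
        exact ⟨_, h4, rfl⟩
  spawns y q h := by
    obtain ⟨a, ha, h⟩ := h.exists_since
    obtain rfl := erase_eq_spawn ha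
    obtain ⟨h1, Δ, n, o, ⟨s, m, hm⟩, h3, h4⟩ := hS.spawns y q h
    refine ⟨h1, _, _, proc_mem_erase.2 ⟨_, _, hm, rfl⟩, eholds_of_back h3.back_eraseHist, ?_, ?_⟩
    · rw [restore_of_back h3.back_eraseHist]
    · rw [restore_of_back h3.back_eraseHist]
      intro b hb
      obtain ⟨a, ha, hab⟩ := List.mem_filterMap.1 hb
      obtain ⟨τ', s', rfl | rfl⟩ := h4 a ha
      · simp only [Item.erase, Option.some.injEq] at hab
        exact ⟨τ', s', hab.symm⟩
      · simp [Item.erase] at hab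
  bot_spawned e q s he hh hn hq := by
    obtain ⟨Δ, m, hm, rfl⟩ := proc_mem_erase.1 he
    obtain ⟨n, s', o, hb⟩ := hh.exists_back
    obtain ⟨n', o', hn', rfl, rfl⟩ := exists_holds_of_back hb
    rw [restore_of_back hb] at hn
    dsimp only at hn
    subst hn
    obtain ⟨y, hy⟩ := hS.bot_spawned q _ _ _ ⟨s, m, hm⟩ hn' hq
    exact ⟨y, hy.erased rfl⟩
  depends e q s he hh := by
    obtain ⟨Δ, m, hm, rfl⟩ := proc_mem_erase.1 he
    obtain ⟨n, s', o, hb⟩ := hh.exists_back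
    obtain ⟨n', o', hn', rfl, rfl⟩ := exists_holds_of_back hb
    exact (hS.depends q _ _ _ _ ⟨s, m, hm⟩ hn').erased

/-! ### The system to which a rollback leads -/

/-- Process `y` sent a message tagged `ℓ` since `τ`. -/
def Sent (E : Multiset (EComp St V)) (τ : Chk) (y : Pid) (ℓ : Tag) : Prop :=
  ∃ q, ESince E τ y (.send q ℓ)

/-- Process `q` was spawned since `τ`. -/
def Spawned (E : Multiset (EComp St V)) (τ : Chk) (q : Pid) : Prop :=
  ∃ y, ESince E τ y (.spawn q)

/-- Process `y` has spawned or addressed `q` since `τ`. -/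
def Contacts (E : Multiset (EComp St V)) (τ : Chk) (y q : Pid) : Prop :=
  (∃ ℓ, ESince E τ y (.send q ℓ)) ∨ ESince E τ y (.spawn q)

/-- The component is a process, or a message which was not sent since `τ`. -/
def Kept (E : Multiset (EComp St V)) (τ : Chk) : EComp St V → Prop
  | .proc _ _ _ => True
  | .msg y _ ℓ _ => ¬ Sent E τ y ℓ

open Classical in
/-- What is left of a component other than `p` when the rollback of `p` to `τ` is done. -/
noncomputable def undone (p : Pid) (τ : Chk) (E : Multiset (EComp St V)) :
    EComp St V → Multiset (EComp St V)
  | .proc e z s =>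
    (if z = p ∨ Spawned E τ z then 0
      else {EComp.proc (restore τ e s).1 z (restore τ e s).2}) +
    Multiset.filter (Kept E τ) ↑((since τ e).filterMap EItem.recvMsg?)
  | .msg y q ℓ v => Multiset.filter (Kept E τ) {EComp.msg y q ℓ v}

/-- `E` fixes once and for all what counts as sent or spawned since `τ`, while `M` changes along a
derivation. With the two separated, the value can be a conserved quantity. -/
noncomputable def undoneSys (p : Pid) (τ : Chk) (E M : Multiset (EComp St V)) :
    Multiset (EComp St V) := M.bind (undone p τ E)

section

variable {p : Pid} {τ : Chk} {E : Multiset (EComp St V)}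

@[simp] theorem undoneSys_zero : undoneSys p τ E 0 = 0 := rfl

@[simp] theorem undoneSys_add (M N : Multiset (EComp St V)) :
    undoneSys p τ E (M + N) = undoneSys p τ E M + undoneSys p τ E N :=
  Multiset.add_bind _ _ _

@[simp] theorem undoneSys_cons (c : EComp St V) (M : Multiset (EComp St V)) :
    undoneSys p τ E (c ::ₘ M) = undone p τ E c + undoneSys p τ E M :=
  Multiset.cons_bind _ _ _

theorem filterMap_recvMsg_recv (y q : Pid) (ℓ : Tag) (v : V) (n : List (EItem St V)) :
    (EItem.recv y q ℓ v :: n).filterMap EItem.recvMsg? =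
      EComp.msg y q ℓ v :: n.filterMap EItem.recvMsg? := rfl

open Classical in
theorem undoneSys_recvMsg (n : List (EItem St V)) :
    undoneSys p τ E ↑(n.filterMap EItem.recvMsg?) =
      Multiset.filter (Kept E τ) ↑(n.filterMap EItem.recvMsg?) := by
  induction n with
  | nil => simp
  | cons a n ih =>
    cases a with
    | recv y q ℓ v =>
      rw [filterMap_recvMsg_recv, ← Multiset.cons_coe, undoneSys_cons, ih,
        ← Multiset.singleton_add (EComp.msg y q ℓ v), Multiset.filter_add]
      rfl
    | _ => rw [List.filterMap_cons_none rfl, ih]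

theorem undoneSys_eq_self {M : Multiset (EComp St V)} (h : ∀ c ∈ M, undone p τ E c = {c}) :
    undoneSys p τ E M = M := by
  induction M using Multiset.induction with
  | empty => rfl
  | cons c M ih =>
    rw [undoneSys_cons, h c (by simp), ih fun d hd => h d (by simp [hd]),
      Multiset.singleton_add]

/-- Each hypothesis disables one effect of `undone`: `hold` the cuts, `hsp` the deletion of spawned
processes, `hmsg` the filtering of messages. What remains is the omission of `p`, whose pid occurs
only once by `hpid`. -/
theorem undoneSys_eq_of_done {e : List (EItem St V)} {s : Option St} {M : Multiset (EComp St V)}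
    (hpid : ∀ z, wsum (pidW z) (.proc e p s ::ₘ M) ≤ 1)
    (hold : ∀ e' z s', EComp.proc e' z s' ∈ EComp.proc e p s ::ₘ M → ¬ EHolds τ e')
    (hsp : ∀ e' z s', EComp.proc e' z s' ∈ EComp.proc e p s ::ₘ M → ¬ Spawned E τ z)
    (hmsg : ∀ y q ℓ v, EComp.msg y q ℓ v ∈ EComp.proc e p s ::ₘ M → ¬ Sent E τ y ℓ) :
    undoneSys p τ E (.proc e p s ::ₘ M) = M := by
  classical
  have h0 : undone p τ E (.proc e p s) = 0 := by
    simp [undone, since_of_not (hold e p s (by simp))]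
  rw [undoneSys_cons, h0, zero_add]
  refine undoneSys_eq_self fun c hc => ?_
  cases c with
  | proc e' z s' =>
    have hz : z ≠ p := by
      rintro rfl
      have h1 := hpid z
      have h2 := le_wsum (f := pidW z) hc
      simp only [wsum_cons, pidW, if_true] at h1 h2
      omega
    have h1 := hold e' z s' (by simp [hc])
    simp [undone, since_of_not h1, restore_of_not h1, hz, hsp e' z s' (by simp [hc])]
  | msg y q ℓ v =>
    have h1 := hmsg y q ℓ v (by simp [hc])
    simp [undone, Kept, h1]

end

/-! ### Weights of components of the rollback recovery semantics -/

/-- A function on erased components, as a function on components. -/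
def onErased (f : EComp St V → ℕ) (c : Comp St V) : ℕ := c.erase.elim 0 f

theorem wsum_onErased (f : EComp St V → ℕ) (S : Sys St V) :
    wsum f (S.filterMap Comp.erase) = wsum (onErased f) S := wsum_filterMap _ _ _

@[simp] theorem onErased_proc (f : EComp St V → ℕ) (Δ : List (Item St V)) (z : Pid)
    (s : Option St) (m : Mode) : onErased f (.proc Δ z s m) = f (.proc (eraseHist Δ) z s) := rfl

@[simp] theorem onErased_msg (f : EComp St V → ℕ) (C : Finset Chk) (y q : Pid) (ℓ : Tag) (v : V) :
    onErased f (.msg C y q ℓ v) = f (.msg y q ℓ v) := rfl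

@[simp] theorem onErased_note (f : EComp St V → ℕ) (y q : Pid) (n : Note) :
    onErased f (.note y q n) = 0 := rfl

@[simp] theorem filterMap_erase_cons_proc (Δ : List (Item St V)) (z : Pid) (s : Option St)
    (m : Mode) (S : Sys St V) : (Comp.proc Δ z s m ::ₘ S).filterMap Comp.erase =
      EComp.proc (eraseHist Δ) z s ::ₘ S.filterMap Comp.erase :=
  Multiset.filterMap_cons_some Comp.erase _ _ rfl

@[simp] theorem filterMap_erase_cons_msg (C : Finset Chk) (y q : Pid) (ℓ : Tag) (v : V)
    (S : Sys St V) : (Comp.msg C y q ℓ v ::ₘ S).filterMap Comp.erase =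
      EComp.msg y q ℓ v ::ₘ S.filterMap Comp.erase :=
  Multiset.filterMap_cons_some Comp.erase _ _ rfl

@[simp] theorem filterMap_erase_cons_note (y q : Pid) (n : Note) (S : Sys St V) :
    (Comp.note y q n ::ₘ S).filterMap Comp.erase = S.filterMap Comp.erase :=
  Multiset.filterMap_cons_none _ _ rfl

@[simp] theorem filterMap_erase_proc (Δ : List (Item St V)) (z : Pid) (s : Option St)
    (m : Mode) : ({Comp.proc Δ z s m} : Sys St V).filterMap Comp.erase =
      {EComp.proc (eraseHist Δ) z s} := rfl

@[simp] theorem filterMap_erase_note (y q : Pid) (n : Note) :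
    ({Comp.note y q n} : Sys St V).filterMap Comp.erase = 0 := rfl

@[simp] theorem undoneSys_singleton {p : Pid} {τ : Chk} {E : Multiset (EComp St V)}
    (c : EComp St V) : undoneSys p τ E {c} = undone p τ E c := Multiset.singleton_bind _ _

/-- Process `z` still has to delete the message tagged `ℓ`. -/
def tagsW (z : Pid) (ℓ : Tag) : Comp St V → ℕ
  | .proc _ z' _ (.rolling _ _ _ L _) => if z' = z ∧ ℓ ∈ L then 1 else 0
  | _ => 0

/-- Process `y` waits for the rollback of `q`. -/
def depW (y q : Pid) : Comp St V → ℕ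
  | .proc _ z _ (.rolling _ _ _ _ P) => if z = y ∧ q ∈ P then 1 else 0
  | _ => 0

/-- Process `q` is rolling back on request of `y`. -/
def childW (y q : Pid) : Comp St V → ℕ
  | .proc _ z _ (.rolling _ _ pr _ _) => if z = q ∧ pr = y then 1 else 0
  | _ => 0

/-- Requests of `y` to `q`, and answers to them. -/
def noteW (y q : Pid) : Comp St V → ℕ
  | .note x z (.roll _ _) => if x = y ∧ z = q then 1 else 0
  | .note x z (.doneAsync _) => if x = q ∧ z = y then 1 else 0
  | .note x z (.doneSync _) => if x = q ∧ z = y then 1 else 0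
  | _ => 0

def doneW (q : Pid) : Comp St V → ℕ
  | .note x _ (.doneAsync _) => if x = q then 1 else 0
  | .note x _ (.doneSync _) => if x = q then 1 else 0
  | _ => 0

/-- Multisets of messages. -/
def AllMsgs (M : Sys St V) : Prop := ∀ c ∈ M, ∃ C y q ℓ v, c = Comp.msg C y q ℓ v

theorem AllMsgs.wsum_eq_zero {M : Sys St V} (h : AllMsgs M) {f : Comp St V → ℕ}
    (hf : ∀ C y q ℓ v, f (.msg C y q ℓ v) = 0) : wsum f M = 0 := by
  rw [wsum_eq_zero_iff]
  intro c hc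
  obtain ⟨C, y, q, ℓ, v, rfl⟩ := h c hc
  exact hf _ _ _ _ _

theorem wsum_rollNotes_eq_zero {f : Comp St V → ℕ} {z pτ : Pid} {τ : Chk} {P : Finset Pid}
    (hf : ∀ q, f (.note z q (.roll pτ τ)) = 0) : wsum f (rollNotes z pτ τ P) = 0 := by
  rw [wsum_eq_zero_iff]
  intro c hc
  obtain ⟨q, _, rfl⟩ := Multiset.mem_map.1 hc
  exact hf q

theorem wsum_noteW_rollNotes (y q z pτ : Pid) (τ : Chk) (P : Finset Pid) :
    wsum (noteW y q) (rollNotes (St := St) (V := V) z pτ τ P) = if z = y ∧ q ∈ P then 1 else 0 := by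
  rw [rollNotes, wsum_map]
  change ∑ q' ∈ P, _ = _
  by_cases h : z = y
  · simp [noteW, h]
  · simp [noteW, h]

theorem filterMap_erase_rollNotes (z pτ : Pid) (τ : Chk) (P : Finset Pid) :
    (rollNotes (St := St) (V := V) z pτ τ P).filterMap Comp.erase = 0 := by
  rw [Multiset.eq_zero_iff_forall_notMem]
  intro c hc
  obtain ⟨d, hd, h⟩ := (Multiset.mem_filterMap _ _).1 hc
  obtain ⟨q, _, rfl⟩ := Multiset.mem_map.1 hd
  simp [Comp.erase] at h

theorem wsum_tagW_recvMsg (ℓ : Tag) (n : List (EItem St V)) :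
    wsum (tagW ℓ) (↑(n.filterMap EItem.recvMsg?) : Multiset (EComp St V)) =
      (n.filterMap EItem.recvTag?).count ℓ := by
  induction n with
  | nil => simp
  | cons a n ih =>
    cases a with
    | recv y q ℓ' v =>
      rw [filterMap_recvMsg_recv, ← Multiset.cons_coe, wsum_cons, ih,
        List.filterMap_cons_some (f := EItem.recvTag?) (b := ℓ') rfl, List.count_cons]
      simp [tagW, add_comm]
    | _ => rw [List.filterMap_cons_none rfl, ih, List.filterMap_cons_none rfl]

theorem wsum_msgW_recvMsg (τ : Chk) (y q : Pid) (ℓ : Tag) (n : List (EItem St V)) :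
    wsum (msgW τ y q ℓ) (↑(n.filterMap EItem.recvMsg?) : Multiset (EComp St V)) =
      (n.filterMap EItem.recvKey?).count (y, q, ℓ) := by
  induction n with
  | nil => simp
  | cons a n ih =>
    cases a with
    | recv y' q' ℓ' v =>
      rw [filterMap_recvMsg_recv, ← Multiset.cons_coe, wsum_cons, ih,
        List.filterMap_cons_some (f := EItem.recvKey?) (b := (y', q', ℓ')) rfl, List.count_cons]
      simp [msgW, add_comm]
    | _ => rw [List.filterMap_cons_none rfl, ih, List.filterMap_cons_none rfl]

/-- A weight bounded by the number of processes with pid `z` is determined by the only process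
with this pid. -/
theorem wsum_eq_of_unique {α : Type*} {f g : α → ℕ} {M : Multiset α} {c : α}
    (hg : wsum g M ≤ 1) (hc : c ∈ M) (hgc : 0 < g c) (hfg : ∀ a, g a = 0 → f a = 0) :
    wsum f M = f c := by
  obtain ⟨T, rfl⟩ := Multiset.exists_cons_of_mem hc
  rw [wsum_cons] at hg ⊢
  have h1 : wsum g T = 0 := by omega
  have h2 : wsum f T = 0 := wsum_eq_zero_iff.2 fun a ha => hfg a (wsum_eq_zero_iff.1 h1 a ha)
  omega

section

variable {p : Pid} {τ : Chk} {E : Multiset (EComp St V)}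

theorem CompleteRecord.unique (hE : CompleteRecord p τ E) {e e' : List (EItem St V)}
    {z : Pid} {s s' : Option St} (h : EComp.proc e z s ∈ E) (h' : EComp.proc e' z s' ∈ E) :
    e = e' ∧ s = s' := by
  have := eq_of_wsum_le_one (hE.pid_le z) h h' (by simp [pidW]) (by simp [pidW])
  simpa using this

theorem CompleteRecord.esince_iff (hE : CompleteRecord p τ E) {e : List (EItem St V)}
    {z : Pid} {s : Option St} (h : EComp.proc e z s ∈ E) (a : EItem St V) :
    ESince E τ z a ↔ a ∈ since τ e := by
  constructor
  · rintro ⟨e', s', h', ha⟩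
    rwa [(hE.unique h h').1]
  · intro ha
    exact ⟨e, s, h, ha⟩

theorem ESince.exists_holds {z : Pid} {a : EItem St V} (h : ESince E τ z a) :
    ∃ e s, EComp.proc e z s ∈ E ∧ EHolds τ e := by
  obtain ⟨e, s, h1, h2⟩ := h
  refine ⟨e, s, h1, ?_⟩
  by_contra hc
  simp [since_of_not hc] at h2

theorem CompleteRecord.spawned_holds (hE : CompleteRecord p τ E) {e : List (EItem St V)}
    {z : Pid} {s : Option St} (h : EComp.proc e z s ∈ E) (hz : Spawned E τ z) :
    z ≠ p ∧ EHolds τ e ∧ (restore τ e s).2 = none ∧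
      ∀ a ∈ (restore τ e s).1, ∃ τ' s, a = .check τ' s := by
  obtain ⟨y, hy⟩ := hz
  obtain ⟨h1, e', s', h2, h3⟩ := hE.spawns y z hy
  obtain ⟨rfl, rfl⟩ := hE.unique h h2
  exact ⟨h1, h3⟩

theorem CompleteRecord.spawned_ne (hE : CompleteRecord p τ E) {z : Pid} (hz : Spawned E τ z) :
    z ≠ p := by
  obtain ⟨y, hy⟩ := hz
  exact (hE.spawns y z hy).1

end

/-! ### Invariants of rollback derivations -/

/-- `orig` says that a rollback would restore now what it would have restored at the start, and that
a holder of `τ` has not moved. By `spawned`, a spawned process that lost `τ` is on its way to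
deletion. `rolling` confines all activity to `τ`, with an initiator that is `p` or foreign to the
system. -/
structure ProcOK (p : Pid) (τ : Chk) (E : Multiset (EComp St V)) (Δ : List (Item St V)) (z : Pid)
    (s : Option St) (m : Mode) : Prop where
  orig : ∃ e₀ s₀, EComp.proc e₀ z s₀ ∈ E ∧ restore τ (eraseHist Δ) s = restore τ e₀ s₀ ∧
    (EHolds τ (eraseHist Δ) → m = .normal ∧ eraseHist Δ = e₀)
  bot : s = none → z = p ∨ Spawned E τ z
  spawned : Spawned E τ z →
    EHolds τ (eraseHist Δ) ∨ ((∃ τ' pτ pr L P, m = .rolling τ' pτ pr L P) ∧ s = none)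
  rolling : ∀ τ' pτ pr L P, m = .rolling τ' pτ pr L P →
    τ' = τ ∧ (pτ = p ∨ ∀ e s, EComp.proc e pτ s ∉ E) ∧ ∀ ℓ ∈ L, Sent E τ z ℓ

structure RollOK (p : Pid) (τ : Chk) (E : Multiset (EComp St V)) (z pτ : Pid) (τ' : Chk) :
    Prop where
  chk_eq : τ' = τ
  initiator : pτ = p ∨ ∀ e s, EComp.proc e pτ s ∉ E
  dst_mem : ∃ e s, EComp.proc e z s ∈ E

def CompOK (p : Pid) (τ : Chk) (E : Multiset (EComp St V)) : Comp St V → Prop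
  | .proc Δ z s m => ProcOK p τ E Δ z s m
  | .note _ z (.roll pτ τ') => RollOK p τ E z pτ τ'
  | .note _ _ (.doneAsync τ') => τ' = τ
  | .note _ _ (.doneSync τ') => τ' = τ
  | _ => True

/-! ### Effect of a single rollback rule on the weights -/

section

variable {p : Pid} {τ : Chk} {E : Multiset (EComp St V)}

/-- Hence `resume1` is reserved for `p`; any other process must report to its requester. -/
theorem ProcOK.ne_initiator {Δ : List (Item St V)} {z τ' pτ pr : Pid} {s : Option St} {L P}
    (h : ProcOK p τ E Δ z s (.rolling τ' pτ pr L P)) (hz : z ≠ p) : z ≠ pτ := by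
  rintro rfl
  obtain ⟨e₀, s₀, h1, -⟩ := h.orig
  rcases (h.rolling _ _ _ _ _ rfl).2.1 with h2 | h2
  · exact hz h2
  · exact h2 _ _ h1

theorem ProcOK.not_holds {Δ : List (Item St V)} {z : Pid} {s : Option St} {m : Mode}
    (h : ProcOK p τ E Δ z s m) (hm : m ≠ .normal) : ¬ EHolds τ (eraseHist Δ) := by
  obtain ⟨_, _, _, _, h3⟩ := h.orig
  exact fun hh => hm (h3 hh).1

/-- The data of a rollback to `τ`. -/
structure Cut (τ : Chk) (E : Multiset (EComp St V)) (Δ : List (Item St V)) (z : Pid)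
    (x : Extract St V) (n : List (EItem St V)) : Prop where
  mem : ∃ s₀, EComp.proc (eraseHist Δ) z s₀ ∈ E
  back_eq : back τ (eraseHist Δ) = some (n, x.state, eraseHist x.hist)
  not_holds : ¬ EHolds τ (eraseHist x.hist)
  mem_tags : ∀ ℓ, ℓ ∈ x.tags ↔ Sent E τ z ℓ
  mem_deps : ∀ q, q ∈ x.deps ↔ Contacts E τ z q
  erase_msgs : x.msgs.filterMap Comp.erase = ↑(n.filterMap EItem.recvMsg?)
  allMsgs : AllMsgs x.msgs

/-- A holder of `τ` still has its initial history, so the extracted tags and dependencies are those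
given by the relations `Sent` and `Contacts` of `E`; `holds_once` excludes a second `τ` below the
cut. -/
theorem ProcOK.cut (hE : CompleteRecord p τ E) {Δ : List (Item St V)} {z : Pid} {s : Option St}
    {m : Mode} (h : ProcOK p τ E Δ z s m) {x : Extract St V} (hx : chk τ Δ = some x) :
    ∃ n, Cut τ E Δ z x n := by
  obtain ⟨n, h1, h2, h3, h4, h5⟩ := back_eraseHist_of_chk hx
  have hh := eholds_of_back h1
  obtain ⟨e₀, s₀, h6, -, h7⟩ := h.orig
  obtain ⟨-, rfl⟩ := h7 hh
  have h8 := hE.holds_once _ _ _ h6 hh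
  rw [restore_of_back h1] at h8
  refine ⟨n, ⟨⟨s₀, h6⟩, h1, h8, fun ℓ => ?_, fun q => ?_, h4, h5⟩⟩
  · rw [h2]
    refine exists_congr fun q => ?_
    rw [hE.esince_iff h6, since_of_back h1]
  · rw [h3, Contacts, hE.esince_iff h6, since_of_back h1]
    refine or_congr (exists_congr fun ℓ => ?_) Iff.rfl
    rw [hE.esince_iff h6, since_of_back h1]

/-- The components consumed and produced by rule Roll1. -/
abbrev rollLhs (x' z pτ : Pid) (τ : Chk) (Δ : List (Item St V)) (s : Option St) : Sys St V :=
  {.note x' z (.roll pτ τ), .proc Δ z s .normal}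

abbrev rollRhs (x' z pτ : Pid) (τ : Chk) (x : Extract St V) : Sys St V :=
  .proc x.hist z x.state (.rolling τ pτ x' x.tags x.deps) ::ₘ
    (rollNotes z pτ τ x.deps + x.msgs)

/-- The rules of a rollback other than Rollback, with the data of `Cut` in the case of Roll1. -/
theorem rule_cases (hE : CompleteRecord p τ E) {A B : Sys St V}
    (h : Roll1Rule A B ∨ UndoRule A B) (hA : ∀ c ∈ A, CompOK p τ E c) {motive : Prop}
    (roll1 : ∀ x' z pτ Δ s x n, A = rollLhs x' z pτ τ Δ s → B = rollRhs x' z pτ τ x →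
      Cut τ E Δ z x n → motive) (undo : UndoRule A B → motive) : motive := by
  rcases h with h | h
  · cases h with
    | @roll1 Δ z s x' pτ τ' x hx =>
      have h1 : RollOK p τ E z pτ τ' := hA (.note x' z (.roll pτ τ')) (by simp)
      obtain rfl := h1.chk_eq
      have h2 : ProcOK p τ' E Δ z s .normal := hA (.proc Δ z s .normal) (by simp)
      obtain ⟨n, hn⟩ := h2.cut hE hx
      exact roll1 x' z pτ Δ s x n rfl rfl hn
  · exact undo h

theorem wsum_pidW_le (hE : CompleteRecord p τ E) {A B : Sys St V}
    (h : Roll1Rule A B ∨ UndoRule A B) (hA : ∀ c ∈ A, CompOK p τ E c) (w : Pid) :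
    wsum (onErased (pidW w)) B ≤ wsum (onErased (pidW w)) A := by
  refine rule_cases hE h hA ?_ ?_
  · rintro x' z pτ Δ s x n rfl rfl hc
    rw [rollRhs, wsum_cons, wsum_add, wsum_rollNotes_eq_zero (by simp),
      hc.allMsgs.wsum_eq_zero (by simp [pidW])]
    simp [pidW]
  · intro h
    cases h <;> simp [pidW]

theorem wsum_holdW_le (hE : CompleteRecord p τ E) {A B : Sys St V}
    (h : Roll1Rule A B ∨ UndoRule A B) (hA : ∀ c ∈ A, CompOK p τ E c) (w : Pid) :
    wsum (onErased (holdW τ w)) B ≤ wsum (onErased (holdW τ w)) A := by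
  refine rule_cases hE h hA ?_ ?_
  · rintro x' z pτ Δ s x n rfl rfl hc
    rw [rollRhs, wsum_cons, wsum_add, wsum_rollNotes_eq_zero (by simp),
      hc.allMsgs.wsum_eq_zero (by simp [holdW])]
    simp [holdW, hc.not_holds]
  · intro h
    cases h <;> simp [holdW]

theorem wsum_onErased_eq {f : EComp St V → ℕ} {M : Sys St V} {l : List (EComp St V)}
    (h : M.filterMap Comp.erase = ↑l) :
    wsum (onErased f) M = wsum f (↑l : Multiset (EComp St V)) := by
  rw [← wsum_onErased, h]

/-- For `Inv.tag_le`: when the sender `w` loses `τ` by Roll1, `ℓ` becomes one of its pending tags,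
and a tag leaves this set only when Undo-send deletes a message that carries it. Roll1 otherwise
moves messages from a history to the network without changing their number. -/
theorem wsum_tagW_add_le (hE : CompleteRecord p τ E) {A B : Sys St V}
    (h : Roll1Rule A B ∨ UndoRule A B) (hA : ∀ c ∈ A, CompOK p τ E c) {w : Pid} {ℓ : Tag}
    (hs : Sent E τ w ℓ) :
    wsum (onErased (tagW ℓ)) B + wsum (onErased (holdW τ w)) A + wsum (tagsW w ℓ) A ≤
      wsum (onErased (tagW ℓ)) A + wsum (onErased (holdW τ w)) B + wsum (tagsW w ℓ) B := by
  refine rule_cases hE h hA ?_ ?_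
  · rintro x' z pτ Δ s x n rfl rfl hc
    rw [rollRhs, wsum_cons, wsum_add, wsum_rollNotes_eq_zero (by simp),
      wsum_onErased_eq hc.erase_msgs, wsum_tagW_recvMsg, wsum_cons, wsum_add,
      wsum_rollNotes_eq_zero (by simp), hc.allMsgs.wsum_eq_zero (by simp [holdW]),
      wsum_cons, wsum_add, wsum_rollNotes_eq_zero (by simp [tagsW]),
      hc.allMsgs.wsum_eq_zero (by simp [tagsW])]
    have h1 := (back_eq_some_iff.1 hc.back_eq).1
    have h2 : (eraseHist Δ).filterMap EItem.recvTag? = n.filterMap EItem.recvTag? ++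
        (eraseHist x.hist).filterMap EItem.recvTag? := by
      rw [h1, List.filterMap_append, List.filterMap_cons_none rfl]
    simp only [Multiset.insert_eq_cons, wsum_cons, wsum_singleton, onErased_note, onErased_proc,
      tagW, h2, List.count_append, holdW, tagsW, hc.not_holds, eholds_of_back hc.back_eq]
    by_cases hz : z = w
    · subst hz
      simp [(hc.mem_tags ℓ).2 hs]
      omega
    · simp [hz]
      omega
  · intro h
    cases h with
    | @undoSend Δ z s p' C ℓ' v τ' pτ pr L P hℓ =>
      simp only [Multiset.insert_eq_cons, wsum_cons, wsum_singleton, onErased_proc, onErased_msg,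
        tagW, tagsW, holdW, Finset.mem_erase]
      by_cases h1 : ℓ' = ℓ
      · subst h1
        by_cases h2 : z = w <;> simp [h2, hℓ]
      · have : ℓ ≠ ℓ' := fun h => h1 h.symm
        simp [h1, this]
    | @resume2 Δ z τ' pτ pr =>
      have h1 : ProcOK p τ E Δ z none (.rolling τ' pτ pr ∅ ∅) :=
        hA (.proc Δ z none (.rolling τ' pτ pr ∅ ∅)) (by simp)
      simp [holdW, tagsW, h1.not_holds]
    | _ => simp [tagW, holdW, tagsW]

/-- A process that loses `τ` starts to wait for all its contacts. It stops waiting for `q` only by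
consuming an answer of `q`, which the term in `doneW` pays for. -/
theorem wsum_edge (hE : CompleteRecord p τ E) {A B : Sys St V}
    (h : Roll1Rule A B ∨ UndoRule A B) (hA : ∀ c ∈ A, CompOK p τ E c) {y q : Pid}
    (hs : Contacts E τ y q) :
    wsum (onErased (holdW τ q)) B + wsum (onErased (holdW τ y)) A + wsum (depW y q) A ≤
      wsum (onErased (holdW τ q)) A + wsum (onErased (holdW τ y)) B + wsum (depW y q) B +
        wsum (doneW q) A := by
  refine rule_cases hE h hA ?_ ?_
  · rintro x' z pτ Δ s x n rfl rfl hc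
    simp only [rollRhs, wsum_cons, wsum_add]
    rw [wsum_rollNotes_eq_zero (f := onErased (holdW τ q)) (by simp),
      hc.allMsgs.wsum_eq_zero (f := onErased (holdW τ q)) (by simp [holdW]),
      wsum_rollNotes_eq_zero (f := onErased (holdW τ y)) (by simp),
      hc.allMsgs.wsum_eq_zero (f := onErased (holdW τ y)) (by simp [holdW]),
      wsum_rollNotes_eq_zero (f := depW y q) (by simp [depW]),
      hc.allMsgs.wsum_eq_zero (f := depW y q) (by simp [depW])]
    simp only [Multiset.insert_eq_cons, wsum_cons, wsum_singleton, onErased_note, onErased_proc,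
      holdW, depW, doneW, hc.not_holds, eholds_of_back hc.back_eq]
    by_cases hz : z = y
    · subst hz
      simp [(hc.mem_deps q).2 hs]
    · simp [hz]
  · intro h
    cases h with
    | @undoDep1 Δ z s p' τ' pτ pr P =>
      simp only [Multiset.insert_eq_cons, wsum_cons, wsum_singleton, onErased_proc, onErased_note,
        holdW, depW, doneW, Finset.mem_erase]
      by_cases h1 : q = p'
      · subst h1
        simp only [if_true]; split_ifs <;> simp_all
      · simp [h1]
    | @undoDep2 Δ z s p' τ' pτ pr P =>
      simp only [Multiset.insert_eq_cons, wsum_cons, wsum_singleton, onErased_proc, onErased_note,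
        holdW, depW, doneW, Finset.mem_erase]
      by_cases h1 : q = p'
      · subst h1
        simp only [if_true]; split_ifs <;> simp_all
      · simp [h1]
    | @resume2 Δ z τ' pτ pr =>
      have h1 : ProcOK p τ E Δ z none (.rolling τ' pτ pr ∅ ∅) :=
        hA (.proc Δ z none (.rolling τ' pτ pr ∅ ∅)) (by simp)
      simp [holdW, depW, h1.not_holds]
    | _ => simp [holdW, depW, doneW]

/-- A dependency is created together with a token: first a request, then possibly a process rolling
back on this request, then an answer. Consuming the answer removes the dependency, so tokens never
outnumber dependencies. -/
theorem wsum_tok (hE : CompleteRecord p τ E) {A B : Sys St V}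
    (h : Roll1Rule A B ∨ UndoRule A B) (hA : ∀ c ∈ A, CompOK p τ E c) (y q : Pid) :
    wsum (noteW y q) B + wsum (childW y q) B + wsum (depW y q) A ≤
      wsum (noteW y q) A + wsum (childW y q) A + wsum (depW y q) B := by
  refine rule_cases hE h hA ?_ ?_
  · rintro x' z pτ Δ s x n rfl rfl hc
    simp only [rollRhs, wsum_cons, wsum_add]
    rw [wsum_noteW_rollNotes,
      hc.allMsgs.wsum_eq_zero (f := noteW y q) (by simp [noteW]),
      wsum_rollNotes_eq_zero (f := childW y q) (by simp [childW]),
      hc.allMsgs.wsum_eq_zero (f := childW y q) (by simp [childW]),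
      wsum_rollNotes_eq_zero (f := depW y q) (by simp [depW]),
      hc.allMsgs.wsum_eq_zero (f := depW y q) (by simp [depW])]
    simp only [Multiset.insert_eq_cons, wsum_cons, wsum_singleton, noteW, childW, depW,
      and_comm (a := x' = y)]
    omega
  · intro h
    cases h with
    | @undoDep1 Δ z s p' τ' pτ pr P =>
      simp only [Multiset.insert_eq_cons, wsum_cons, wsum_singleton, noteW, childW, depW,
        Finset.mem_erase]
      by_cases h1 : q = p'
      · subst h1
        simp only [true_and]; split_ifs <;> simp_all
      · simp [h1]
    | @undoDep2 Δ z s p' τ' pτ pr P =>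
      simp only [Multiset.insert_eq_cons, wsum_cons, wsum_singleton, noteW, childW, depW,
        Finset.mem_erase]
      by_cases h1 : q = p'
      · subst h1
        simp only [true_and]; split_ifs <;> simp_all
      · simp [h1]
    | roll2 => simp [noteW, childW, depW, and_comm]
    | roll3 => simp [noteW, childW, depW, and_comm, add_comm]
    | _ => simp [noteW, childW, depW]

/-- Answers come only from processes that are rolling back, and these no longer hold `τ`. This
maintains `Inv.done`. -/
theorem exists_rolling_of_doneW (hE : CompleteRecord p τ E) {A B : Sys St V}
    (h : Roll1Rule A B ∨ UndoRule A B) (hA : ∀ c ∈ A, CompOK p τ E c) {q : Pid}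
    (hq : wsum (doneW q) A < wsum (doneW q) B) :
    ∃ Δ s τ' pτ pr L P, Comp.proc Δ q s (.rolling τ' pτ pr L P) ∈ A := by
  revert hq
  refine rule_cases hE h hA ?_ ?_
  · rintro x' z pτ Δ s x n rfl rfl hc
    simp only [rollRhs, wsum_cons, wsum_add]
    rw [wsum_rollNotes_eq_zero (f := doneW q) (by simp [doneW]),
      hc.allMsgs.wsum_eq_zero (f := doneW q) (by simp [doneW])]
    simp [doneW]
  · intro h hq
    cases h with
    | @roll3 Δ z s p' pτ τ₁ τ' p₁ p₂ L P =>
      simp only [Multiset.insert_eq_cons, wsum_cons, wsum_singleton, doneW] at hq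
      split_ifs at hq with h1
      · subst h1
        exact ⟨Δ, s, τ', p₁, p₂, L, P, by simp⟩
      · omega
    | @resume2 Δ z τ' pτ pr =>
      simp only [wsum_singleton, doneW] at hq
      split_ifs at hq with h1
      · subst h1
        exact ⟨Δ, none, τ', pτ, pr, ∅, ∅, by simp⟩
      · omega
    | @resume3 Δ z s τ' pτ pr =>
      simp only [Multiset.insert_eq_cons, wsum_cons, wsum_singleton, doneW] at hq
      split_ifs at hq with h1
      · subst h1
        exact ⟨Δ, s, τ', pτ, pr, ∅, ∅, by simp⟩
      · omega
    | _ => simp [doneW] at hq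

theorem undone_eq_of_not_holds {e : List (EItem St V)} {z : Pid} {s : Option St}
    (h : ¬ EHolds τ e) (hz : z = p ∨ Spawned E τ z) : undone p τ E (.proc e z s) = 0 := by
  simp [undone, since_of_not h, hz]

/-- The conservation law. Roll1 performs a cut, and releases messages, that `undone` accounts for
already; Undo-send deletes a message that `Kept` rejects; a process deleted by Resume has a null
state, hence is `p` or spawned since `τ`, and contributes nothing. -/
theorem undoneSys_rule (hE : CompleteRecord p τ E) {A B : Sys St V}
    (h : Roll1Rule A B ∨ UndoRule A B) (hA : ∀ c ∈ A, CompOK p τ E c) :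
    undoneSys p τ E (B.filterMap Comp.erase) = undoneSys p τ E (A.filterMap Comp.erase) := by
  refine rule_cases hE h hA ?_ ?_
  · rintro x' z pτ Δ s x n rfl rfl hc
    rw [rollRhs, filterMap_erase_cons_proc, Multiset.filterMap_add, filterMap_erase_rollNotes,
      hc.erase_msgs, zero_add, undoneSys_cons, undoneSys_recvMsg]
    simp [undone, since_of_not hc.not_holds,
      restore_of_not hc.not_holds, since_of_back hc.back_eq, restore_of_back hc.back_eq]
  · intro h
    cases h with
    | @undoSend Δ z s p' C ℓ v τ' pτ pr L P hℓ =>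
      have h1 : ProcOK p τ E Δ z s (.rolling τ' pτ pr L P) :=
        hA (.proc Δ z s (.rolling τ' pτ pr L P)) (by simp)
      have h2 := (h1.rolling _ _ _ _ _ rfl).2.2 ℓ hℓ
      simp [Kept, undone, h2, Multiset.filter_singleton]
    | @resume2 Δ z τ' pτ pr hz =>
      have h1 : ProcOK p τ E Δ z none (.rolling τ' pτ pr ∅ ∅) :=
        hA (.proc Δ z none (.rolling τ' pτ pr ∅ ∅)) (by simp)
      simp [undone_eq_of_not_holds (s := none) (h1.not_holds (by simp)) (h1.bot rfl)]
    | _ => simp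

/-- Two points need the assumptions. A null state restored by Roll1 belongs to `p` or to a process
spawned since `τ`, by `bot_spawned`. And since `resume3` requires a proper state, a spawned process
that has lost `τ` leaves the rolling mode only by being deleted. -/
theorem compOK_rule (hE : CompleteRecord p τ E) {A B : Sys St V}
    (h : Roll1Rule A B ∨ UndoRule A B) (hA : ∀ c ∈ A, CompOK p τ E c) :
    ∀ c ∈ B, CompOK p τ E c := by
  refine rule_cases hE h hA ?_ ?_
  · rintro x' z pτ Δ s x n rfl rfl hc c hcB
    have h1 : RollOK p τ E z pτ τ := hA (.note x' z (.roll pτ τ)) (by simp)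
    obtain ⟨s₀, hs₀⟩ := hc.mem
    have hh := eholds_of_back hc.back_eq
    rcases Multiset.mem_cons.1 hcB with rfl | hcB
    · refine ⟨⟨_, _, hs₀, ?_, ?_⟩, ?_, ?_, ?_⟩
      · rw [restore_of_not hc.not_holds, restore_of_back hc.back_eq]
      · exact fun h => absurd h hc.not_holds
      · intro hn
        by_cases hz : z = p
        · exact .inl hz
        · refine .inr (hE.bot_spawned _ _ _ hs₀ hh ?_ hz)
          rw [restore_of_back hc.back_eq]
          exact hn
      · intro hz
        have := (hE.spawned_holds hs₀ hz).2.2.1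
        rw [restore_of_back hc.back_eq] at this
        exact .inr ⟨⟨_, _, _, _, _, rfl⟩, this⟩
      · intro τ' pτ' pr L P hm
        cases hm
        exact ⟨rfl, h1.initiator, fun ℓ hℓ => (hc.mem_tags ℓ).1 hℓ⟩
    · rcases Multiset.mem_add.1 hcB with hcB | hcB
      · obtain ⟨q, hq, rfl⟩ := Multiset.mem_map.1 hcB
        refine ⟨rfl, h1.initiator, ?_⟩
        rcases (hc.mem_deps q).1 hq with ⟨ℓ, hℓ⟩ | hsp
        · exact (hE.sends _ _ _ hℓ).1
        · obtain ⟨-, e, s', he, -⟩ := hE.spawns _ _ hsp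
          exact ⟨e, s', he⟩
      · obtain ⟨C, y, q, ℓ, v, rfl⟩ := hc.allMsgs c hcB
        trivial
  · intro h
    cases h with
    | @roll2 Δ z s p' pτ τ' hτ =>
      have h1 : RollOK p τ E z pτ τ' := hA (.note p' z (.roll pτ τ')) (by simp)
      have h2 : ProcOK p τ E Δ z s .normal := hA (.proc Δ z s .normal) (by simp)
      obtain rfl := h1.chk_eq
      rw [mem_chks_iff] at hτ
      intro c hc
      rw [Multiset.mem_singleton.1 hc]
      refine ⟨?_, h2.bot, ?_, ?_⟩
      · obtain ⟨e₀, s₀, h3, h4, -⟩ := h2.orig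
        exact ⟨e₀, s₀, h3, h4, fun h => absurd h hτ⟩
      · intro hz
        rcases h2.spawned hz with h | ⟨⟨_, _, _, _, _, h⟩, -⟩
        · exact .inl h
        · cases h
      · intro τ' pτ' pr L P hm
        cases hm
        exact ⟨rfl, h1.initiator, by simp⟩
    | @roll3 Δ z s p' pτ τ₁ τ' p₁ p₂ L P =>
      have h2 : ProcOK p τ E Δ z s (.rolling τ' p₁ p₂ L P) :=
        hA (.proc Δ z s (.rolling τ' p₁ p₂ L P)) (by simp)
      have h1 : RollOK p τ E z pτ τ₁ := hA (.note p' z (.roll pτ τ₁)) (by simp)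
      simpa [CompOK, h1.chk_eq] using h2
    | @undoSend Δ z s p' C ℓ v τ' pτ pr L P hℓ =>
      have h2 : ProcOK p τ E Δ z s (.rolling τ' pτ pr L P) :=
        hA (.proc Δ z s (.rolling τ' pτ pr L P)) (by simp)
      intro c hc
      rw [Multiset.mem_singleton.1 hc]
      refine ⟨?_, h2.bot, ?_, ?_⟩
      · obtain ⟨e₀, s₀, h3, h4, h5⟩ := h2.orig
        exact ⟨e₀, s₀, h3, h4, fun h => absurd (h5 h).1 (by simp)⟩
      · intro hz
        exact (h2.spawned hz).imp_right fun h => ⟨⟨_, _, _, _, _, rfl⟩, h.2⟩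
      · intro τ'' pτ' pr' L' P' hm
        cases hm
        obtain ⟨h3, h4, h5⟩ := h2.rolling _ _ _ _ _ rfl
        exact ⟨h3, h4, fun ℓ' h => h5 ℓ' (Finset.mem_of_mem_erase h)⟩
    | @undoDep1 Δ z s p' τ' pτ pr P =>
      have h2 : ProcOK p τ E Δ z s (.rolling τ' pτ pr ∅ P) :=
        hA (.proc Δ z s (.rolling τ' pτ pr ∅ P)) (by simp)
      intro c hc
      rw [Multiset.mem_singleton.1 hc]
      refine ⟨?_, h2.bot, ?_, ?_⟩
      · obtain ⟨e₀, s₀, h3, h4, h5⟩ := h2.orig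
        exact ⟨e₀, s₀, h3, h4, fun h => absurd (h5 h).1 (by simp)⟩
      · intro hz
        exact (h2.spawned hz).imp_right fun h => ⟨⟨_, _, _, _, _, rfl⟩, h.2⟩
      · intro τ'' pτ' pr' L' P' hm
        cases hm
        exact h2.rolling _ _ _ _ _ rfl
    | @undoDep2 Δ z s p' τ' pτ pr P =>
      have h2 : ProcOK p τ E Δ z s (.rolling τ' pτ pr ∅ P) :=
        hA (.proc Δ z s (.rolling τ' pτ pr ∅ P)) (by simp)
      intro c hc
      rcases Multiset.mem_cons.1 hc with rfl | hc
      · refine ⟨?_, h2.bot, ?_, ?_⟩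
        · obtain ⟨e₀, s₀, h3, h4, h5⟩ := h2.orig
          exact ⟨e₀, s₀, h3, h4, fun h => absurd (h5 h).1 (by simp)⟩
        · intro hz
          exact (h2.spawned hz).imp_right fun h => ⟨⟨_, _, _, _, _, rfl⟩, h.2⟩
        · intro τ'' pτ' pr' L' P' hm
          cases hm
          exact h2.rolling _ _ _ _ _ rfl
      · rw [Multiset.mem_singleton.1 hc]
        trivial
    | @resume1 Δ z s τ' pr =>
      have h2 : ProcOK p τ E Δ z s (.rolling τ' z pr ∅ ∅) :=
        hA (.proc Δ z s (.rolling τ' z pr ∅ ∅)) (by simp)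
      intro c hc
      rw [Multiset.mem_singleton.1 hc]
      have hz : z = p := by
        by_contra hz
        exact h2.ne_initiator hz rfl
      refine ⟨?_, h2.bot, fun h => absurd hz (hE.spawned_ne h), ?_⟩
      · obtain ⟨e₀, s₀, h3, h4, h5⟩ := h2.orig
        exact ⟨e₀, s₀, h3, h4, fun h => absurd (h5 h).1 (by simp)⟩
      · intro τ'' pτ' pr' L' P' hm
        cases hm
    | @resume2 Δ z τ' pτ pr hz =>
      have h2 : ProcOK p τ E Δ z none (.rolling τ' pτ pr ∅ ∅) :=
        hA (.proc Δ z none (.rolling τ' pτ pr ∅ ∅)) (by simp)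
      simp [CompOK, (h2.rolling _ _ _ _ _ rfl).1]
    | @resume3 Δ z s τ' pτ pr hz hs =>
      have h2 : ProcOK p τ E Δ z s (.rolling τ' pτ pr ∅ ∅) :=
        hA (.proc Δ z s (.rolling τ' pτ pr ∅ ∅)) (by simp)
      intro c hc
      rcases Multiset.mem_cons.1 hc with rfl | hc
      · obtain ⟨e₀, s₀, h3, h4, h5⟩ := h2.orig
        refine ⟨⟨e₀, s₀, h3, h4, fun h => absurd (h5 h).1 (by simp)⟩, h2.bot, ?_, ?_⟩
        · intro hz
          rcases h2.spawned hz with h | h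
          · exact .inl h
          · exact absurd h.2 hs
        · intro τ'' pτ' pr' L' P' hm
          cases hm
      · rw [Multiset.mem_singleton.1 hc]
        exact (h2.rolling _ _ _ _ _ rfl).1
    | @resume4 Δ z s p' τ' =>
      have h2 : ProcOK p τ E Δ z s (.waiting τ') :=
        hA (.proc Δ z s (.waiting τ')) (by simp)
      intro c hc
      rw [Multiset.mem_singleton.1 hc]
      refine ⟨?_, h2.bot, ?_, ?_⟩
      · obtain ⟨e₀, s₀, h3, h4, h5⟩ := h2.orig
        exact ⟨e₀, s₀, h3, h4, fun h => absurd (h5 h).1 (by simp)⟩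
      · intro hz
        rcases h2.spawned hz with h | ⟨⟨_, _, _, _, _, h⟩, -⟩
        · exact .inl h
        · cases h
      · intro τ'' pτ' pr' L' P' hm
        cases hm

end

/-- Invariants of the subsequent steps of a rollback derivation of `p` to `τ` that starts with a
system whose image is `E`. -/
structure Inv (p : Pid) (τ : Chk) (E : Multiset (EComp St V)) (S : Sys St V) : Prop where
  ok : ∀ c ∈ S, CompOK p τ E c
  pid_le : ∀ z, wsum (onErased (pidW z)) S ≤ 1
  tag_le : ∀ z ℓ, Sent E τ z ℓ → wsum (onErased (tagW ℓ)) S ≤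
    wsum (onErased (holdW τ z)) S + wsum (tagsW z ℓ) S
  edge : ∀ y q, Contacts E τ y q → wsum (onErased (holdW τ q)) S ≤
    wsum (onErased (holdW τ y)) S + wsum (depW y q) S
  done : ∀ q, wsum (doneW q) S = 0 ∨ wsum (onErased (holdW τ q)) S = 0
  tok : ∀ y q, q ≠ p → wsum (noteW y q) S + wsum (childW y q) S ≤ wsum (depW y q) S
  rank : ∃ r : Pid → ℕ, ∀ Δ z s τ' pτ pr L P,
    Comp.proc Δ z s (.rolling τ' pτ pr L P) ∈ S → z ≠ p → r pr < r z
  undone : undoneSys p τ E (S.filterMap Comp.erase) = undoneSys p τ E E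

/-! ### Preservation of the invariants along rollback steps, and the initial system -/

section

variable {p : Pid} {τ : Chk} {E : Multiset (EComp St V)}

theorem Inv.proc_ok {S : Sys St V} (hS : Inv p τ E S) {Δ z s m} (h : Comp.proc Δ z s m ∈ S) :
    ProcOK p τ E Δ z s m := hS.ok _ h

theorem Inv.proc_unique {S : Sys St V} (hS : Inv p τ E S) {Δ z s m Δ' s' m'}
    (h : Comp.proc Δ z s m ∈ S) (h' : Comp.proc Δ' z s' m' ∈ S) : Δ = Δ' ∧ s = s' ∧ m = m' := by
  have := eq_of_wsum_le_one (hS.pid_le z) h h' (by simp [pidW]) (by simp [pidW])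
  simpa using this

theorem Inv.holdW_eq {S : Sys St V} (hS : Inv p τ E S) {Δ z s m} (h : Comp.proc Δ z s m ∈ S) :
    wsum (onErased (holdW τ z)) S = holdW τ z (.proc (eraseHist Δ) z s) := by
  refine wsum_eq_of_unique (hS.pid_le z) h (by simp [pidW]) ?_
  rintro (⟨Δ, z', s, m⟩ | _ | _) hz
  · simp only [onErased_proc, pidW] at hz
    simp [holdW]
    intro h
    simp [h] at hz
  · simp [holdW]
  · simp

theorem Inv.holdW_eq_zero {S : Sys St V} (hS : Inv p τ E S) {Δ z s m}
    (h : Comp.proc Δ z s m ∈ S) (hm : m ≠ .normal) : wsum (onErased (holdW τ z)) S = 0 := by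
  rw [hS.holdW_eq h]
  simp [holdW, (hS.proc_ok h).not_holds hm]

theorem Inv.depW_eq {S : Sys St V} (hS : Inv p τ E S) {Δ z s m} (h : Comp.proc Δ z s m ∈ S)
    (q : Pid) : wsum (depW z q) S = depW z q (.proc Δ z s m) := by
  refine wsum_eq_of_unique (hS.pid_le z) h (by simp [pidW]) ?_
  rintro (⟨Δ, z', s, m⟩ | _ | _) hz
  · have : z' ≠ z := by
      rintro rfl
      simp [pidW] at hz
    cases m <;> simp [depW, this]
  · rfl
  · rfl

theorem exists_rolling_of_depW {S : Sys St V} {y q : Pid} (h : 0 < wsum (depW y q) S) :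
    ∃ Δ s τ' pτ pr L P, Comp.proc Δ y s (.rolling τ' pτ pr L P) ∈ S ∧ q ∈ P := by
  obtain ⟨c, hc, h⟩ := exists_of_wsum_pos h
  rcases c with ⟨Δ, z, s, m⟩ | _ | _
  · cases m with
    | rolling τ' pτ pr L P =>
      simp only [depW] at h
      split_ifs at h with h1
      · obtain ⟨rfl, h1⟩ := h1
        exact ⟨Δ, s, τ', pτ, pr, L, P, hc, h1⟩
      · omega
    | _ => simp [depW] at h
  · simp [depW] at h
  · simp [depW] at h

theorem exists_rolling_of_tagsW {S : Sys St V} {y : Pid} {ℓ : Tag} (h : 0 < wsum (tagsW y ℓ) S) :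
    ∃ Δ s τ' pτ pr L P, Comp.proc Δ y s (.rolling τ' pτ pr L P) ∈ S ∧ ℓ ∈ L := by
  obtain ⟨c, hc, h⟩ := exists_of_wsum_pos h
  rcases c with ⟨Δ, z, s, m⟩ | _ | _
  · cases m with
    | rolling τ' pτ pr L P =>
      simp only [tagsW] at h
      split_ifs at h with h1
      · obtain ⟨rfl, h1⟩ := h1
        exact ⟨Δ, s, τ', pτ, pr, L, P, hc, h1⟩
      · omega
    | _ => simp [tagsW] at h
  · simp [tagsW] at h
  · simp [tagsW] at h

/-- A rule lets at most one process start to roll back. -/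
theorem rolling_rule (hE : CompleteRecord p τ E) {A B : Sys St V}
    (h : Roll1Rule A B ∨ UndoRule A B) (hA : ∀ c ∈ A, CompOK p τ E c) :
    (∀ Δ z s τ' pτ pr L P, Comp.proc Δ z s (.rolling τ' pτ pr L P) ∈ B →
      ∃ Δ s τ' pτ L P, Comp.proc Δ z s (.rolling τ' pτ pr L P) ∈ A) ∨
    (∃ x₀ z₀ pτ₀ τ₀ Δ₀ s₀, Comp.note x₀ z₀ (.roll pτ₀ τ₀) ∈ A ∧ Comp.proc Δ₀ z₀ s₀ .normal ∈ A ∧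
      ∀ Δ z s τ' pτ pr L P, Comp.proc Δ z s (.rolling τ' pτ pr L P) ∈ B → z = z₀ ∧ pr = x₀) := by
  refine rule_cases hE h hA ?_ ?_
  · rintro x' z pτ Δ s x n rfl rfl hc
    refine .inr ⟨x', z, pτ, τ, Δ, s, by simp, by simp, fun Δ₁ z₁ s₁ τ₁ pτ₁ pr₁ L₁ P₁ h1 => ?_⟩
    rcases Multiset.mem_cons.1 h1 with h1 | h1
    · simp only [Comp.proc.injEq, Mode.rolling.injEq] at h1
      exact ⟨h1.2.1, h1.2.2.2.2.2.1⟩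
    · rcases Multiset.mem_add.1 h1 with h1 | h1
      · obtain ⟨q, _, h2⟩ := Multiset.mem_map.1 h1
        cases h2
      · obtain ⟨_, _, _, _, _, h2⟩ := hc.allMsgs _ h1
        cases h2
  · intro h
    cases h with
    | @roll2 Δ z s p' pτ τ' hτ =>
      refine .inr ⟨p', z, pτ, τ', Δ, s, by simp, by simp, fun Δ₁ z₁ s₁ τ₁ pτ₁ pr₁ L₁ P₁ h1 => ?_⟩
      simp only [Multiset.mem_singleton, Comp.proc.injEq, Mode.rolling.injEq] at h1
      exact ⟨h1.2.1, h1.2.2.2.2.2.1⟩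
    | @roll3 Δ z s p' pτ τ₁ τ' p₁ p₂ L P =>
      refine .inl fun Δ₁ z₁ s₁ τ₁ pτ₁ pr₁ L₁ P₁ h1 => ?_
      simp only [Multiset.insert_eq_cons, Multiset.mem_cons, Multiset.mem_singleton,
        Comp.proc.injEq, Mode.rolling.injEq, reduceCtorEq, or_false] at h1
      obtain ⟨-, rfl, -, -, -, rfl, -⟩ := h1
      exact ⟨_, _, _, _, _, _, Multiset.mem_cons_of_mem (Multiset.mem_singleton_self _)⟩
    | @undoSend Δ z s p' C ℓ v τ' pτ pr L P hℓ =>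
      refine .inl fun Δ₁ z₁ s₁ τ₁ pτ₁ pr₁ L₁ P₁ h1 => ?_
      simp only [Multiset.mem_singleton, Comp.proc.injEq, Mode.rolling.injEq] at h1
      obtain ⟨-, rfl, -, -, -, rfl, -⟩ := h1
      exact ⟨_, _, _, _, _, _, Multiset.mem_cons_of_mem (Multiset.mem_singleton_self _)⟩
    | @undoDep1 Δ z s p' τ' pτ pr P =>
      refine .inl fun Δ₁ z₁ s₁ τ₁ pτ₁ pr₁ L₁ P₁ h1 => ?_
      simp only [Multiset.mem_singleton, Comp.proc.injEq, Mode.rolling.injEq] at h1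
      obtain ⟨-, rfl, -, -, -, rfl, -⟩ := h1
      exact ⟨_, _, _, _, _, _, Multiset.mem_cons_of_mem (Multiset.mem_singleton_self _)⟩
    | @undoDep2 Δ z s p' τ' pτ pr P =>
      refine .inl fun Δ₁ z₁ s₁ τ₁ pτ₁ pr₁ L₁ P₁ h1 => ?_
      simp only [Multiset.insert_eq_cons, Multiset.mem_cons, Multiset.mem_singleton,
        Comp.proc.injEq, Mode.rolling.injEq, reduceCtorEq, or_false] at h1
      obtain ⟨-, rfl, -, -, -, rfl, -⟩ := h1
      exact ⟨_, _, _, _, _, _, Multiset.mem_cons_of_mem (Multiset.mem_singleton_self _)⟩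
    | _ => exact .inl (by simp)

theorem one_le_childW {S : Sys St V} {Δ z s τ' pτ pr L P}
    (h : Comp.proc Δ z s (.rolling τ' pτ pr L P) ∈ S) : 1 ≤ wsum (childW pr z) S := by
  have := le_wsum (f := childW pr z) h
  simpa [childW] using this

/-- A process that starts to roll back is a new leaf of the forest of requests: it was normal, so it
waits for nobody, and by `tok` no rolling process other than `p` was requested by it. It can be
ranked just above its requester without disturbing the others. -/
theorem Inv.rank_rule (hE : CompleteRecord p τ E) {A B T : Sys St V}
    (h : Roll1Rule A B ∨ UndoRule A B) (hS : Inv p τ E (A + T)) :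
    ∃ r : Pid → ℕ, ∀ Δ z s τ' pτ pr L P,
      Comp.proc Δ z s (.rolling τ' pτ pr L P) ∈ B + T → z ≠ p → r pr < r z := by
  obtain ⟨r, hr⟩ := hS.rank
  rcases rolling_rule hE h (fun c hc => hS.ok c (by simp [hc])) with h1 | h1
  · refine ⟨r, fun Δ z s τ' pτ pr L P h2 hz => ?_⟩
    rcases Multiset.mem_add.1 h2 with h2 | h2
    · obtain ⟨Δ', s', τ'', pτ', L', P', h3⟩ := h1 _ _ _ _ _ _ _ _ h2
      exact hr _ _ _ _ _ _ _ _ (Multiset.mem_add.2 (.inl h3)) hz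
    · exact hr _ _ _ _ _ _ _ _ (Multiset.mem_add.2 (.inr h2)) hz
  · obtain ⟨x₀, z₀, pτ₀, τ₀, Δ₀, s₀, hx, hz₀, h1⟩ := h1
    by_cases hp : z₀ = p
    · refine ⟨r, fun Δ z s τ' pτ pr L P h2 hz => ?_⟩
      rcases Multiset.mem_add.1 h2 with h2 | h2
      · exact absurd ((h1 _ _ _ _ _ _ _ _ h2).1.trans hp) hz
      · exact hr _ _ _ _ _ _ _ _ (Multiset.mem_add.2 (.inr h2)) hz
    · have hmem : Comp.proc Δ₀ z₀ s₀ .normal ∈ A + T := Multiset.mem_add.2 (.inl hz₀)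
      have hdep : ∀ q, wsum (depW z₀ q) (A + T) = 0 := fun q => hS.depW_eq hmem q
      refine ⟨Function.update r z₀ (r x₀ + 1), fun Δ z s τ' pτ pr L P h2 hz => ?_⟩
      rcases Multiset.mem_add.1 h2 with h2 | h2
      · obtain ⟨rfl, rfl⟩ := h1 _ _ _ _ _ _ _ _ h2
        -- A request of this process to itself would be a token without a dependency.
        have hne : pr ≠ z := by
          rintro rfl
          have h3 := le_wsum (f := noteW pr pr) (Multiset.mem_add.2 (.inl hx) : _ ∈ A + T)
          have h4 := hS.tok pr pr hp
          rw [hdep] at h4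
          simp only [noteW, and_self, if_true] at h3
          omega
        simp [Function.update_of_ne hne]
      · have h5 : Comp.proc Δ z s (.rolling τ' pτ pr L P) ∈ A + T :=
          Multiset.mem_add.2 (.inr h2)
        have hne : z ≠ z₀ := by
          rintro rfl
          have := (hS.proc_unique h5 hmem).2.2
          cases this
        have hne' : pr ≠ z₀ := by
          rintro rfl
          have h3 := one_le_childW h5
          have h4 := hS.tok pr z hz
          rw [hdep] at h4
          omega
        rw [Function.update_of_ne hne, Function.update_of_ne hne']
        exact hr _ _ _ _ _ _ _ _ h5 hz

theorem Inv.propStep (hE : CompleteRecord p τ E) {S S' : Sys St V} (hS : Inv p τ E S)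
    (h : PropStep S S') : Inv p τ E S' := by
  obtain ⟨A, B, T, h, rfl, rfl⟩ := h
  have hA : ∀ c ∈ A, CompOK p τ E c := fun c hc => hS.ok c (by simp [hc])
  refine ⟨?_, ?_, ?_, ?_, ?_, ?_, hS.rank_rule hE h, ?_⟩
  · intro c hc
    rcases Multiset.mem_add.1 hc with hc | hc
    · exact compOK_rule hE h hA c hc
    · exact hS.ok c (by simp [hc])
  · intro z
    have h1 := hS.pid_le z
    have h2 := wsum_pidW_le hE h hA z
    rw [wsum_add] at h1 ⊢
    omega
  · intro z ℓ hs
    have h1 := hS.tag_le z ℓ hs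
    have h2 := wsum_tagW_add_le hE h hA hs
    simp only [wsum_add] at h1 ⊢
    omega
  · intro y q hs
    have h1 := hS.edge y q hs
    have h2 := wsum_edge hE h hA hs
    have h3 := wsum_holdW_le hE h hA q
    -- If the rule consumes an answer of `q`, then `q` does not hold `τ` and, by `h3`, does not
    -- regain it; otherwise the correction term of `wsum_edge` vanishes.
    have h4 := hS.done q
    simp only [wsum_add] at h1 h4 ⊢
    omega
  · intro q
    have h1 := wsum_holdW_le hE h hA q
    by_cases h2 : wsum (doneW q) A < wsum (doneW q) B
    · obtain ⟨Δ, s, τ', pτ, pr, L, P, h3⟩ := exists_rolling_of_doneW hE h hA h2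
      have h4 := hS.holdW_eq_zero (Multiset.mem_add.2 (.inl h3)) (by simp)
      simp only [wsum_add] at h4 ⊢
      omega
    · have h4 := hS.done q
      simp only [wsum_add] at h4 ⊢
      omega
  · intro y q hq
    have h1 := hS.tok y q hq
    have h2 := wsum_tok hE h hA y q
    simp only [wsum_add] at h1 ⊢
    omega
  · have h1 := hS.undone
    rw [Multiset.filterMap_add, undoneSys_add] at h1 ⊢
    rw [undoneSys_rule hE h hA, h1]

theorem Inv.propSteps (hE : CompleteRecord p τ E) {S S' : Sys St V} (hS : Inv p τ E S)
    (h : Relation.ReflTransGen PropStep S S') : Inv p τ E S' := by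
  induction h with
  | refl => exact hS
  | tail _ h ih => exact ih.propStep hE h

/-- Systems without ongoing rollback, except for requests to `p` to roll back to `τ`. -/
structure Start (p : Pid) (τ : Chk) (E : Multiset (EComp St V)) (S : Sys St V) : Prop where
  erase_eq : S.filterMap Comp.erase = E
  normal : ∀ Δ q s m, Comp.proc Δ q s m ∈ S → m = .normal
  notes : ∀ q q' n, Comp.note q q' n ∈ S → (∃ τ', n = .commit τ') ∨
    (q' = p ∧ ∃ pτ, n = .roll pτ τ ∧ (pτ = p ∨ ∀ e s, EComp.proc e pτ s ∉ E))
  mem : ∃ e s, EComp.proc e p s ∈ E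

theorem one_le_holdW {e : List (EItem St V)} {z : Pid} {s : Option St}
    (h : EComp.proc e z s ∈ E) (hh : EHolds τ e) : 1 ≤ wsum (holdW τ z) E := by
  have := le_wsum (f := holdW τ z) h
  simpa [holdW, hh] using this

theorem Start.wsum_eq_zero {S : Sys St V} (hS : Start p τ E S) {f : Comp St V → ℕ}
    (h1 : ∀ Δ q s, f (.proc Δ q s .normal) = 0) (h2 : ∀ C y q ℓ v, f (.msg C y q ℓ v) = 0)
    (h3 : ∀ y q τ', f (.note y q (.commit τ')) = 0)
    (h4 : ∀ y pτ, f (.note y p (.roll pτ τ)) = 0) : wsum f S = 0 := by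
  rw [wsum_eq_zero_iff]
  rintro (⟨Δ, q, s, m⟩ | ⟨C, y, q, ℓ, v⟩ | ⟨y, q, n⟩) hc
  · rw [hS.normal _ _ _ _ hc, h1]
  · exact h2 _ _ _ _ _
  · rcases hS.notes _ _ _ hc with ⟨τ', rfl⟩ | ⟨rfl, pτ, rfl, -⟩
    · exact h3 _ _ _
    · exact h4 _ _

/-- Whoever sent or spawned something since `τ` still holds `τ`, which pays for the bounds in
`tag_le` and `edge`. Requests, if any, are addressed to `p`, which `tok` leaves out. -/
theorem Start.inv (hE : CompleteRecord p τ E) {S : Sys St V} (hS : Start p τ E S) :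
    Inv p τ E S := by
  have hold1 : ∀ {z a}, ESince E τ z a → 1 ≤ wsum (onErased (holdW τ z)) S := by
    intro z a h
    obtain ⟨e, s, h1, h2⟩ := h.exists_holds
    rw [← wsum_onErased, hS.erase_eq]
    exact one_le_holdW h1 h2
  refine ⟨?_, ?_, ?_, ?_, ?_, ?_, ⟨fun _ => 0, ?_⟩, by rw [hS.erase_eq]⟩
  · rintro (⟨Δ, q, s, m⟩ | ⟨C, y, q, ℓ, v⟩ | ⟨y, q, n⟩) hc
    · have hm := hS.normal _ _ _ _ hc
      subst hm
      have h1 : EComp.proc (eraseHist Δ) q s ∈ E := by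
        rw [← hS.erase_eq]
        exact proc_mem_erase.2 ⟨Δ, _, hc, rfl⟩
      refine ⟨⟨_, _, h1, rfl, fun _ => ⟨rfl, rfl⟩⟩, fun h => absurd h (hE.state_ne _ _ _ h1),
        fun h => .inl (hE.spawned_holds h1 h).2.1, ?_⟩
      intro _ _ _ _ _ h
      cases h
    · trivial
    · rcases hS.notes _ _ _ hc with ⟨τ', rfl⟩ | ⟨rfl, pτ, rfl, h⟩
      · trivial
      · exact ⟨rfl, h, hS.mem⟩
  · intro z
    rw [← wsum_onErased, hS.erase_eq]
    exact hE.pid_le z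
  · rintro z ℓ ⟨q, h⟩
    have h1 := hold1 h
    have h2 := hE.tag_le ℓ
    rw [← wsum_onErased (tagW ℓ), hS.erase_eq]
    omega
  · rintro y q h
    have h1 : 1 ≤ wsum (onErased (holdW τ y)) S := by
      rcases h with ⟨ℓ, h⟩ | h <;> exact hold1 h
    have h2 := hE.pid_le q
    have h3 : wsum (holdW τ q) E ≤ wsum (pidW q) E := by
      refine wsum_mono ?_
      rintro (⟨e, z, s⟩ | _) _
      · simp only [holdW, pidW]
        split_ifs <;> simp_all
      · simp [holdW]
    rw [← wsum_onErased (holdW τ q), hS.erase_eq]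
    omega
  · intro q
    exact .inl (hS.wsum_eq_zero (by simp [doneW]) (by simp [doneW]) (by simp [doneW])
      (by simp [doneW]))
  · intro y q hq
    rw [hS.wsum_eq_zero (f := noteW y q) (by simp [noteW]) (by simp [noteW]) (by simp [noteW])
      (by simp [noteW, hq.symm]), hS.wsum_eq_zero (f := childW y q) (by simp [childW])
      (by simp [childW]) (by simp [childW]) (by simp [childW])]
    omega
  · intro Δ z s τ' pτ pr L P h
    cases hS.normal _ _ _ _ h

/-! ### The end of a rollback derivation -/

/-- By `tok`, a rolling process other than `p` is awaited by its requester, which is therefore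
rolling as well and has a smaller rank. The descent has to end in `p`, but `p` awaits nobody. -/
theorem Inv.no_other_rolling {S : Sys St V} (hS : Inv p τ E S) {Δ s τ' pτ pr L}
    (hp : Comp.proc Δ p s (.rolling τ' pτ pr L ∅) ∈ S) {Δ₁ z s₁ τ₁ pτ₁ pr₁ L₁ P₁}
    (h : Comp.proc Δ₁ z s₁ (.rolling τ₁ pτ₁ pr₁ L₁ P₁) ∈ S) : z = p := by
  obtain ⟨r, hr⟩ := hS.rank
  by_contra hz
  induction hn : r z using Nat.strong_induction_on generalizing Δ₁ z s₁ τ₁ pτ₁ pr₁ L₁ P₁ with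
  | _ n ih =>
    subst hn
    have h1 := one_le_childW h
    have h2 := hS.tok pr₁ z hz
    obtain ⟨Δ₂, s₂, τ₂, pτ₂, pr₂, L₂, P₂, h3, h4⟩ :=
      exists_rolling_of_depW (S := S) (y := pr₁) (q := z) (by omega)
    by_cases h5 : pr₁ = p
    · subst h5
      have := (hS.proc_unique hp h3).2.2
      simp only [Mode.rolling.injEq] at this
      simp [← this.2.2.2.2] at h4
    · exact ih _ (hr _ _ _ _ _ _ _ _ h hz) h3 h5 rfl

/-- Only `p` is rolling, so no dependency and no tag is pending. Now `edge` spreads the absence of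
`τ` from `p` along causal dependency, and `depends` makes this reach every process; `tag_le` then
excludes messages sent since `τ`, and `ProcOK.spawned` excludes spawned processes. -/
theorem Inv.final (hE : CompleteRecord p τ E) {Δ s τ' pτ pr} {S : Sys St V}
    (hS : Inv p τ E (.proc Δ p s (.rolling τ' pτ pr ∅ ∅) ::ₘ S)) :
    S.filterMap Comp.erase = undoneSys p τ E E := by
  set S' : Sys St V := .proc Δ p s (.rolling τ' pτ pr ∅ ∅) ::ₘ S with hS'
  have hp : Comp.proc Δ p s (.rolling τ' pτ pr ∅ ∅) ∈ S' := by simp [hS']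
  have hno : ∀ {Δ₁ z s₁ τ₁ pτ₁ pr₁ L₁ P₁},
      Comp.proc Δ₁ z s₁ (.rolling τ₁ pτ₁ pr₁ L₁ P₁) ∈ S' → z = p ∧ L₁ = ∅ ∧ P₁ = ∅ := by
    intro Δ₁ z s₁ τ₁ pτ₁ pr₁ L₁ P₁ h
    have hz := hS.no_other_rolling hp h
    subst hz
    have := (hS.proc_unique h hp).2.2
    simp only [Mode.rolling.injEq] at this
    exact ⟨rfl, this.2.2.2⟩
  have hedge : ∀ y q, wsum (onErased (holdW τ y)) S' = 0 → Contacts E τ y q →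
      wsum (onErased (holdW τ q)) S' = 0 := by
    intro y q h1 h2
    have h3 := hS.edge y q h2
    by_contra h4
    obtain ⟨_, _, _, _, _, _, _, h5, h6⟩ :=
      exists_rolling_of_depW (S := S') (y := y) (q := q) (by omega)
    simp [(hno h5).2.2] at h6
  have hdep : ∀ w, EDependsOn E τ p w → wsum (onErased (holdW τ w)) S' = 0 := by
    intro w hw
    induction hw with
    | refl => exact hS.holdW_eq_zero hp (by simp)
    | spawn _ h ih => exact hedge _ _ ih (.inr h)
    | message _ h _ ih => exact hedge _ _ ih (.inl ⟨_, h⟩)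
  have hsince : ∀ {z a}, ESince E τ z a → wsum (onErased (holdW τ z)) S' = 0 := by
    intro z a h
    obtain ⟨e, s, h1, h2⟩ := h.exists_holds
    exact hdep z (hE.depends _ _ _ h1 h2)
  have hhold : ∀ {Δ₁ z s₁ m₁}, Comp.proc Δ₁ z s₁ m₁ ∈ S' → ¬ EHolds τ (eraseHist Δ₁) := by
    intro Δ₁ z s₁ m₁ h hh
    obtain ⟨e₀, s₀, h1, -, h2⟩ := (hS.proc_ok h).orig
    have h3 := hS.holdW_eq h
    rw [← (h2 hh).2] at h1
    rw [hdep z (hE.depends _ _ _ h1 hh)] at h3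
    simp [holdW, hh] at h3
  rw [← hS.undone, hS', filterMap_erase_cons_proc]
  have he : S'.filterMap Comp.erase = .proc (eraseHist Δ) p s ::ₘ S.filterMap Comp.erase :=
    filterMap_erase_cons_proc _ _ _ _ _
  rw [undoneSys_eq_of_done] <;> rw [← he]
  · intro z
    rw [wsum_onErased]
    exact hS.pid_le z
  · intro e' z s' h
    obtain ⟨Δ₁, m₁, h1, rfl⟩ := proc_mem_erase.1 h
    exact hhold h1
  · intro e' z s' h hz
    obtain ⟨Δ₁, m₁, h1, rfl⟩ := proc_mem_erase.1 h
    rcases (hS.proc_ok h1).spawned hz with h2 | ⟨⟨_, _, _, _, _, rfl⟩, -⟩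
    · exact hhold h1 h2
    -- A spawned process without `τ` would have to be rolling, but the only rolling process is `p`,
    -- which is not spawned since `τ`.
    · exact hE.spawned_ne hz (hno h1).1
  · rintro y q ℓ v h ⟨q', hs⟩
    have h1 := hS.tag_le y ℓ ⟨q', hs⟩
    rw [hsince hs, ← wsum_onErased] at h1
    have h2 := le_wsum (f := tagW ℓ) h
    simp only [tagW, if_true] at h2
    obtain ⟨_, _, _, _, _, _, _, h5, h6⟩ :=
      exists_rolling_of_tagsW (S := S') (y := y) (ℓ := ℓ) (by omega)
    simp [(hno h5).2.1] at h6

end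

section

variable {p : Pid} {τ : Chk} {E : Multiset (EComp St V)}

/-! ### Existence of rollback derivations -/

/-- The balance opposite to `wsum_tagW_add_le`: a message that its sender still has to delete does
not vanish. Recorded messages count only if received since `τ`, because these are the ones that
Roll1 returns to the network. -/
theorem wsum_msgW_le (hE : CompleteRecord p τ E) {A B : Sys St V}
    (h : Roll1Rule A B ∨ UndoRule A B) (hA : ∀ c ∈ A, CompOK p τ E c) (y q : Pid) (ℓ : Tag) :
    wsum (onErased (holdW τ y)) B + wsum (tagsW y ℓ) B + wsum (onErased (msgW τ y q ℓ)) A ≤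
      wsum (onErased (holdW τ y)) A + wsum (tagsW y ℓ) A + wsum (onErased (msgW τ y q ℓ)) B := by
  refine rule_cases hE h hA ?_ ?_
  · rintro x' z pτ Δ s x n rfl rfl hc
    simp only [rollRhs, wsum_cons, wsum_add]
    rw [wsum_rollNotes_eq_zero (f := onErased (holdW τ y)) (by simp),
      hc.allMsgs.wsum_eq_zero (f := onErased (holdW τ y)) (by simp [holdW]),
      wsum_rollNotes_eq_zero (f := tagsW y ℓ) (by simp [tagsW]),
      hc.allMsgs.wsum_eq_zero (f := tagsW y ℓ) (by simp [tagsW]),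
      wsum_rollNotes_eq_zero (f := onErased (msgW τ y q ℓ)) (by simp),
      wsum_onErased_eq hc.erase_msgs, wsum_msgW_recvMsg]
    simp only [Multiset.insert_eq_cons, wsum_cons, wsum_singleton, onErased_note, onErased_proc,
      holdW, tagsW, msgW, hc.not_holds, eholds_of_back hc.back_eq, since_of_back hc.back_eq,
      since_of_not hc.not_holds, List.filterMap_nil, List.count_nil]
    split_ifs <;> first | omega | (exfalso; simp_all)
  · intro h
    cases h with
    | @undoSend Δ z s p' C ℓ' v τ' pτ pr L P hℓ =>
      simp only [Multiset.insert_eq_cons, wsum_cons, wsum_singleton, onErased_proc, onErased_msg,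
        msgW, tagsW, holdW, Finset.mem_erase, Prod.mk.injEq]
      by_cases h1 : ℓ' = ℓ
      · subst h1
        by_cases h2 : z = y
        · simp [h2, hℓ]
          split_ifs <;> omega
        · simp [h2]
      · have : ℓ ≠ ℓ' := fun h => h1 h.symm
        simp [h1, this]
    | @resume2 Δ z τ' pτ pr =>
      have h1 : ProcOK p τ E Δ z none (.rolling τ' pτ pr ∅ ∅) :=
        hA (.proc Δ z none (.rolling τ' pτ pr ∅ ∅)) (by simp)
      simp [holdW, tagsW, msgW, since_of_not (h1.not_holds (by simp))]
    | _ => simp [msgW, holdW, tagsW]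

open Classical in
/-- The weight of `childW`, except that nobody waits for `p` on account of its request. -/
noncomputable def childW' (p y q : Pid) (c : Comp St V) : ℕ := if q = p then 0 else childW y q c

/-- Rules that keep the process `p` rolling back. -/
def KeepsRolling (p : Pid) (A B : Sys St V) : Prop :=
  ∀ Δ s τ pτ pr L P, Comp.proc Δ p s (.rolling τ pτ pr L P) ∈ A →
    ∃ L' P', Comp.proc Δ p s (.rolling τ pτ pr L' P') ∈ B

/-- The balance opposite to `wsum_tok`: a dependency keeps a token. Undo-dep may consume an answer
that is no longer awaited, which breaks the inequality; the second alternative records that the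
dependency is then absent anyway. A dependency on `p` needs no child as token, since `p` is rolling
all the time and answers requests at once by Roll3. -/
theorem wsum_depW_le (hE : CompleteRecord p τ E) {A B : Sys St V}
    (h : Roll1Rule A B ∨ UndoRule A B) (hA : ∀ c ∈ A, CompOK p τ E c) (hB : KeepsRolling p A B)
    (hp : ∀ Δ s, Comp.proc Δ p s .normal ∉ A) (y q : Pid) :
    wsum (depW y q) B + wsum (noteW y q) A + wsum (childW' p y q) A ≤
      wsum (depW y q) A + wsum (noteW y q) B + wsum (childW' p y q) B ∨
    ∃ Δ s m, Comp.proc Δ y s m ∈ B ∧ depW y q (Comp.proc Δ y s m) = 0 := by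
  refine rule_cases hE h hA ?_ ?_
  · rintro x' z pτ Δ s x n rfl rfl hc
    have hz : z ≠ p := by
      rintro rfl
      exact hp Δ s (by simp)
    left
    simp only [rollRhs, wsum_cons, wsum_add]
    rw [wsum_noteW_rollNotes,
      hc.allMsgs.wsum_eq_zero (f := noteW y q) (by simp [noteW]),
      wsum_rollNotes_eq_zero (f := childW' p y q) (by simp [childW', childW]),
      hc.allMsgs.wsum_eq_zero (f := childW' p y q) (by simp [childW', childW]),
      wsum_rollNotes_eq_zero (f := depW y q) (by simp [depW]),
      hc.allMsgs.wsum_eq_zero (f := depW y q) (by simp [depW])]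
    simp only [Multiset.insert_eq_cons, wsum_cons, wsum_singleton, noteW, childW', childW, depW,
      and_comm (a := x' = y)]
    by_cases hq : q = p
    · subst hq
      simp [hz]
    · simp [hq]
  · intro h
    cases h with
    | @roll2 Δ z s p' pτ τ' =>
      have hz : z ≠ p := by
        rintro rfl
        exact hp Δ s (by simp)
      left
      by_cases hq : q = p
      · subst hq
        simp [noteW, childW', depW, hz]
      · simp [noteW, childW', childW, depW, hq, and_comm]
    | roll3 =>
      left
      by_cases hq : q = p <;> simp [noteW, childW', childW, depW, hq, and_comm]
    | undoSend =>
      left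
      by_cases hq : q = p <;> simp [noteW, childW', childW, depW, hq]
    | @undoDep1 Δ z s p' τ' pτ pr P =>
      by_cases h1 : z = y ∧ p' = q
      · obtain ⟨rfl, rfl⟩ := h1
        exact .inr ⟨_, _, _, Multiset.mem_singleton_self _, by simp [depW]⟩
      · left
        by_cases h2 : z = y
        · subst h2
          have h3 : p' ≠ q := fun h => h1 ⟨rfl, h⟩
          by_cases hq : q = p
          · subst hq
            simp [noteW, childW', depW, h3, h3.symm]
          · simp [noteW, childW', childW, depW, h3, hq, h3.symm]
        · by_cases hq : q = p <;> simp [noteW, childW', childW, depW, h2, hq]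
    | @undoDep2 Δ z s p' τ' pτ pr P =>
      by_cases h1 : z = y ∧ p' = q
      · obtain ⟨rfl, rfl⟩ := h1
        exact .inr ⟨_, _, _, Multiset.mem_cons_self _ _, by simp [depW]⟩
      · left
        by_cases h2 : z = y
        · subst h2
          have h3 : p' ≠ q := fun h => h1 ⟨rfl, h⟩
          by_cases hq : q = p
          · subst hq
            simp [noteW, childW', depW, h3, h3.symm]
          · simp [noteW, childW', childW, depW, h3, hq, h3.symm]
        · by_cases hq : q = p <;> simp [noteW, childW', childW, depW, h2, hq]
    | @resume1 Δ z s τ' pr =>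
      have h2 : ProcOK p τ E Δ z s (.rolling τ' z pr ∅ ∅) :=
        hA (.proc Δ z s (.rolling τ' z pr ∅ ∅)) (by simp)
      have hz : z = p := by
        by_contra hz
        exact h2.ne_initiator hz rfl
      subst hz
      obtain ⟨L', P', h3⟩ := hB _ _ _ _ _ _ _ (Multiset.mem_singleton_self _)
      simp at h3
    | @resume2 Δ z τ' pτ pr =>
      have hz : z ≠ p := by
        rintro rfl
        obtain ⟨L', P', h3⟩ := hB _ _ _ _ _ _ _ (Multiset.mem_singleton_self _)
        simp at h3
      left
      by_cases hq : q = p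
      · subst hq
        simp [noteW, childW', depW, hz]
      · simp [noteW, childW', childW, depW, hq]
    | @resume3 Δ z s τ' pτ pr =>
      have hz : z ≠ p := by
        rintro rfl
        obtain ⟨L', P', h3⟩ := hB _ _ _ _ _ _ _ (Multiset.mem_singleton_self _)
        simp at h3
      left
      by_cases hq : q = p
      · subst hq
        simp [noteW, childW', depW, hz]
      · simp [noteW, childW', childW, depW, hq]
    | resume4 =>
      left
      by_cases hq : q = p <;> simp [noteW, childW', childW, depW, hq]

/-- Invariants of a rollback derivation during which `p` does not resume. -/
structure Driven (p : Pid) (τ : Chk) (E : Multiset (EComp St V)) (Δ' : List (Item St V))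
    (sτ : Option St) (pτ pr : Pid) (S : Sys St V) : Prop where
  inv : Inv p τ E S
  self : ∃ L P, Comp.proc Δ' p sτ (.rolling τ pτ pr L P) ∈ S
  deps : ∀ y q, wsum (depW y q) S ≤ wsum (noteW y q) S + wsum (childW' p y q) S
  msgs : ∀ y q ℓ, ESince E τ y (.send q ℓ) →
    wsum (onErased (holdW τ y)) S + wsum (tagsW y ℓ) S ≤ wsum (onErased (msgW τ y q ℓ)) S

variable {Δ' : List (Item St V)} {sτ : Option St} {pτ pr : Pid}

theorem Driven.rule (hE : CompleteRecord p τ E) {A B T : Sys St V}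
    (hS : Driven p τ E Δ' sτ pτ pr (A + T)) (h : Roll1Rule A B ∨ UndoRule A B)
    (hB : KeepsRolling p A B) : Driven p τ E Δ' sτ pτ pr (B + T) := by
  have hA : ∀ c ∈ A, CompOK p τ E c := fun c hc => hS.inv.ok c (by simp [hc])
  have hinv : Inv p τ E (B + T) := hS.inv.propStep hE ⟨A, B, T, h, rfl, rfl⟩
  refine ⟨hinv, ?_, ?_, ?_⟩
  · obtain ⟨L, P, h1⟩ := hS.self
    rcases Multiset.mem_add.1 h1 with h1 | h1
    · obtain ⟨L', P', h2⟩ := hB _ _ _ _ _ _ _ h1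
      exact ⟨L', P', Multiset.mem_add.2 (.inl h2)⟩
    · exact ⟨L, P, Multiset.mem_add.2 (.inr h1)⟩
  · intro y q
    have hp : ∀ Δ s, Comp.proc Δ p s .normal ∉ A := by
      intro Δ s h1
      obtain ⟨L, P, h2⟩ := hS.self
      have := (hS.inv.proc_unique h2 (Multiset.mem_add.2 (.inl h1))).2.2
      cases this
    rcases wsum_depW_le hE h hA hB hp y q with h1 | ⟨Δ, s, m, h1, h2⟩
    · have h3 := hS.deps y q
      simp only [wsum_add] at h3 ⊢
      omega
    · rw [hinv.depW_eq (Multiset.mem_add.2 (.inl h1)), h2]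
      omega
  · intro y q ℓ hs
    have h1 := hS.msgs y q ℓ hs
    have h2 := wsum_msgW_le hE h hA y q ℓ
    simp only [wsum_add] at h1 ⊢
    omega

theorem exists_pair {α : Type*} {S : Multiset α} {a b : α} (ha : a ∈ S) (hb : b ∈ S)
    (hab : a ≠ b) : ∃ T, S = {a, b} + T := by
  obtain ⟨T, rfl⟩ := Multiset.exists_cons_of_mem ha
  obtain ⟨T, rfl⟩ := Multiset.exists_cons_of_mem ((Multiset.mem_cons.1 hb).resolve_left hab.symm)
  exact ⟨T, by simp⟩

/-- The number of requests that are pending or that will be made by processes holding `τ`. -/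
def requestW (τ : Chk) : Comp St V → ℕ
  | .proc Δ _ _ _ => (chk τ Δ).elim 0 fun x => x.deps.card
  | .note _ _ (.roll _ _) => 1
  | _ => 0

theorem wsum_requestW_rollNotes (z pτ : Pid) (τ : Chk) (P : Finset Pid) :
    wsum (requestW τ) (rollNotes (St := St) (V := V) z pτ τ P) = P.card := by
  rw [rollNotes, wsum_map]
  simp [wsum, requestW]

/-- All requests can be delivered. -/
theorem Driven.deliver (hE : CompleteRecord p τ E) {S : Sys St V}
    (hS : Driven p τ E Δ' sτ pτ pr S) (hw : ∀ Δ z s τ', Comp.proc Δ z s (.waiting τ') ∉ S)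
    (hpid : ∀ e z s, EComp.proc e z s ∈ E → 1 ≤ wsum (onErased (pidW z)) S) :
    ∃ S', Relation.ReflTransGen PropStep S S' ∧ Driven p τ E Δ' sτ pτ pr S' ∧
      ∀ y q pτ' τ', Comp.note y q (.roll pτ' τ') ∉ S' := by
  induction hn : wsum (requestW τ) S using Nat.strong_induction_on generalizing S with
  | _ n ih =>
  subst hn
  by_cases hnote : ∀ y q pτ' τ', Comp.note y q (.roll pτ' τ') ∉ S
  · exact ⟨S, .refl, hS, hnote⟩
  push Not at hnote
  obtain ⟨y, q, pτ', τ', hnote⟩ := hnote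
  have hok : RollOK p τ E q pτ' τ' := hS.inv.ok _ hnote
  obtain rfl := hok.chk_eq
  obtain ⟨e, s₀, he⟩ := hok.dst_mem
  obtain ⟨c, hc, hcq⟩ := exists_of_wsum_pos (hpid e q s₀ he)
  rcases c with ⟨Δ, z, s, m⟩ | _ | _
  rotate_left
  · simp [pidW] at hcq
  · simp at hcq
  have hz : z = q := by
    by_contra h
    simp [pidW, h] at hcq
  subst hz
  obtain ⟨T, rfl⟩ := exists_pair hnote hc (by simp)
  -- The mode of the addressee decides between Roll1, Roll2 and Roll3. The addressee exists by
  -- `hpid`, and `hw` excludes the waiting mode, in which no rule accepts a request.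
  suffices hsuff : ∃ B, (Roll1Rule {.note y z (.roll pτ' τ'), .proc Δ z s m} B ∨
      UndoRule {.note y z (.roll pτ' τ'), .proc Δ z s m} B) ∧
      KeepsRolling p {.note y z (.roll pτ' τ'), .proc Δ z s m} B ∧
      (∀ Δ z s τ', Comp.proc Δ z s (.waiting τ') ∉ B) ∧
      (∀ w, wsum (onErased (pidW w)) B =
        wsum (onErased (pidW w)) {.note y z (.roll pτ' τ'), .proc Δ z s m}) ∧
      wsum (requestW τ') B < wsum (requestW τ') {.note y z (.roll pτ' τ'), .proc Δ z s m} by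
    obtain ⟨B, h1, h2, h3, h4, h5⟩ := hsuff
    have hw' : ∀ Δ z s τ', Comp.proc Δ z s (.waiting τ') ∉ B + T := by
      intro Δ₁ z₁ s₁ τ₁ h6
      rcases Multiset.mem_add.1 h6 with h6 | h6
      · exact h3 _ _ _ _ h6
      · exact hw _ _ _ _ (Multiset.mem_add.2 (.inr h6))
    have hpid' : ∀ e z s, EComp.proc e z s ∈ E → 1 ≤ wsum (onErased (pidW z)) (B + T) := by
      intro e z₁ s₁ h6
      have := hpid e z₁ s₁ h6
      rw [wsum_add, h4, ← wsum_add]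
      exact this
    obtain ⟨S', h6, h7⟩ := ih (wsum (requestW τ') (B + T)) (by simp only [wsum_add]; omega)
      (hS.rule hE h1 h2) hw' hpid' rfl
    exact ⟨S', .head ⟨_, B, T, h1, rfl, rfl⟩ h6, h7⟩
  obtain ⟨L₀, P₀, hself⟩ := hS.self
  have hok2 := hS.inv.proc_ok hc
  cases m with
  | waiting τ'' => exact absurd hc (hw _ _ _ _)
  | normal =>
    have hzp : z ≠ p := by
      rintro rfl
      have := (hS.inv.proc_unique hc hself).2.2
      cases this
    cases hx : chk τ' Δ with
    | some x =>
      obtain ⟨n, hcut⟩ := hok2.cut hE hx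
      refine ⟨_, .inl (.roll1 hx), ?_, ?_, ?_, ?_⟩
      · intro Δ₁ s₁ τ₁ pτ₁ pr₁ L₁ P₁ h
        simp at h
      · intro Δ₁ z₁ s₁ τ₁ h
        rcases Multiset.mem_cons.1 h with h | h
        · cases h
        · rcases Multiset.mem_add.1 h with h | h
          · obtain ⟨_, _, h⟩ := Multiset.mem_map.1 h
            cases h
          · obtain ⟨_, _, _, _, _, h⟩ := hcut.allMsgs _ h
            cases h
      · intro w
        rw [wsum_cons, wsum_add, wsum_rollNotes_eq_zero (by simp),
          hcut.allMsgs.wsum_eq_zero (by simp [pidW])]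
        simp [pidW]
      -- The new requests were already counted as future requests of this holder of `τ`, so the
      -- consumed one is the net decrease.
      · rw [wsum_cons, wsum_add, wsum_requestW_rollNotes,
          hcut.allMsgs.wsum_eq_zero (by simp [requestW])]
        simp [requestW, hx, chk_eq_none_iff.2 hcut.not_holds]
    | none =>
      rw [chk_eq_none_iff] at hx
      refine ⟨_, .inr (.roll2 (mt mem_chks_iff.1 hx)), ?_, ?_, ?_, ?_⟩
      · intro Δ₁ s₁ τ₁ pτ₁ pr₁ L₁ P₁ h
        simp at h
      · simp
      · simp [pidW]
      · simp [requestW]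
  | rolling τ'' p₁ p₂ L P =>
    obtain rfl := (hok2.rolling _ _ _ _ _ rfl).1
    refine ⟨_, .inr (.roll3 (.inl rfl)), ?_, ?_, ?_, ?_⟩
    · intro Δ₁ s₁ τ₁ pτ₁ pr₁ L₁ P₁ h
      simp only [Multiset.insert_eq_cons, Multiset.mem_cons, Multiset.mem_singleton, reduceCtorEq,
        false_or, Comp.proc.injEq, Mode.rolling.injEq] at h
      obtain ⟨rfl, rfl, rfl, rfl, rfl, rfl, rfl, rfl⟩ := h
      exact ⟨_, _, Multiset.mem_cons_self _ _⟩
    · simp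
    · simp [pidW]
    · simp [requestW]

theorem exists_of_noteW {S : Sys St V} {y q : Pid} (h : 0 < wsum (noteW y q) S) :
    (∃ pτ τ', Comp.note y q (.roll pτ τ') ∈ S) ∨ (∃ τ', Comp.note q y (.doneAsync τ') ∈ S) ∨
      ∃ τ', Comp.note q y (.doneSync τ') ∈ S := by
  obtain ⟨c, hc, h⟩ := exists_of_wsum_pos h
  rcases c with _ | _ | ⟨x, z, n⟩
  · simp [noteW] at h
  · simp [noteW] at h
  cases n with
  | roll pτ τ' =>
    simp only [noteW] at h
    split_ifs at h with h1
    · obtain ⟨rfl, rfl⟩ := h1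
      exact .inl ⟨_, _, hc⟩
    · omega
  | doneAsync τ' =>
    simp only [noteW] at h
    split_ifs at h with h1
    · obtain ⟨rfl, rfl⟩ := h1
      exact .inr (.inl ⟨_, hc⟩)
    · omega
  | doneSync τ' =>
    simp only [noteW] at h
    split_ifs at h with h1
    · obtain ⟨rfl, rfl⟩ := h1
      exact .inr (.inr ⟨_, hc⟩)
    · omega
  | resume => simp [noteW] at h
  | commit => simp [noteW] at h

theorem exists_of_childW' {S : Sys St V} {y q : Pid} (h : 0 < wsum (childW' p y q) S) :
    q ≠ p ∧ ∃ Δ s τ' pτ L P, Comp.proc Δ q s (.rolling τ' pτ y L P) ∈ S := by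
  obtain ⟨c, hc, h⟩ := exists_of_wsum_pos h
  have hq : q ≠ p := by
    rintro rfl
    simp [childW'] at h
  simp only [childW', hq, if_false] at h
  refine ⟨hq, ?_⟩
  rcases c with ⟨Δ, z, s, m⟩ | _ | _
  · cases m with
    | rolling τ' pτ pr L P =>
      simp only [childW] at h
      split_ifs at h with h1
      · obtain ⟨rfl, rfl⟩ := h1
        exact ⟨_, _, _, _, _, _, hc⟩
      · omega
    | _ => simp [childW] at h
  · simp [childW] at h
  · simp [childW] at h

/-- When all requests have been delivered, no process holds `τ`. -/
theorem Driven.not_holds (hE : CompleteRecord p τ E) {S : Sys St V}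
    (hS : Driven p τ E Δ' sτ pτ pr S) (hn : ∀ y q pτ' τ', Comp.note y q (.roll pτ' τ') ∉ S)
    {Δ z s m} (h : Comp.proc Δ z s m ∈ S) : ¬ EHolds τ (eraseHist Δ) := by
  have hedge : ∀ y q, wsum (onErased (holdW τ y)) S = 0 → Contacts E τ y q →
      wsum (onErased (holdW τ q)) S = 0 := by
    intro y q h1 h2
    have h3 := hS.inv.edge y q h2
    -- If `y` waits for `q`, there is a token. It is not a request, so it is an answer of `q` or `q`
    -- is rolling; in both cases `q` no longer holds `τ`.
    by_cases h4 : wsum (depW y q) S = 0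
    · omega
    have h5 := hS.deps y q
    by_cases h6 : wsum (noteW y q) S = 0
    · obtain ⟨-, _, _, _, _, _, _, h7⟩ :=
        exists_of_childW' (p := p) (S := S) (y := y) (q := q) (by omega)
      exact hS.inv.holdW_eq_zero h7 (by simp)
    · refine (hS.inv.done q).resolve_left ?_
      rcases exists_of_noteW (Nat.pos_of_ne_zero h6) with ⟨_, _, h7⟩ | ⟨_, h7⟩ | ⟨_, h7⟩
      · exact absurd h7 (hn _ _ _ _)
      · have := le_wsum (f := doneW q) h7
        simp only [doneW, if_true] at this
        omega
      · have := le_wsum (f := doneW q) h7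
        simp only [doneW, if_true] at this
        omega
  have hdep : ∀ w, EDependsOn E τ p w → wsum (onErased (holdW τ w)) S = 0 := by
    intro w hw
    induction hw with
    | refl =>
      obtain ⟨L, P, hp⟩ := hS.self
      exact hS.inv.holdW_eq_zero hp (by simp)
    | spawn _ h ih => exact hedge _ _ ih (.inr h)
    | message _ h _ ih => exact hedge _ _ ih (.inl ⟨_, h⟩)
  intro hh
  obtain ⟨e₀, s₀, h1, -, h2⟩ := (hS.inv.proc_ok h).orig
  have h3 := hS.inv.holdW_eq h
  rw [← (h2 hh).2] at h1
  rw [hdep z (hE.depends _ _ _ h1 hh)] at h3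
  simp [holdW, hh] at h3

/-- A bound on the number of steps that remain when all requests have been delivered. -/
def remainingW : Comp St V → ℕ
  | .proc _ _ _ (.rolling _ _ _ L _) => 2 + L.card
  | .note _ _ (.doneAsync _) => 1
  | .note _ _ (.doneSync _) => 1
  | _ => 0

/-- Its total bounds all ranks, which permits induction towards higher ranks. -/
def rankW (r : Pid → ℕ) : Comp St V → ℕ
  | .proc _ z _ _ => r z
  | _ => 0

/-- When all requests have been delivered, and nothing but `p` can proceed, `p` has finished. -/
theorem Driven.finished {S : Sys St V} (hS : Driven p τ E Δ' sτ pτ pr S)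
    (hn : ∀ y q pτ' τ', Comp.note y q (.roll pτ' τ') ∉ S)
    (hL : ∀ Δ z s τ' pτ pr L P, Comp.proc Δ z s (.rolling τ' pτ pr L P) ∈ S → L = ∅)
    (hd : ∀ Δ z s τ' pτ pr L P, Comp.proc Δ z s (.rolling τ' pτ pr L P) ∈ S →
      ∀ y τ'', Comp.note y z (.doneAsync τ'') ∉ S ∧ Comp.note y z (.doneSync τ'') ∉ S)
    (hP : ∀ Δ z s τ' pτ pr L, Comp.proc Δ z s (.rolling τ' pτ pr L ∅) ∈ S → z = p) :
    ∃ S₂, S = .proc Δ' p sτ (.rolling τ pτ pr ∅ ∅) ::ₘ S₂ := by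
  obtain ⟨r, hr⟩ := hS.inv.rank
  -- Induction towards higher ranks. An awaited process with no notification in transit is a rolling
  -- child of larger rank; by induction it awaits nobody, so `hP` makes it `p`, although children of
  -- this kind are different from `p`.
  have key : ∀ k Δ z s τ' pτ pr L P, Comp.proc Δ z s (.rolling τ' pτ pr L P) ∈ S →
      wsum (rankW r) S - r z = k → P = ∅ := by
    intro k
    induction k using Nat.strong_induction_on with
    | _ k ih =>
      intro Δ z s τ' pτ pr L P h hk
      subst hk
      rw [Finset.eq_empty_iff_forall_notMem]
      intro q hq
      have h1 : 1 ≤ wsum (depW z q) S := by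
        have := le_wsum (f := depW z q) h
        simpa [depW, hq] using this
      have h2 := hS.deps z q
      by_cases h3 : wsum (noteW z q) S = 0
      · obtain ⟨hqp, Δ₁, s₁, τ₁, pτ₁, L₁, P₁, h4⟩ :=
          exists_of_childW' (p := p) (S := S) (y := z) (q := q) (by omega)
        have h5 := hr _ _ _ _ _ _ _ _ h4 hqp
        have h6 : r q ≤ wsum (rankW r) S := le_wsum (f := rankW r) h4
        have h7 := ih _ (by omega) _ _ _ _ _ _ _ _ h4 rfl
        subst h7
        exact hqp (hP _ _ _ _ _ _ _ h4)
      · rcases exists_of_noteW (Nat.pos_of_ne_zero h3) with ⟨_, _, h7⟩ | ⟨_, h7⟩ | ⟨_, h7⟩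
        · exact hn _ _ _ _ h7
        · exact (hd _ _ _ _ _ _ _ _ h _ _).1 h7
        · exact (hd _ _ _ _ _ _ _ _ h _ _).2 h7
  obtain ⟨L, P, h⟩ := hS.self
  obtain rfl := hL _ _ _ _ _ _ _ _ h
  obtain rfl := key _ _ _ _ _ _ _ _ _ h rfl
  exact Multiset.exists_cons_of_mem h

/-- When all requests have been delivered, `p` can finish its rollback. -/
theorem Driven.finish (hE : CompleteRecord p τ E) {S : Sys St V}
    (hS : Driven p τ E Δ' sτ pτ pr S)
    (hn : ∀ y q pτ' τ', Comp.note y q (.roll pτ' τ') ∉ S) :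
    ∃ S₂, Relation.ReflTransGen PropStep S (.proc Δ' p sτ (.rolling τ pτ pr ∅ ∅) ::ₘ S₂) := by
  induction hk : wsum remainingW S using Nat.strong_induction_on generalizing S with
  | _ k ih =>
  subst hk
  -- It remains to find one rule that keeps `p` rolling, makes no request and decreases
  -- `remainingW`, or to see that `p` has finished.
  have step : ∀ A B T, S = A + T → UndoRule A B → KeepsRolling p A B →
      (∀ y q pτ' τ', Comp.note y q (.roll pτ' τ') ∉ B) → wsum remainingW B < wsum remainingW A →
      ∃ S₂, Relation.ReflTransGen PropStep S
        (.proc Δ' p sτ (.rolling τ pτ pr ∅ ∅) ::ₘ S₂) := by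
    rintro A B T rfl h1 h2 h3 h4
    obtain ⟨S₂, h5⟩ := ih (wsum remainingW (B + T)) (by simp only [wsum_add]; omega)
      (hS.rule hE (.inr h1) h2) (fun y q pτ' τ' h => by
        rcases Multiset.mem_add.1 h with h | h
        · exact h3 _ _ _ _ h
        · exact hn _ _ _ _ (Multiset.mem_add.2 (.inr h))) rfl
    exact ⟨S₂, .head ⟨A, B, T, .inr h1, rfl, rfl⟩ h5⟩
  by_cases hL : ∀ Δ z s τ' pτ pr L P, Comp.proc Δ z s (.rolling τ' pτ pr L P) ∈ S → L = ∅
  swap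
  · push Not at hL
    obtain ⟨Δ, z, s, τ', pτ', pr', L, P, h, hL⟩ := hL
    obtain ⟨ℓ, hℓ⟩ := hL
    obtain ⟨q, hq⟩ := ((hS.inv.proc_ok h).rolling _ _ _ _ _ rfl).2.2 ℓ hℓ
    have h1 : 1 ≤ wsum (tagsW z ℓ) S := by
      have := le_wsum (f := tagsW z ℓ) h
      simpa [tagsW, hℓ] using this
    have h2 := hS.msgs z q ℓ hq
    -- `Driven.msgs` provides the message. As nobody holds `τ`, it cannot be recorded since `τ`, so
    -- it is on the network.
    obtain ⟨c, hc, h3⟩ := exists_of_wsum_pos (f := onErased (msgW τ z q ℓ)) (M := S) (by omega)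
    rcases c with ⟨Δ₁, z₁, s₁, m₁⟩ | ⟨C, y', q', ℓ', v⟩ | _
    · simp [msgW, since_of_not (hS.not_holds hE hn hc)] at h3
    · simp only [onErased_msg, msgW, Prod.mk.injEq] at h3
      split_ifs at h3 with h4
      · obtain ⟨rfl, rfl, rfl⟩ := h4
        obtain ⟨T, hT⟩ := exists_pair hc h (by simp)
        refine step _ _ T hT (.undoSend hℓ) ?_ (by simp) ?_
        · intro Δ₁ s₁ τ₁ pτ₁ pr₁ L₁ P₁ h
          simp only [Multiset.insert_eq_cons, Multiset.mem_cons, Multiset.mem_singleton,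
            reduceCtorEq, false_or, Comp.proc.injEq, Mode.rolling.injEq] at h
          obtain ⟨rfl, rfl, rfl, rfl, rfl, rfl, rfl, rfl⟩ := h
          exact ⟨_, _, Multiset.mem_singleton_self _⟩
        · have := Finset.card_erase_lt_of_mem hℓ
          simp only [Multiset.insert_eq_cons, wsum_cons, wsum_singleton, remainingW]
          omega
      · omega
    · simp at h3
  by_cases hd : ∀ Δ z s τ' pτ pr L P, Comp.proc Δ z s (.rolling τ' pτ pr L P) ∈ S →
      ∀ y τ'', Comp.note y z (.doneAsync τ'') ∉ S ∧ Comp.note y z (.doneSync τ'') ∉ S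
  swap
  · push Not at hd
    obtain ⟨Δ, z, s, τ', pτ', pr', L, P, h, y, τ'', hd⟩ := hd
    obtain rfl := ((hS.inv.proc_ok h).rolling _ _ _ _ _ rfl).1
    obtain rfl := hL _ _ _ _ _ _ _ _ h
    by_cases ha : Comp.note y z (.doneAsync τ'') ∈ S
    · obtain rfl : τ'' = τ' := hS.inv.ok _ ha
      obtain ⟨T, hT⟩ := exists_pair ha h (by simp)
      refine step _ _ T hT .undoDep1 ?_ (by simp) ?_
      · intro Δ₁ s₁ τ₁ pτ₁ pr₁ L₁ P₁ h
        simp only [Multiset.insert_eq_cons, Multiset.mem_cons, Multiset.mem_singleton,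
          reduceCtorEq, false_or, Comp.proc.injEq, Mode.rolling.injEq] at h
        obtain ⟨rfl, rfl, rfl, rfl, rfl, rfl, rfl, rfl⟩ := h
        exact ⟨_, _, Multiset.mem_singleton_self _⟩
      · simp [remainingW]
    · have hs := hd ha
      obtain rfl : τ'' = τ' := hS.inv.ok _ hs
      obtain ⟨T, hT⟩ := exists_pair hs h (by simp)
      refine step _ _ T hT .undoDep2 ?_ (by simp) ?_
      · intro Δ₁ s₁ τ₁ pτ₁ pr₁ L₁ P₁ h
        simp only [Multiset.insert_eq_cons, Multiset.mem_cons, Multiset.mem_singleton,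
          reduceCtorEq, false_or, Comp.proc.injEq, Mode.rolling.injEq] at h
        obtain ⟨rfl, rfl, rfl, rfl, rfl, rfl, rfl, rfl⟩ := h
        exact ⟨_, _, Multiset.mem_cons_self _ _⟩
      · simp [remainingW]
  by_cases hP : ∀ Δ z s τ' pτ pr L, Comp.proc Δ z s (.rolling τ' pτ pr L ∅) ∈ S → z = p
  swap
  · push Not at hP
    obtain ⟨Δ, z, s, τ', pτ', pr', L, h, hz⟩ := hP
    obtain rfl := hL _ _ _ _ _ _ _ _ h
    have hne := (hS.inv.proc_ok h).ne_initiator hz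
    obtain ⟨T, hT⟩ := Multiset.exists_cons_of_mem h
    rw [← Multiset.singleton_add] at hT
    have hkeep : ∀ B, KeepsRolling p {Comp.proc Δ z s (.rolling τ' pτ' pr' ∅ ∅)} B := by
      intro B Δ₁ s₁ τ₁ pτ₁ pr₁ L₁ P₁ h
      simp only [Multiset.mem_singleton, Comp.proc.injEq] at h
      exact absurd h.2.1.symm hz
    cases s with
    | none => exact step _ _ T hT (.resume2 hne) (hkeep _) (by simp) (by simp [remainingW])
    | some s =>
      exact step _ _ T hT (.resume3 hne (by simp)) (hkeep _) (by simp) (by simp [remainingW])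
  obtain ⟨S₂, rfl⟩ := hS.finished hn hL hd hP
  exact ⟨S₂, .refl⟩

/-- Once `p` has received a request, it can roll back. -/
theorem Start.exists_derivation (hE : CompleteRecord p τ E) {Δ : List (Item St V)} {s : Option St}
    {x : Extract St V} {T : Sys St V} (hx : chk τ Δ = some x)
    (hS : Start p τ E (rollLhs pr p pτ τ Δ s + T)) :
    ∃ S₂, Relation.ReflTransGen PropStep (rollRhs pr p pτ τ x + T)
      (.proc x.hist p x.state (.rolling τ pτ pr ∅ ∅) ::ₘ S₂) := by
  have hinv := hS.inv hE
  have hrule : Roll1Rule (rollLhs pr p pτ τ Δ s) (rollRhs pr p pτ τ x) := .roll1 hx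
  obtain ⟨n, hc⟩ := (hinv.proc_ok (Multiset.mem_add.2 (.inl (by simp))) :
    ProcOK p τ E Δ p s .normal).cut hE hx
  have hA : ∀ c ∈ rollLhs pr p pτ τ Δ s, CompOK p τ E c :=
    fun c h => hinv.ok c (Multiset.mem_add.2 (.inl h))
  have hD : Driven p τ E x.hist x.state pτ pr (rollRhs pr p pτ τ x + T) := by
    refine ⟨hinv.propStep hE ⟨_, _, T, .inl hrule, rfl, rfl⟩, ⟨x.tags, x.deps, by simp⟩, ?_, ?_⟩
    · intro y q
      -- Nobody waits before the first step, so the only dependencies are the new ones of `p`, each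
      -- matched by its own request.
      have h1 : wsum (depW y q) (rollLhs pr p pτ τ Δ s + T) = 0 :=
        hS.wsum_eq_zero (by simp [depW]) (by simp [depW]) (by simp [depW]) (by simp [depW])
      rw [wsum_add] at h1
      rw [wsum_add, rollRhs, wsum_cons, wsum_add, wsum_rollNotes_eq_zero (by simp [depW]),
        hc.allMsgs.wsum_eq_zero (by simp [depW])]
      rw [wsum_add (noteW y q), wsum_cons (noteW y q), wsum_add (noteW y q), wsum_noteW_rollNotes]
      simp only [depW]
      omega
    · intro y q ℓ hs
      have h1 := wsum_msgW_le hE (.inl hrule) hA y q ℓ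
      have h2 : wsum (tagsW y ℓ) (rollLhs pr p pτ τ Δ s + T) = 0 :=
        hS.wsum_eq_zero (by simp [tagsW]) (by simp [tagsW]) (by simp [tagsW]) (by simp [tagsW])
      have h3 : 1 ≤ wsum (onErased (msgW τ y q ℓ)) (rollLhs pr p pτ τ Δ s + T) := by
        rw [← wsum_onErased, hS.erase_eq]
        exact (hE.sends y q ℓ hs).2
      have h4 : wsum (onErased (holdW τ y)) (rollLhs pr p pτ τ Δ s + T) ≤ 1 := by
        refine le_trans (wsum_mono ?_) (hinv.pid_le y)
        rintro (⟨Δ, z, s, m⟩ | _ | _) _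
        · simp only [onErased_proc, holdW, pidW]
          split_ifs <;> simp_all
        · simp [holdW]
        · simp
      simp only [wsum_add] at h1 h2 h3 h4 ⊢
      omega
  have hw : ∀ Δ z s τ', Comp.proc Δ z s (.waiting τ') ∉ rollRhs pr p pτ τ x + T := by
    intro Δ₁ z₁ s₁ τ₁ h
    rcases Multiset.mem_add.1 h with h | h
    · rcases Multiset.mem_cons.1 h with h | h
      · cases h
      · rcases Multiset.mem_add.1 h with h | h
        · obtain ⟨_, _, h⟩ := Multiset.mem_map.1 h
          cases h
        · obtain ⟨_, _, _, _, _, h⟩ := hc.allMsgs _ h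
          cases h
    · have := hS.normal _ _ _ _ (Multiset.mem_add.2 (.inr h))
      cases this
  have hpid : ∀ e z s, EComp.proc e z s ∈ E →
      1 ≤ wsum (onErased (pidW z)) (rollRhs pr p pτ τ x + T) := by
    intro e z s' h
    have h1 := le_wsum (f := pidW z) h
    rw [← hS.erase_eq, wsum_onErased] at h1
    simp only [pidW, if_true] at h1
    rw [wsum_add] at h1 ⊢
    rw [rollRhs, wsum_cons, wsum_add, wsum_rollNotes_eq_zero (by simp),
      hc.allMsgs.wsum_eq_zero (by simp [pidW])]
    simp [pidW] at h1 ⊢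
    omega
  obtain ⟨S', h1, h2, h3⟩ := hD.deliver hE hw hpid
  obtain ⟨S₂, h4⟩ := h2.finish hE h3
  exact ⟨S₂, h1.trans h4⟩

end

section

variable {p : Pid} {τ : Chk} {E : Multiset (EComp St V)}

/-! ### Invariants of controlled backward derivations -/

/-- The image of a history of the reversible semantics. -/
abbrev eraseRHist (h : List (RItem St V)) : List (EItem St V) := h.filterMap RItem.erase

/-- A process not spawned since `τ` stops at `τ`; a spawned one may go below, where only checkpoints
are left. Requests by tag concern receipts since `τ`, so none of them outlives the checkpoint `τ`. A
holder of `τ` without requests has not moved. -/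
structure RProcOK (p : Pid) (τ : Chk) (E : Multiset (EComp St V)) (e : List (EItem St V)) (z : Pid)
    (s : Option St) (φ : Set Request) : Prop where
  orig : ∃ e₀ s₀, EComp.proc e₀ z s₀ ∈ E ∧ e <:+ e₀ ∧
    (¬ Spawned E τ z → restore τ e s = restore τ e₀ s₀) ∧ (EHolds τ e → φ = ∅ → e = e₀)
  idle : ¬ Spawned E τ z → ¬ EHolds τ e → φ = ∅
  checks : Spawned E τ z → ¬ EHolds τ e → ∀ a ∈ e, ∃ τ' s', a = EItem.check τ' s'
  active : EHolds τ e → .chk τ ∈ φ ∨ (φ = ∅ ∧ z ≠ p)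
  tags : ∀ ℓ, .tag ℓ ∈ φ → ∃ y v, EItem.recv y z ℓ v ∈ since τ e
  sp : .sp ∈ φ → Spawned E τ z
  chks : ∀ τ', .chk τ' ∈ φ → τ' = τ

theorem EHolds.mono {e e' : List (EItem St V)} (h : EHolds τ e) (hs : e ⊆ e') : EHolds τ e' := by
  obtain ⟨s, h⟩ := h
  exact ⟨s, hs h⟩

/-- As `τ` is active only once, undoing newer elements leaves the same checkpoint as the place of
the cut. -/
theorem CompleteRecord.suffix (hE : CompleteRecord p τ E) {e e₀ : List (EItem St V)} {z : Pid}
    {s₀ : Option St} (h : EComp.proc e₀ z s₀ ∈ E) (hs : e <:+ e₀) (hh : EHolds τ e) :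
    since τ e ⊆ since τ e₀ ∧ (∀ s, restore τ e s = restore τ e₀ s₀) ∧
      ∀ s, ¬ EHolds τ (restore τ e s).1 := by
  obtain ⟨u, rfl⟩ := hs
  have h1 := hE.holds_once _ _ _ h (hh.mono (by simp))
  have h2 : ∀ s, restore τ e s = restore τ (u ++ e) s₀ := fun s => (restore_append s₀ s hh h1).symm
  refine ⟨?_, h2, fun s => ?_⟩
  · rw [since_append s₀ hh h1]
    simp
  · rwa [h2]

theorem RProcOK.chk_mem {e : List (EItem St V)} {z : Pid} {s : Option St} {φ : Set Request}
    (h : RProcOK p τ E e z s φ) (hφ : φ.Nonempty) (hh : EHolds τ e) : .chk τ ∈ φ := by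
  rcases h.active hh with h1 | ⟨rfl, -⟩
  · exact h1
  · simp at hφ

/-- A process with a request does not undo actions recorded before `τ`. -/
theorem RProcOK.pop (hE : CompleteRecord p τ E) {a : EItem St V} {e : List (EItem St V)} {z : Pid}
    {s : Option St} {φ : Set Request} (h : RProcOK p τ E (a :: e) z s φ) (hφ : φ.Nonempty)
    (ha : ∀ τ' s', a ≠ .check τ' s') : EHolds τ e ∧ .chk τ ∈ φ ∧ ESince E τ z a := by
  have hh : EHolds τ (a :: e) := by
    by_contra hh
    by_cases hz : Spawned E τ z
    · obtain ⟨τ', s', h1⟩ := h.checks hz hh a (by simp)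
      exact ha _ _ h1
    · exact hφ.ne_empty (h.idle hz hh)
  have hh' : EHolds τ e := (eholds_cons.1 hh).resolve_left fun ⟨s, h⟩ => ha _ _ h
  obtain ⟨e₀, s₀, h1, h2, -⟩ := h.orig
  refine ⟨hh', h.chk_mem hφ hh, e₀, s₀, h1, (hE.suffix h1 h2 hh).1 ?_⟩
  rw [since_cons (fun s => ha τ s) hh']
  simp

theorem RProcOK.undo (hE : CompleteRecord p τ E) {a : EItem St V} {e : List (EItem St V)} {z : Pid}
    {s : Option St} {φ φ' : Set Request} (h : RProcOK p τ E (a :: e) z s φ) (hφ : φ.Nonempty)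
    (ha : ∀ τ' s', a ≠ .check τ' s') (hφ' : φ' ⊆ φ) (hc : .chk τ ∈ φ → .chk τ ∈ φ')
    (ht : ∀ y q ℓ v, a = .recv y q ℓ v → .tag ℓ ∉ φ') (s' : Option St) :
    RProcOK p τ E e z s' φ' := by
  obtain ⟨hh, hτ, -⟩ := h.pop hE hφ ha
  obtain ⟨e₀, s₀, h1, h2, h3, -⟩ := h.orig
  refine ⟨⟨e₀, s₀, h1, (List.suffix_cons _ _).trans h2, ?_, ?_⟩, ?_, ?_, ?_, ?_, ?_, ?_⟩
  · intro hz
    rw [← h3 hz, restore_cons (fun s => ha τ s) hh]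
  · rintro - rfl
    exact absurd (hc hτ) (by simp)
  · exact fun _ h => absurd hh h
  · exact fun _ h => absurd hh h
  · exact fun _ => .inl (hc hτ)
  · intro ℓ hℓ
    obtain ⟨y, v, h4⟩ := h.tags ℓ (hφ' hℓ)
    rw [since_cons (fun s => ha τ s) hh] at h4
    rcases List.mem_cons.1 h4 with h4 | h4
    · exact absurd hℓ (ht _ _ _ _ h4.symm)
    · exact ⟨y, v, h4⟩
  · exact fun h4 => h.sp (hφ' h4)
  · exact fun τ' h4 => h.chks _ (hφ' h4)

theorem RProcOK.undo_check (hE : CompleteRecord p τ E) {τ' : Chk} {e : List (EItem St V)} {z : Pid}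
    {s s' : Option St} {φ : Set Request} (h : RProcOK p τ E (.check τ' s' :: e) z s φ)
    (hφ : φ.Nonempty) : RProcOK p τ E e z s' (φ \ {.chk τ'}) := by
  obtain ⟨e₀, s₀, h1, h2, h3, -⟩ := h.orig
  have h2' : e <:+ e₀ := (List.suffix_cons _ _).trans h2
  by_cases hτ : τ' = τ
  · subst hτ
    have hh : EHolds τ' (.check τ' s' :: e) := ⟨s', by simp⟩
    obtain ⟨-, h4, h5⟩ := hE.suffix h1 h2 hh
    have h6 := h5 s
    rw [restore_check] at h6
    dsimp only at h6
    -- Nothing newer than `τ` is left, hence no request by tag; only `sp` can survive the undoing of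
    -- `τ`.
    have h7 : ∀ r ∈ φ \ {.chk τ'}, r = .sp := by
      rintro (τ'' | ℓ | _) ⟨hr, hr'⟩
      · obtain rfl := h.chks _ hr
        exact absurd rfl hr'
      · obtain ⟨y, v, h8⟩ := h.tags _ hr
        simp [since_check] at h8
      · rfl
    refine ⟨⟨e₀, s₀, h1, h2', ?_, fun h => absurd h h6⟩, ?_, ?_, fun h => absurd h h6, ?_, ?_, ?_⟩
    · intro hz
      rw [← h4 s, restore_check, restore_of_not h6]
    · intro hz _
      rw [Set.eq_empty_iff_forall_notMem]
      intro r hr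
      obtain rfl := h7 r hr
      exact hz (h.sp hr.1)
    · intro hz _
      have := (hE.spawned_holds h1 hz).2.2.2
      rwa [← h4 s, restore_check] at this
    · intro ℓ hℓ
      cases h7 _ hℓ
    · exact fun h8 => h.sp h8.1
    · exact fun τ'' h8 => h.chks _ h8.1
  · have hne : ∀ s, EItem.check (St := St) (V := V) τ' s' ≠ .check τ s := by
      intro s h
      cases h
      exact hτ rfl
    have hiff : EHolds τ (.check τ' s' :: e) ↔ EHolds τ e := by
      rw [eholds_cons]
      exact ⟨fun h => h.resolve_left fun ⟨s, h⟩ => hne s h, .inr⟩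
    refine ⟨⟨e₀, s₀, h1, h2', ?_, ?_⟩, ?_, ?_, ?_, ?_, ?_, ?_⟩
    · intro hz
      by_cases hh : EHolds τ e
      · rw [← h3 hz, restore_cons hne hh]
      · exact absurd (h.idle hz (mt hiff.1 hh)) hφ.ne_empty
    · intro hh he
      have : Request.chk τ ∈ φ \ {.chk τ'} := ⟨h.chk_mem hφ (hiff.2 hh), by simp [Ne.symm hτ]⟩
      rw [he] at this
      exact absurd this (by simp)
    · intro hz hh
      rw [h.idle hz (mt hiff.1 hh)]
      simp
    · exact fun hz hh a ha => h.checks hz (mt hiff.1 hh) a (by simp [ha])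
    · exact fun hh => .inl ⟨h.chk_mem hφ (hiff.2 hh), by simp [Ne.symm hτ]⟩
    · rintro ℓ ⟨hℓ, -⟩
      obtain ⟨y, v, h4⟩ := h.tags ℓ hℓ
      by_cases hh : EHolds τ e
      · rw [since_cons hne hh] at h4
        exact ⟨y, v, by simpa using h4⟩
      · simp [since_of_not (mt hiff.1 hh)] at h4
    · exact fun h8 => h.sp h8.1
    · exact fun τ'' h8 => h.chks _ h8.1

theorem RProcOK.undo_seq {e : List (EItem St V)} {z : Pid} {s : Option St} {φ : Set Request}
    (h : RProcOK p τ E e z s φ) (hφ : φ.Nonempty) (s' : Option St) : RProcOK p τ E e z s' φ := by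
  obtain ⟨e₀, s₀, h1, h2, h3, h4⟩ := h.orig
  refine ⟨⟨e₀, s₀, h1, h2, fun hz => ?_, h4⟩, h.idle, h.checks, h.active, h.tags, h.sp, h.chks⟩
  by_cases hh : EHolds τ e
  · rw [← h3 hz, restore_indep hh]
  · exact absurd (h.idle hz hh) hφ.ne_empty

theorem RProcOK.drop_sp {z : Pid} {s : Option St} {φ : Set Request}
    (h : RProcOK p τ E [] z s φ) : RProcOK p τ E [] z s (φ \ {.sp}) := by
  have hh : ¬ EHolds τ ([] : List (EItem St V)) := by simp [EHolds]
  obtain ⟨e₀, s₀, h1, h2, h3, h4⟩ := h.orig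
  refine ⟨⟨e₀, s₀, h1, h2, h3, fun h => absurd h hh⟩, fun hz _ => ?_, h.checks,
    fun h => absurd h hh, fun ℓ hℓ => h.tags ℓ hℓ.1, fun h' => h.sp h'.1,
    fun τ' h' => h.chks _ h'.1⟩
  rw [h.idle hz hh]
  simp

/-- `hz` prevents a process that has completed its rollback from being woken: the target must still
hold `τ`, or be a spawned process that has to disappear. -/
theorem RProcOK.request {e : List (EItem St V)} {z : Pid} {s : Option St} {φ : Set Request}
    (h : RProcOK p τ E e z s φ) (r : Request) (hz : EHolds τ e ∨ Spawned E τ z)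
    (ht : ∀ ℓ, r = .tag ℓ → ∃ y v, EItem.recv y z ℓ v ∈ since τ e)
    (hsp : r = .sp → Spawned E τ z) (hr : ∀ τ', r = .chk τ' → τ' = τ) :
    RProcOK p τ E e z s (φ ∪ {.chk τ, r}) := by
  obtain ⟨e₀, s₀, h1, h2, h3, h4⟩ := h.orig
  refine ⟨⟨e₀, s₀, h1, h2, h3, fun _ he => ?_⟩, fun h5 h6 => ?_, h.checks, fun _ => .inl (by simp),
    ?_, ?_, ?_⟩
  · have : Request.chk τ ∈ φ ∪ {.chk τ, r} := by simp
    rw [he] at this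
    exact absurd this (by simp)
  · exact absurd hz (by simp [h5, h6])
  · rintro ℓ (hℓ | hℓ | hℓ)
    · exact h.tags ℓ hℓ
    · cases hℓ
    · exact ht ℓ hℓ.symm
  · rintro (hℓ | hℓ | hℓ)
    · exact h.sp hℓ
    · cases hℓ
    · exact hsp hℓ.symm
  · rintro τ' (hℓ | hℓ | hℓ)
    · exact h.chks _ hℓ
    · cases hℓ
      rfl
    · exact hr _ hℓ.symm

/-! ### Global balances of reversible systems -/

/-- The global invariants of controlled backward derivations. -/
structure RBalance (p : Pid) (τ : Chk) (E M : Multiset (EComp St V)) : Prop where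
  pid_le : ∀ z, wsum (pidW z) M ≤ 1
  pid_pos : 1 ≤ wsum (pidW p) M
  msg_le : ∀ y q ℓ, wsum (sendW τ y q ℓ) M ≤ wsum (msgW τ y q ℓ) M
  tag_le : ∀ y q ℓ, ESince E τ y (.send q ℓ) → wsum (tagW ℓ) M ≤ wsum (sendW τ y q ℓ) M
  spawn_le : ∀ q, wsum (spawnW τ q) M ≤ wsum (pidW q) M
  spawned_le : ∀ y q, ESince E τ y (.spawn q) → wsum (pidW q) M ≤ wsum (spawnOfW τ y q) M
  undone : undoneSys p τ E M = undoneSys p τ E E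

/-- The assumptions provide a message for each send and a process for each spawn; uniqueness of
identifiers turns these existence statements into inequalities of weights. -/
theorem RBalance.start (hE : CompleteRecord p τ E) (hp : ∃ e s, EComp.proc e p s ∈ E) :
    RBalance p τ E E := by
  have hpid : ∀ {q}, (∃ e s, EComp.proc e q s ∈ E) → 1 ≤ wsum (pidW q) E := by
    rintro q ⟨e, s, h⟩
    have := le_wsum (f := pidW q) h
    simpa [pidW] using this
  refine ⟨hE.pid_le, hpid hp, ?_, ?_, ?_, ?_, rfl⟩
  · intro y q ℓ
    by_cases h : wsum (sendW τ y q ℓ) E = 0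
    · omega
    obtain ⟨c, hc, h1⟩ := exists_of_wsum_pos (Nat.pos_of_ne_zero h)
    have h2 : ESince E τ y (.send q ℓ) := by
      rcases c with ⟨e, z, s⟩ | _
      · simp only [sendW] at h1
        split_ifs at h1 with h3
        · subst h3
          obtain ⟨a, ha, h4⟩ := List.mem_filterMap.1 (List.count_pos_iff.1 h1)
          cases a <;> simp [EItem.sendKey?] at h4
          obtain ⟨rfl, rfl⟩ := h4
          exact ⟨e, s, hc, ha⟩
        · omega
      · simp [sendW] at h1
    have h3 := (hE.sends _ _ _ h2).2
    have h4 := hE.send_le y q ℓ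
    omega
  · rintro y q ℓ ⟨e, s, h, ha⟩
    refine (hE.tag_le ℓ).trans ((?_ : 1 ≤ _).trans (le_wsum h))
    simp only [sendW, if_true, Nat.one_le_iff_ne_zero, ← Nat.pos_iff_ne_zero, List.count_pos_iff]
    exact List.mem_filterMap.2 ⟨_, ha, rfl⟩
  · intro q
    by_cases h : wsum (spawnW τ q) E = 0
    · omega
    obtain ⟨c, hc, h1⟩ := exists_of_wsum_pos (Nat.pos_of_ne_zero h)
    refine (hE.spawn_le q).trans (hpid ?_)
    rcases c with ⟨e, z, s⟩ | _
    · obtain ⟨a, ha, h4⟩ := List.mem_filterMap.1 (List.count_pos_iff.1 h1)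
      cases a <;> simp [EItem.spawned?] at h4
      subst h4
      obtain ⟨-, e', s', h5, -⟩ := hE.spawns z _ ⟨e, s, hc, ha⟩
      exact ⟨e', s', h5⟩
    · simp [spawnW] at h1
  · rintro y q ⟨e, s, h, ha⟩
    refine (hE.pid_le q).trans ((?_ : 1 ≤ _).trans (le_wsum h))
    simp only [spawnOfW, if_true, Nat.one_le_iff_ne_zero, ← Nat.pos_iff_ne_zero,
      List.count_pos_iff]
    exact List.mem_filterMap.2 ⟨_, ha, rfl⟩

/-- Two systems cannot be told apart by the global invariants. -/
structure Balanced (p : Pid) (τ : Chk) (E A B : Multiset (EComp St V)) : Prop where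
  pid : ∀ z, wsum (pidW z) A = wsum (pidW z) B
  msg : ∀ y q ℓ, wsum (msgW τ y q ℓ) A = wsum (msgW τ y q ℓ) B
  send : ∀ y q ℓ, wsum (sendW τ y q ℓ) A = wsum (sendW τ y q ℓ) B
  tag : ∀ ℓ, wsum (tagW ℓ) A = wsum (tagW ℓ) B
  spawn : ∀ q, wsum (spawnW τ q) A = wsum (spawnW τ q) B
  spawnOf : ∀ y q, wsum (spawnOfW τ y q) A = wsum (spawnOfW τ y q) B
  undone : undoneSys p τ E A = undoneSys p τ E B

theorem RBalance.congr {A B M : Multiset (EComp St V)} (h : Balanced p τ E A B)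
    (hM : RBalance p τ E (A + M)) : RBalance p τ E (B + M) := by
  obtain ⟨h1, h2, h3, h4, h5, h6, h7⟩ := hM
  simp only [wsum_add, undoneSys_add, h.pid, h.msg, h.send, h.tag, h.spawn, h.spawnOf,
    h.undone] at h1 h2 h3 h4 h5 h6 h7
  refine ⟨?_, ?_, ?_, ?_, ?_, ?_, ?_⟩ <;> simpa only [wsum_add, undoneSys_add]

/-- The current state of a process matters to `undone` only if the process is kept and does not hold
`τ`; the hypothesis excludes this. -/
theorem balanced_seq {e : List (EItem St V)} {z : Pid} {s s' : Option St}
    (h : EHolds τ e ∨ Spawned E τ z) : Balanced p τ E {EComp.proc e z s} {EComp.proc e z s'} := by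
  refine ⟨?_, ?_, ?_, ?_, ?_, ?_, ?_⟩ <;>
    simp only [wsum_singleton, pidW, msgW, sendW, tagW, spawnW, spawnOfW, implies_true,
      undoneSys_singleton]
  simp only [undone]
  rcases h with h | h
  · rw [restore_indep h s s']
  · simp [h]

/-- Checkpoints carry none of the counted identifiers, so it is enough that the elements since `τ`
change by this checkpoint at most. The restored data are irrelevant for spawned processes, which
`undone` deletes. -/
theorem balanced_check {τ' : Chk} {e : List (EItem St V)} {z : Pid} {s s' : Option St}
    (h : since τ (.check τ' s' :: e) = .check τ' s' :: since τ e ∨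
      since τ (.check τ' s' :: e) = since τ e)
    (h' : restore τ (.check τ' s' :: e) s = restore τ e s' ∨ Spawned E τ z) :
    Balanced p τ E {EComp.proc (.check τ' s' :: e) z s} {EComp.proc e z s'} := by
  have key : ∀ {β : Type _} (f : EItem St V → Option β), f (.check τ' s') = none →
      (since τ (.check τ' s' :: e)).filterMap f = (since τ e).filterMap f := by
    intro β f hf
    rcases h with h | h
    · rw [h, List.filterMap_cons_none hf]
    · rw [h]
  refine ⟨?_, ?_, ?_, ?_, ?_, ?_, ?_⟩ <;>
    simp only [wsum_singleton, pidW, msgW, sendW, tagW, spawnW, spawnOfW, implies_true,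
      undoneSys_singleton]
  · intro y q ℓ
    rw [key EItem.recvKey? rfl]
  · intro y q ℓ
    rw [key EItem.sendKey? rfl]
  · intro ℓ
    rw [List.filterMap_cons_none rfl]
  · intro q
    rw [key EItem.spawned? rfl]
  · intro y q
    rw [key EItem.spawned? rfl]
  · simp only [undone]
    have : (since τ (.check τ' s' :: e)).filterMap EItem.recvMsg? =
        (since τ e).filterMap EItem.recvMsg? := by
      rcases h with h | h
      · rw [h, List.filterMap_cons_none rfl]
      · rw [h]
    rw [this]
    rcases h' with h' | h'
    · rw [h']
    · simp [h']

/-- The receipt is newer than `τ`, so `msgW` and `undone` already counted the message; it only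
changes its place. -/
theorem balanced_receive {y z : Pid} {ℓ : Tag} {v : V} {e : List (EItem St V)} {s s' : Option St}
    (hh : EHolds τ e) : Balanced p τ E {EComp.proc (.recv y z ℓ v :: e) z s}
      {EComp.proc e z s', EComp.msg y z ℓ v} := by
  have h1 : since τ (.recv y z ℓ v :: e) = .recv y z ℓ v :: since τ e := since_cons (by simp) hh
  refine ⟨?_, ?_, ?_, ?_, ?_, ?_, ?_⟩ <;>
    simp only [wsum_singleton, pidW, msgW, sendW, tagW, spawnW, spawnOfW, implies_true,
      undoneSys_singleton, h1, Multiset.insert_eq_cons, wsum_cons, undoneSys_cons, add_zero]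
  · intro y' q ℓ'
    rw [List.filterMap_cons_some (f := EItem.recvKey?) (b := (y, z, ℓ)) rfl, List.count_cons]
    simp
  · intro y' q ℓ'
    rw [List.filterMap_cons_none rfl]
  · intro ℓ'
    rw [List.filterMap_cons_some (f := EItem.recvTag?) (b := ℓ) rfl, List.count_cons]
    simp
  · intro q
    rw [List.filterMap_cons_none rfl]
  · intro y' q
    rw [List.filterMap_cons_none rfl]
  · classical
    simp only [undone, h1, filterMap_recvMsg_recv]
    rw [restore_cons (by simp) hh s s', ← Multiset.cons_coe, ← Multiset.singleton_add,
      Multiset.filter_add, add_assoc]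
    congr 1
    rw [add_comm]

/-- The recorded send and the message on the network disappear together, which cancels in `msg_le`
and `tag_le`; `undone` never kept the message. -/
theorem RBalance.unsend {z q : Pid} {ℓ : Tag} {v : V} {e : List (EItem St V)} {s s' : Option St}
    {M : Multiset (EComp St V)} (hh : EHolds τ e) (hs : ESince E τ z (.send q ℓ))
    (hM : RBalance p τ E (.proc (.send q ℓ :: e) z s ::ₘ .msg z q ℓ v ::ₘ M)) :
    RBalance p τ E (.proc e z s' ::ₘ M) := by
  have h1 : since τ (.send q ℓ :: e) = .send q ℓ :: since τ e := since_cons (by simp) hh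
  obtain ⟨hpid, hpos, hmsg, htag, hspawn, hspawned, hu⟩ := hM
  simp only [wsum_cons, undoneSys_cons, pidW, msgW, sendW, tagW, spawnW, spawnOfW, h1,
    List.filterMap_cons_some (f := EItem.sendKey?) (a := EItem.send q ℓ) (b := (q, ℓ)) rfl,
    List.filterMap_cons_none (f := EItem.recvKey?) (a := EItem.send q ℓ) rfl,
    List.filterMap_cons_none (f := EItem.recvTag?) (a := EItem.send q ℓ) rfl,
    List.filterMap_cons_none (f := EItem.spawned?) (a := EItem.send q ℓ) rfl,
    List.count_cons, beq_iff_eq, Prod.mk.injEq] at hpid hpos hmsg htag hspawn hspawned hu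
  refine ⟨?_, ?_, ?_, ?_, ?_, ?_, ?_⟩ <;>
    simp only [wsum_cons, undoneSys_cons, pidW, msgW, sendW, tagW, spawnW, spawnOfW]
  · simpa using hpid
  · simpa using hpos
  · intro y q' ℓ'
    have := hmsg y q' ℓ'
    split_ifs at this ⊢ <;> first | omega | (exfalso; simp_all)
  · intro y q' ℓ' h
    have := htag y q' ℓ' h
    split_ifs at this ⊢ <;> first | omega | (exfalso; simp_all)
  · simpa using hspawn
  · simpa using hspawned
  · rw [← hu]
    have : ¬ Kept E τ (.msg z q ℓ v) := fun h => h ⟨q, hs⟩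
    simp only [RollbackRecovery.undone, restore_cons (a := EItem.send q ℓ) (by simp) hh s s', h1,
      List.filterMap_cons_none (f := EItem.recvMsg?) (a := EItem.send q ℓ) rfl]
    simp [Multiset.filter_singleton, this]

/-- The recorded spawn and the spawned process disappear together, which cancels in `spawn_le` and
`spawned_le`; `undone` never kept the process, and it is not `p`. -/
theorem RBalance.unspawn (hE : CompleteRecord p τ E) {z q : Pid} {e : List (EItem St V)}
    {s s' s'' : Option St} {M : Multiset (EComp St V)} (hh : EHolds τ e)
    (hs : ESince E τ z (.spawn q))
    (hM : RBalance p τ E (.proc (.spawn q :: e) z s ::ₘ .proc [] q s'' ::ₘ M)) :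
    RBalance p τ E (.proc e z s' ::ₘ M) := by
  have h1 : since τ (.spawn q :: e) = .spawn q :: since τ e := since_cons (by simp) hh
  have h2 : since τ ([] : List (EItem St V)) = [] := rfl
  have h3 : q ≠ p := (hE.spawns z q hs).1
  obtain ⟨hpid, hpos, hmsg, htag, hspawn, hspawned, hu⟩ := hM
  simp only [wsum_cons, undoneSys_cons, pidW, msgW, sendW, tagW, spawnW, spawnOfW, h1, h2,
    List.filterMap_nil, List.count_nil, ite_self,
    List.filterMap_cons_none (f := EItem.sendKey?) (a := EItem.spawn q) rfl,
    List.filterMap_cons_none (f := EItem.recvKey?) (a := EItem.spawn q) rfl,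
    List.filterMap_cons_none (f := EItem.recvTag?) (a := EItem.spawn q) rfl,
    List.filterMap_cons_some (f := EItem.spawned?) (a := EItem.spawn q) (b := q) rfl,
    List.count_cons, beq_iff_eq, zero_add, h3, if_false]
    at hpid hpos hmsg htag hspawn hspawned hu
  refine ⟨?_, ?_, ?_, ?_, ?_, ?_, ?_⟩ <;>
    simp only [wsum_cons, undoneSys_cons, pidW, msgW, sendW, tagW, spawnW, spawnOfW]
  · intro w
    have := hpid w
    split_ifs at this ⊢ <;> omega
  · exact hpos
  · exact hmsg
  · exact htag
  · intro w
    have := hspawn w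
    split_ifs at this ⊢ <;> omega
  · intro y w h
    have := hspawned y w h
    split_ifs at this ⊢ <;> omega
  · rw [← hu]
    have hq : Spawned E τ q := ⟨z, hs⟩
    simp [RollbackRecovery.undone, restore_cons (a := EItem.spawn q) (by simp) hh s s', hq, h1, h2,
      List.filterMap_cons_none (f := EItem.recvMsg?) (a := EItem.spawn q) rfl]

end

/-! ### Controlled steps: preservation of the invariants and the final system -/

section

variable {p : Pid} {τ : Chk} {E : Multiset (EComp St V)}

structure RInv (p : Pid) (τ : Chk) (E : Multiset (EComp St V)) (R : RSys St V) : Prop where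
  ok : ∀ h z s φ, RComp.proc h z s φ ∈ R → RProcOK p τ E (eraseRHist h) z s φ
  bal : RBalance p τ E (R.map RComp.erase)

theorem RInv.proc_unique {R : RSys St V} (hR : RInv p τ E R) {h h' z s s' φ φ'}
    (h1 : RComp.proc h z s φ ∈ R) (h2 : RComp.proc h' z s' φ' ∈ R) :
    h = h' ∧ s = s' ∧ φ = φ' := by
  have h3 := hR.bal.pid_le z
  rw [wsum_map] at h3
  have := eq_of_wsum_le_one h3 h1 h2 (by simp [RComp.erase, pidW]) (by simp [RComp.erase, pidW])
  simpa using this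

theorem RInv.exists_proc {R : RSys St V} {q : Pid} (h : 0 < wsum (pidW q) (R.map RComp.erase)) :
    ∃ h s φ, RComp.proc h q s φ ∈ R := by
  rw [wsum_map] at h
  obtain ⟨c, hc, h1⟩ := exists_of_wsum_pos h
  rcases c with ⟨h, z, s, φ⟩ | _
  · simp only [RComp.erase, pidW] at h1
    split_ifs at h1 with hz
    · subst hz
      exact ⟨_, _, _, hc⟩
    · omega
  · simp [RComp.erase, pidW] at h1

theorem RInv.pop {R : RSys St V} (hE : CompleteRecord p τ E) (hR : RInv p τ E R) {a h z s φ b}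
    (h1 : RComp.proc (a :: h) z s φ ∈ R) (hφ : φ.Nonempty) (ha : a.erase = some b)
    (hb : ∀ τ' s', b ≠ .check τ' s') :
    EHolds τ (eraseRHist h) ∧ .chk τ ∈ φ ∧ ESince E τ z b := by
  have h2 := hR.ok _ _ _ _ h1
  rw [eraseRHist, List.filterMap_cons_some ha] at h2
  exact h2.pop hE hφ hb

/-- A message to be deleted which is not on the network has been received. -/
theorem RInv.received {R : RSys St V} (hE : CompleteRecord p τ E) (hR : RInv p τ E R)
    {s' q ℓ h z s φ} (h1 : RComp.proc (.send s' q ℓ :: h) z s φ ∈ R) (hφ : φ.Nonempty)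
    (hm : ∀ v, RComp.msg z q ℓ v ∉ R) :
    ∃ h' s φ v, RComp.proc h' q s φ ∈ R ∧ EItem.recv z q ℓ v ∈ since τ (eraseRHist h') := by
  obtain ⟨hh, -, hs⟩ := hR.pop hE h1 hφ (b := .send q ℓ) rfl (by simp)
  have h2 : 1 ≤ wsum (sendW τ z q ℓ) (R.map RComp.erase) := by
    refine le_trans ?_ (le_wsum (Multiset.mem_map_of_mem _ h1))
    have : since τ (eraseRHist (.send s' q ℓ :: h)) = .send q ℓ :: since τ (eraseRHist h) :=
      since_cons (by simp) hh
    simp only [RComp.erase, sendW, if_true, this, Nat.one_le_iff_ne_zero, ← Nat.pos_iff_ne_zero,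
      List.count_pos_iff]
    exact List.mem_filterMap.2 ⟨_, List.mem_cons_self, rfl⟩
  have h3 := h2.trans (hR.bal.msg_le z q ℓ)
  rw [wsum_map] at h3
  obtain ⟨c, hc, h4⟩ := exists_of_wsum_pos h3
  rcases c with ⟨h', y, s₁, φ'⟩ | ⟨y', q', ℓ', v⟩
  · obtain ⟨a, ha, h5⟩ := List.mem_filterMap.1 (List.count_pos_iff.1 h4)
    cases a <;> simp [EItem.recvKey?] at h5
    obtain ⟨rfl, rfl, rfl⟩ := h5
    obtain ⟨e₀, s₀, h6, h7, -⟩ := (hR.ok _ _ _ _ hc).orig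
    obtain rfl := hE.recv_dst _ _ _ _ _ _ _ h6 (h7.subset ((since_subset _ _).subset ha))
    exact ⟨_, _, _, _, hc, ha⟩
  · simp only [RComp.erase, msgW] at h4
    split_ifs at h4 with h5
    · simp only [Prod.mk.injEq] at h5
      obtain ⟨rfl, rfl, rfl⟩ := h5
      exact absurd hc (hm v)
    · omega

theorem eholds_of_mem_since {a : EItem St V} {e : List (EItem St V)} (h : a ∈ since τ e) :
    EHolds τ e := by
  by_contra hh
  simp [since_of_not hh] at h

/-- By `RProcOK.pop`, sends, receipts and spawns are undone only if recorded since `τ`, as the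
balance lemmas demand. In `send2` the message is not on the network, so `RInv.received` finds its
receipt, and uniqueness of pids identifies the receiver with the process that gets the request. -/
theorem RInv.step (hE : CompleteRecord p τ E) {R R' : RSys St V} (hR : RInv p τ E R)
    (h : ControlledStep τ R R') : RInv p τ E R' := by
  have hbal := hR.bal
  cases h with
  | @seq s' h z s φ T hφ =>
    have h1 : RProcOK p τ E (eraseRHist h) z s φ := hR.ok (.seq s' :: h) z s φ (by simp)
    constructor
    · intro h₁ z₁ s₁ φ₁ hm
      rcases Multiset.mem_cons.1 hm with hm | hm
      · cases hm
        exact h1.undo_seq hφ _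
      · exact hR.ok _ _ _ _ (by simp [hm])
    · rw [Multiset.map_cons, ← Multiset.singleton_add] at hbal ⊢
      refine RBalance.congr (balanced_seq ?_) hbal
      by_contra! hc
      exact hφ.ne_empty (h1.idle hc.2 hc.1)
  | @check τ' s' h z s φ T hφ =>
    have h1 : RProcOK p τ E (.check τ' s' :: eraseRHist h) z s φ :=
      hR.ok (.check τ' s' :: h) z s φ (by simp)
    have h2 := h1.undo_check hE hφ
    constructor
    · intro h₁ z₁ s₁ φ₁ hm
      rcases Multiset.mem_cons.1 hm with hm | hm
      · cases hm
        exact h2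
      · exact hR.ok _ _ _ _ (by simp [hm])
    · rw [Multiset.map_cons, ← Multiset.singleton_add] at hbal ⊢
      refine RBalance.congr (balanced_check ?_ ?_) hbal
      · by_cases hτ : τ' = τ
        · subst hτ
          right
          obtain ⟨e₀, s₀, h3, h4, -⟩ := h1.orig
          have h5 := (hE.suffix h3 h4 ⟨s', by simp⟩).2.2 s
          rw [restore_check] at h5
          rw [since_check, since_of_not h5]
        · have hne : ∀ s, EItem.check (St := St) (V := V) τ' s' ≠ .check τ s := by
            intro s h
            cases h
            exact hτ rfl
          by_cases hh : EHolds τ (eraseRHist h)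
          · exact .inl (since_cons hne hh)
          · right
            rw [since_of_not hh, since_of_not]
            rw [eholds_cons]
            rintro (⟨s, h⟩ | h)
            · exact hne _ h
            · exact hh h
      · by_cases hz : Spawned E τ z
        · exact .inr hz
        · left
          obtain ⟨e₀, s₀, h3, -, h4, -⟩ := h1.orig
          obtain ⟨e₁, s₁, h5, -, h6, -⟩ := h2.orig
          obtain ⟨rfl, rfl⟩ := hE.unique h3 h5
          exact (h4 hz).trans (h6 hz).symm
  | @sp z s φ T hφ =>
    have h1 : RProcOK p τ E [] z s φ := hR.ok [] z s φ (by simp)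
    refine ⟨?_, by simpa [RComp.erase] using hbal⟩
    intro h₁ z₁ s₁ φ₁ hm
    rcases Multiset.mem_cons.1 hm with hm | hm
    · cases hm
      exact h1.drop_sp
    · exact hR.ok _ _ _ _ (by simp [hm])
  | @receive s' y ℓ v h z s φ T hφ =>
    have h1 : RProcOK p τ E (.recv y z ℓ v :: eraseRHist h) z s φ :=
      hR.ok (.recv s' y z ℓ v :: h) z s φ (by simp)
    constructor
    · intro h₁ z₁ s₁ φ₁ hm
      rcases Multiset.mem_cons.1 hm with hm | hm
      · cases hm
        refine h1.undo hE hφ (by simp) Set.sdiff_subset (fun h => ⟨h, by simp⟩) ?_ s'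
        intro y' q' ℓ' v' h
        cases h
        simp
      · simp only [Multiset.mem_cons, reduceCtorEq, false_or] at hm
        exact hR.ok _ _ _ _ (by simp [hm])
    · have hh := (h1.pop hE hφ (by simp)).1
      rw [Multiset.map_cons, ← Multiset.singleton_add] at hbal
      have := RBalance.congr (balanced_receive (s' := s') hh) hbal
      simpa [RComp.erase] using this
  | @spawn1 s'' q h z s φ s' T hφ =>
    have h1 : RProcOK p τ E (.spawn q :: eraseRHist h) z s φ :=
      hR.ok (.spawn s'' q :: h) z s φ (by simp)
    obtain ⟨hh, -, hs⟩ := h1.pop hE hφ (by simp)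
    constructor
    · intro h₁ z₁ s₁ φ₁ hm
      rcases Multiset.mem_cons.1 hm with hm | hm
      · cases hm
        exact h1.undo hE hφ (by simp) subset_rfl id (by simp) s''
      · exact hR.ok _ _ _ _ (by simp [hm])
    · simp only [Multiset.map_cons] at hbal ⊢
      exact RBalance.unspawn hE hh hs hbal
  | @spawn2 s'' q h z s φ h' s' φ' T hφ hne =>
    obtain ⟨-, -, hs⟩ := hR.pop hE (Multiset.mem_cons_self _ _) hφ (b := .spawn q) rfl (by simp)
    refine ⟨?_, by simpa [RComp.erase] using hbal⟩
    intro h₁ z₁ s₁ φ₁ hm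
    rcases Multiset.mem_cons.1 hm with hm | hm
    · exact hR.ok _ _ _ _ (by simp [hm])
    · rcases Multiset.mem_cons.1 hm with hm | hm
      · cases hm
        exact (hR.ok h' q s' φ' (by simp)).request .sp (.inr ⟨z, hs⟩) (by simp)
          (fun _ => ⟨z, hs⟩) (by simp)
      · exact hR.ok _ _ _ _ (by simp [hm])
  | @send1 s'' q ℓ v h z s φ T hφ =>
    have h1 : RProcOK p τ E (.send q ℓ :: eraseRHist h) z s φ :=
      hR.ok (.send s'' q ℓ :: h) z s φ (by simp)
    obtain ⟨hh, -, hs⟩ := h1.pop hE hφ (by simp)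
    constructor
    · intro h₁ z₁ s₁ φ₁ hm
      rcases Multiset.mem_cons.1 hm with hm | hm
      · cases hm
        exact h1.undo hE hφ (by simp) subset_rfl id (by simp) s''
      · exact hR.ok _ _ _ _ (by simp [hm])
    · simp only [Multiset.map_cons] at hbal ⊢
      exact RBalance.unsend hh hs hbal
  | @send2 s'' q ℓ h z s φ h' s' φ' T hφ hne =>
    obtain ⟨h₂, s₂, φ₂, v, h2, h3⟩ := hR.received hE (Multiset.mem_cons_self _ _) hφ
      (by simpa using hne)
    obtain ⟨rfl, rfl, rfl⟩ := hR.proc_unique h2 (h' := h') (s' := s') (φ' := φ') (by simp)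
    refine ⟨?_, by simpa [RComp.erase] using hbal⟩
    intro h₁ z₁ s₁ φ₁ hm
    rcases Multiset.mem_cons.1 hm with hm | hm
    · exact hR.ok _ _ _ _ (by simp [hm])
    · rcases Multiset.mem_cons.1 hm with hm | hm
      · cases hm
        refine (hR.ok _ _ _ _ h2).request (.tag ℓ) (.inl (eholds_of_mem_since h3)) ?_ (by simp)
          (by simp)
        intro ℓ' h4
        cases h4
        exact ⟨_, _, h3⟩
      · exact hR.ok _ _ _ _ (by simp [hm])

theorem RInv.steps (hE : CompleteRecord p τ E) {R R' : RSys St V} (hR : RInv p τ E R)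
    (h : Relation.ReflTransGen (ControlledStep τ) R R') : RInv p τ E R' := by
  induction h with
  | refl => exact hR
  | tail _ h ih => exact ih.step hE h

theorem RInv.start {h : List (RItem St V)} {s : Option St} {R : RSys St V}
    (hR : NoRequests R) (hE : CompleteRecord p τ ((RComp.proc h p s ∅ ::ₘ R).map RComp.erase))
    (hh : EHolds τ (eraseRHist h)) : RInv p τ ((RComp.proc h p s ∅ ::ₘ R).map RComp.erase)
      (.proc h p s {.chk τ} ::ₘ R) := by
  set E := (RComp.proc h p s ∅ ::ₘ R).map RComp.erase with hE'
  have hmem : EComp.proc (eraseRHist h) p s ∈ E := by simp [hE', RComp.erase]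
  have heq : (RComp.proc h p s {.chk τ} ::ₘ R).map RComp.erase = E := by simp [hE', RComp.erase]
  refine ⟨?_, by rw [heq]; exact RBalance.start hE ⟨_, _, hmem⟩⟩
  intro h₁ z s₁ φ hm
  rcases Multiset.mem_cons.1 hm with hm | hR₁
  · cases hm
    exact ⟨⟨_, _, hmem, List.suffix_rfl, fun _ => rfl, fun _ _ => rfl⟩, fun _ h => absurd hh h,
      fun _ h => absurd hh h, fun _ => .inl rfl, by simp, by simp, by simp⟩
  · obtain rfl := hR _ _ _ _ hR₁
    have hmem' : EComp.proc (eraseRHist h₁) z s₁ ∈ E :=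
      Multiset.mem_map.2 ⟨_, Multiset.mem_cons_of_mem hR₁, rfl⟩
    refine ⟨⟨_, _, hmem', List.suffix_rfl, fun _ => rfl, fun _ _ => rfl⟩, fun _ _ => rfl,
      fun hz hh' => absurd (hE.spawned_holds hmem' hz).2.1 hh', fun _ => .inr ⟨rfl, ?_⟩,
      by simp, by simp, by simp⟩
    rintro rfl
    have h1 := hE.pid_le z
    have h2 := le_wsum (f := pidW z) (Multiset.mem_map_of_mem RComp.erase hR₁)
    rw [hE', Multiset.map_cons, wsum_cons] at h1
    simp only [RComp.erase, pidW, if_true] at h1 h2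
    omega

/-- When all requested processes have been rolled back as far as `τ`, so have all processes. -/
theorem RInv.depends (hE : CompleteRecord p τ E) {R : RSys St V} (hR : RInv p τ E R)
    (hs : ∀ h z s φ, RComp.proc h z s φ ∈ R → φ.Nonempty → since τ (eraseRHist h) = [])
    {w : Pid} (hw : EDependsOn E τ p w) {h s φ} (h1 : RComp.proc h w s φ ∈ R) :
    since τ (eraseRHist h) = [] ∧ (EHolds τ (eraseRHist h) → φ.Nonempty) := by
  induction hw generalizing h s φ with
  | refl =>
    by_cases hφ : φ.Nonempty
    · exact ⟨hs _ _ _ _ h1 hφ, fun _ => hφ⟩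
    · have hh : ¬ EHolds τ (eraseRHist h) := by
        intro hh
        rcases (hR.ok _ _ _ _ h1).active hh with h2 | h2
        · exact hφ ⟨_, h2⟩
        · exact h2.2 rfl
      exact ⟨since_of_not hh, fun h => absurd h hh⟩
  | @spawn y q hy hsp ih =>
    -- The spawner has undone the spawn, so `spawned_le` denies the existence of the spawned
    -- process.
    exfalso
    have h2 := hR.bal.spawned_le y q hsp
    have h3 : wsum (spawnOfW τ y q) (R.map RComp.erase) = 0 := by
      rw [wsum_map, wsum_eq_zero_iff]
      rintro (⟨h, z, s, φ⟩ | _) hm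
      · simp only [RComp.erase, spawnOfW]
        split_ifs with hz
        · subst hz
          rw [(ih hm).1]
          rfl
        · rfl
      · rfl
    have h4 := le_wsum (f := pidW q) (Multiset.mem_map_of_mem RComp.erase h1)
    simp only [RComp.erase, pidW, if_true] at h4
    omega
  | @message y q ℓ v hy hsd hrc ih =>
    have h2 := hR.bal.tag_le y q ℓ hsd
    have h3 : wsum (sendW τ y q ℓ) (R.map RComp.erase) = 0 := by
      rw [wsum_map, wsum_eq_zero_iff]
      rintro (⟨h, z, s, φ⟩ | _) hm
      · simp only [RComp.erase, sendW]
        split_ifs with hz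
        · subst hz
          rw [(ih hm).1]
          rfl
        · rfl
      · rfl
    have h4 : EHolds τ (eraseRHist h) → φ.Nonempty := by
      intro hh
      rw [Set.nonempty_iff_ne_empty]
      intro hφ
      -- Without requests, a holder of `τ` would have its initial history, which contains the
      -- receipt. But the send has been undone, so `tag_le` leaves no copy of the message.
      obtain ⟨e₀, s₀, h5, -, -, h6⟩ := (hR.ok _ _ _ _ h1).orig
      rw [← h6 hh hφ] at h5
      have h7 := (since_subset _ _).subset ((hE.esince_iff h5 _).1 hrc)
      have h8 := le_wsum (f := tagW ℓ) (Multiset.mem_map_of_mem RComp.erase h1)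
      have h9 : 0 < tagW ℓ (RComp.erase (.proc h q s φ)) := by
        simp only [RComp.erase, tagW, List.count_pos_iff]
        exact List.mem_filterMap.2 ⟨_, h7, rfl⟩
      omega
    refine ⟨?_, h4⟩
    by_cases hh : EHolds τ (eraseRHist h)
    · exact hs _ _ _ _ h1 (h4 hh)
    · exact since_of_not hh

/-- In that case there are no spawned processes. -/
theorem RInv.not_spawned (hE : CompleteRecord p τ E) {R : RSys St V} (hR : RInv p τ E R)
    (hs : ∀ h z s φ, RComp.proc h z s φ ∈ R → φ.Nonempty → since τ (eraseRHist h) = [])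
    {h z s φ} (h1 : RComp.proc h z s φ ∈ R) : ¬ Spawned E τ z := by
  rintro ⟨y, hy⟩
  obtain ⟨e, s', h2, h3⟩ := hy.exists_holds
  have h4 := hR.bal.spawned_le y z hy
  have h5 : wsum (spawnOfW τ y z) (R.map RComp.erase) = 0 := by
    rw [wsum_map, wsum_eq_zero_iff]
    rintro (⟨h, z', s, φ⟩ | _) hm
    · simp only [RComp.erase, spawnOfW]
      split_ifs with hz
      · subst hz
        rw [(hR.depends hE hs (hE.depends _ _ _ h2 h3) hm).1]
        rfl
      · rfl
    · rfl
  have h6 := le_wsum (f := pidW z) (Multiset.mem_map_of_mem RComp.erase h1)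
  simp only [RComp.erase, pidW, if_true] at h6
  omega

/-- The counterpart of `Inv.final`. With no requests at all, the premise of `RInv.depends` and
`RInv.not_spawned` is vacuous, so no process holds `τ` and none is spawned; the sends since `τ` are
undone, and `tag_le` excludes their messages. -/
theorem RInv.final (hE : CompleteRecord p τ E) {h : List (RItem St V)} {s : Option St}
    {R : RSys St V} (hR : RInv p τ E (.proc h p s ∅ ::ₘ R)) (hn : NoRequests R) :
    R.map RComp.erase = undoneSys p τ E E := by
  have hs : ∀ h' z s' φ, RComp.proc h' z s' φ ∈ RComp.proc h p s ∅ ::ₘ R → φ.Nonempty →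
      since τ (eraseRHist h') = [] := by
    intro h' z s' φ h1 h2
    rcases Multiset.mem_cons.1 h1 with h1 | h1
    · cases h1
      simp at h2
    · exact absurd (hn _ _ _ _ h1) h2.ne_empty
  have hφ : ∀ {h' z s' φ}, RComp.proc h' z s' φ ∈ RComp.proc h p s ∅ ::ₘ R → ¬ φ.Nonempty := by
    intro h' z s' φ h1
    rcases Multiset.mem_cons.1 h1 with h1 | h1
    · cases h1
      simp
    · simp [hn _ _ _ _ h1]
  have hproc : ∀ {e' z s'}, EComp.proc e' z s' ∈
      EComp.proc (eraseRHist h) p s ::ₘ R.map RComp.erase → ∃ h' φ,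
        RComp.proc h' z s' φ ∈ RComp.proc h p s ∅ ::ₘ R ∧ eraseRHist h' = e' := by
    intro e' z s' h1
    have h2 : EComp.proc e' z s' ∈ (RComp.proc h p s ∅ ::ₘ R).map RComp.erase := by
      rwa [Multiset.map_cons]
    obtain ⟨c, hc, h2⟩ := Multiset.mem_map.1 h2
    rcases c with ⟨h', z, s, φ⟩ | _
    · simp only [RComp.erase, EComp.proc.injEq] at h2
      obtain ⟨rfl, rfl, rfl⟩ := h2
      exact ⟨_, _, hc, rfl⟩
    · simp [RComp.erase] at h2
  have hbal := hR.bal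
  rw [Multiset.map_cons] at hbal
  change RBalance p τ E (EComp.proc (eraseRHist h) p s ::ₘ R.map RComp.erase) at hbal
  rw [← hbal.undone, undoneSys_eq_of_done hbal.pid_le]
  · intro e' z s' h1 hh
    obtain ⟨h', φ, h2, rfl⟩ := hproc h1
    obtain ⟨e₀, s₀, h3, h4, -⟩ := (hR.ok _ _ _ _ h2).orig
    exact hφ h2 ((hR.depends hE hs (hE.depends _ _ _ h3 (hh.mono h4.subset)) h2).2 hh)
  · intro e' z s' h1
    obtain ⟨h', φ, h2, rfl⟩ := hproc h1
    exact hR.not_spawned hE hs h2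
  · rintro y q ℓ v h1 ⟨q', hq⟩
    obtain ⟨e, s', h2, h3⟩ := hq.exists_holds
    have h4 := hbal.tag_le _ _ _ hq
    have h5 : wsum (sendW τ y q' ℓ) (EComp.proc (eraseRHist h) p s ::ₘ R.map RComp.erase) = 0 := by
      rw [wsum_eq_zero_iff]
      rintro (⟨e', z, s'⟩ | _) hm
      · simp only [sendW]
        split_ifs with hz
        · subst hz
          obtain ⟨h', φ, h6, rfl⟩ := hproc hm
          rw [(hR.depends hE hs (hE.depends _ _ _ h2 h3) h6).1]
          rfl
        · rfl
      · rfl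
    have h6 := le_wsum (f := tagW ℓ) h1
    simp only [tagW, if_true] at h6
    omega

theorem EHolds.cons_of_erase {a : RItem St V} {h : List (RItem St V)}
    (hh : EHolds τ (eraseRHist h)) : EHolds τ (eraseRHist (a :: h)) := by
  refine hh.mono ?_
  cases a <;> simp [List.filterMap_cons, RItem.erase]

/-- A process that does not hold `τ` cannot satisfy the request to roll back to it. -/
theorem unfinished_of_not_holds {R R' : RSys St V}
    (h : Relation.ReflTransGen (ControlledStep τ) R R')
    (hR : ∀ h s φ, RComp.proc h p s φ ∈ R → .chk τ ∈ φ ∧ ¬ EHolds τ (eraseRHist h)) :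
    ∀ h s φ, RComp.proc h p s φ ∈ R' → .chk τ ∈ φ ∧ ¬ EHolds τ (eraseRHist h) := by
  induction h with
  | refl => exact hR
  | tail _ h ih =>
    cases h with
    | @seq s' h z s φ T hφ =>
      intro h₁ s₁ φ₁ hm
      rcases Multiset.mem_cons.1 hm with hm | hm
      · cases hm
        exact ih (.seq s' :: h) s φ (by simp)
      · exact ih _ s₁ _ (by simp [hm])
    | @check τ' s' h z s φ T hφ =>
      intro h₁ s₁ φ₁ hm
      rcases Multiset.mem_cons.1 hm with hm | hm
      · cases hm
        obtain ⟨h1, h2⟩ := ih (.check τ' s' :: h) s φ (by simp)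
        refine ⟨⟨h1, ?_⟩, fun h => h2 h.cons_of_erase⟩
        simp only [Set.mem_singleton_iff, Request.chk.injEq]
        rintro rfl
        exact h2 ⟨s', List.mem_cons_self⟩
      · exact ih _ s₁ _ (by simp [hm])
    | @sp z s φ T hφ =>
      intro h₁ s₁ φ₁ hm
      rcases Multiset.mem_cons.1 hm with hm | hm
      · cases hm
        obtain ⟨h1, h2⟩ := ih [] s φ (by simp)
        exact ⟨⟨h1, by simp⟩, h2⟩
      · exact ih _ s₁ _ (by simp [hm])
    | @receive s' y ℓ v h z s φ T hφ =>
      intro h₁ s₁ φ₁ hm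
      simp only [Multiset.mem_cons, reduceCtorEq, false_or] at hm
      rcases hm with hm | hm
      · cases hm
        obtain ⟨h1, h2⟩ := ih (.recv s' y p ℓ v :: h) s φ (by simp)
        exact ⟨⟨h1, by simp⟩, fun h => h2 h.cons_of_erase⟩
      · exact ih _ s₁ _ (by simp [hm])
    | @spawn1 s'' q h z s φ s' T hφ =>
      intro h₁ s₁ φ₁ hm
      rcases Multiset.mem_cons.1 hm with hm | hm
      · cases hm
        obtain ⟨h1, h2⟩ := ih (.spawn s'' q :: h) s φ (by simp)
        exact ⟨h1, fun h => h2 h.cons_of_erase⟩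
      · exact ih _ s₁ _ (by simp [hm])
    | @spawn2 s'' q h z s φ h' s' φ' T hφ hne =>
      intro h₁ s₁ φ₁ hm
      simp only [Multiset.mem_cons] at hm
      rcases hm with hm | hm | hm
      · exact ih h₁ s₁ φ₁ (by simp [hm])
      · cases hm
        obtain ⟨h1, h2⟩ := ih h' s' φ' (by simp)
        exact ⟨.inl h1, h2⟩
      · exact ih _ s₁ _ (by simp [hm])
    | @send1 s'' q ℓ v h z s φ T hφ =>
      intro h₁ s₁ φ₁ hm
      rcases Multiset.mem_cons.1 hm with hm | hm
      · cases hm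
        obtain ⟨h1, h2⟩ := ih (.send s'' q ℓ :: h) s φ (by simp)
        exact ⟨h1, fun h => h2 h.cons_of_erase⟩
      · exact ih _ s₁ _ (by simp [hm])
    | @send2 s'' q ℓ h z s φ h' s' φ' T hφ hne =>
      intro h₁ s₁ φ₁ hm
      simp only [Multiset.mem_cons] at hm
      rcases hm with hm | hm | hm
      · exact ih h₁ s₁ φ₁ (by simp [hm])
      · cases hm
        obtain ⟨h1, h2⟩ := ih h' s' φ' (by simp)
        exact ⟨.inl h1, h2⟩
      · exact ih _ s₁ _ (by simp [hm])

end

section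

variable {p : Pid} {τ : Chk} {E : Multiset (EComp St V)}

/-! ### Existence of controlled backward derivations -/

/-- Process `z` had the history `e` at some time. -/
def Past (E : Multiset (EComp St V)) (z : Pid) (e : List (EItem St V)) : Prop :=
  ∃ e₀ s₀, EComp.proc e₀ z s₀ ∈ E ∧ e <:+ e₀

theorem RProcOK.past {e : List (EItem St V)} {z : Pid} {s : Option St} {φ : Set Request}
    (h : RProcOK p τ E e z s φ) : Past E z e := by
  obtain ⟨e₀, s₀, h1, h2, -⟩ := h.orig
  exact ⟨e₀, s₀, h1, h2⟩

/-- Times of the newest elements of past histories that respect "happened before". -/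
structure Clock (E : Multiset (EComp St V)) (t : Pid → ℕ → ℕ) : Prop where
  recv : ∀ {z q ℓ v e f}, Past E z (.send q ℓ :: e) → Past E q f → EItem.recv z q ℓ v ∈ f →
    t z e.length < t q (f.length - 1)
  spawn : ∀ {z q e f}, Past E z (.spawn q :: e) → Past E q f → f ≠ [] →
    t z e.length < t q (f.length - 1)

/-- Times increase along each history, so a receipt contained in `f` is no later than the newest
element of `f`. For a spawn, every action of the spawned process is later already. -/
theorem CompleteRecord.exists_clock (hE : CompleteRecord p τ E) : ∃ t, Clock E t := by
  obtain ⟨t, h1, h2, h3⟩ := hE.causal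
  refine ⟨t, ?_, ?_⟩
  · rintro z q ℓ v e f ⟨e₀, s₀, he, u, rfl⟩ ⟨f₀, s₁, hf, u', rfl⟩ hr
    obtain ⟨w, w', rfl⟩ := List.append_of_mem hr
    have h4 := h2 _ _ _ _ _ _ u e (u' ++ w) w' ℓ v he hf rfl (by simp)
    rcases Nat.eq_zero_or_pos w.length with h5 | h5
    · rw [List.length_eq_zero_iff] at h5
      subst h5
      simpa using h4
    · refine h4.trans (h1 _ _ _ hf _ _ ?_ ?_) <;> simp <;> omega
  · rintro z q e f ⟨e₀, s₀, he, u, rfl⟩ ⟨f₀, s₁, hf, u', rfl⟩ hne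
    have := List.length_pos_iff.2 hne
    exact h3 _ _ _ _ _ _ u e _ he hf rfl (by simp; omega)

/-- In a guided derivation, a process spawned since `τ` undoes the checkpoint `τ` only if it is to
be deleted. -/
def Guide (E : Multiset (EComp St V)) (τ : Chk) (h : List (RItem St V)) (z : Pid)
    (φ : Set Request) : Prop :=
  Spawned E τ z → ¬ EHolds τ (eraseRHist h) → .chk τ ∉ φ ∧ (h ≠ [] → .sp ∈ φ)

def Guided (E : Multiset (EComp St V)) (τ : Chk) (R : RSys St V) : Prop :=
  ∀ h z s φ, RComp.proc h z s φ ∈ R → Guide E τ h z φ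

theorem Guided.cons {h : List (RItem St V)} {z : Pid} {s : Option St} {φ : Set Request}
    {T : RSys St V} (h1 : Guide E τ h z φ) (hT : Guided E τ T) :
    Guided E τ (.proc h z s φ ::ₘ T) := by
  intro h₁ z₁ s₁ φ₁ hm
  rcases Multiset.mem_cons.1 hm with hm | hm
  · cases hm
    exact h1
  · exact hT _ _ _ _ hm

theorem Guided.cons_msg {y q : Pid} {ℓ : Tag} {v : V} {T : RSys St V} (hT : Guided E τ T) :
    Guided E τ (.msg y q ℓ v ::ₘ T) := by
  intro h₁ z₁ s₁ φ₁ hm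
  exact hT _ _ _ _ (by simpa using hm)

theorem Guided.of_cons {c : RComp St V} {T : RSys St V} (hT : Guided E τ (c ::ₘ T)) :
    Guided E τ T := fun _ _ _ _ hm => hT _ _ _ _ (Multiset.mem_cons_of_mem hm)

theorem guide_of_holds {h : List (RItem St V)} {z : Pid} {φ : Set Request}
    (hh : EHolds τ (eraseRHist h)) : Guide E τ h z φ := fun _ h => absurd hh h

def lenW : RComp St V → ℕ
  | .proc h _ _ _ => h.length
  | .msg _ _ _ _ => 0

open Classical in
/-- The number of requests that a process can receive or, if it has come to its beginning, drop. -/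
noncomputable def missingW : RComp St V → ℕ
  | .proc h _ _ φ => ((eraseRHist h).filterMap EItem.recvTag?).countP (fun ℓ => .tag ℓ ∉ φ) +
      if h = [] ↔ .sp ∈ φ then 1 else 0
  | .msg _ _ _ _ => 0

/-- A guided step, which decreases the lengths of histories or, if it does not change them, the
number of missing requests. -/
def Advances (E : Multiset (EComp St V)) (τ : Chk) (R R' : RSys St V) : Prop :=
  ControlledStep τ R R' ∧ Guided E τ R' ∧ (wsum lenW R' < wsum lenW R ∨
    (wsum lenW R' = wsum lenW R ∧ wsum missingW R' < wsum missingW R))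

/-- The process waits for another process, whose newest action is later. -/
def Waits (t : Pid → ℕ → ℕ) (τ : Chk) (R : RSys St V) (h : List (RItem St V)) (z : Pid) : Prop :=
  eraseRHist h ≠ [] ∧ ∃ h' q s' φ', RComp.proc h' q s' φ' ∈ R ∧ φ'.Nonempty ∧
    (since τ (eraseRHist h') ≠ [] ∨ .sp ∈ φ') ∧
    (eraseRHist h' ≠ [] → t z ((eraseRHist h).length - 1) < t q ((eraseRHist h').length - 1))

theorem countP_tag_le (l : List Tag) (φ ψ : Set Request)
    [DecidablePred fun ℓ => Request.tag ℓ ∉ φ ∪ ψ] [DecidablePred fun ℓ => Request.tag ℓ ∉ φ] :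
    l.countP (fun ℓ => .tag ℓ ∉ φ ∪ ψ) ≤ l.countP (fun ℓ => .tag ℓ ∉ φ) := by
  refine List.countP_mono_left fun ℓ _ h => ?_
  simp only [Set.mem_union, not_or, decide_eq_true_eq] at h ⊢
  exact h.1

theorem missingW_request_sp {h : List (RItem St V)} {z : Pid} {s : Option St} {φ : Set Request}
    (hh : h ≠ []) (hφ : .sp ∉ φ) :
    missingW (.proc h z s (φ ∪ {.chk τ, .sp})) < missingW (.proc h z s φ) := by
  classical
  have := countP_tag_le ((eraseRHist h).filterMap EItem.recvTag?) φ {.chk τ, .sp}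
  simp only [missingW, hh, hφ]
  simp at this ⊢

theorem missingW_request_tag {h : List (RItem St V)} {y z z' : Pid} {s : Option St}
    {φ : Set Request} {ℓ : Tag} {v : V} (hℓ : EItem.recv y z ℓ v ∈ eraseRHist h)
    (hφ : .tag ℓ ∉ φ) :
    missingW (.proc h z' s (φ ∪ {.chk τ, .tag ℓ})) < missingW (.proc h z' s φ) := by
  classical
  have : ((eraseRHist h).filterMap EItem.recvTag?).countP (fun ℓ' => .tag ℓ' ∉ φ ∪ {.chk τ, .tag ℓ})
      < ((eraseRHist h).filterMap EItem.recvTag?).countP (fun ℓ => .tag ℓ ∉ φ) := by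
    have h1 : ℓ ∈ (eraseRHist h).filterMap EItem.recvTag? := List.mem_filterMap.2 ⟨_, hℓ, rfl⟩
    obtain ⟨u, w, h2⟩ := List.append_of_mem h1
    rw [h2, List.countP_append, List.countP_append, List.countP_cons_of_neg (by simp),
      List.countP_cons_of_pos (by simpa using hφ)]
    have := countP_tag_le u φ {.chk τ, .tag ℓ}
    have := countP_tag_le w φ {.chk τ, .tag ℓ}
    omega
  have h1 : (h = [] ↔ Request.sp ∈ φ ∪ {.chk τ, .tag ℓ}) ↔ (h = [] ↔ .sp ∈ φ) := by simp
  simp only [missingW, h1]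
  refine Nat.add_lt_add_right ?_ _
  convert this

/-- Inspection of the newest element. It can be undone at once, or an unmade request can be made,
except in two situations: the receiver or the spawned process concerned has already been asked, and
its newest action, if any, is later; or a spawned process stands at `τ` and has not been asked to
disappear. Guidedness is needed in the second situation: if the process undid `τ` with some history
left below, `spawn2` would later ask it to roll back to `τ`, and this request could never be
removed. -/
theorem RInv.exists_step (hE : CompleteRecord p τ E) {t : Pid → ℕ → ℕ} (ht : Clock E t)
    {R : RSys St V} (hR : RInv p τ E R) (hG : Guided E τ R) {h z s φ}
    (h1 : RComp.proc h z s φ ∈ R) (hφ : φ.Nonempty) :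
    (∃ R', Advances E τ R R') ∨ (since τ (eraseRHist h) = [] ∧ Spawned E τ z ∧ .sp ∉ φ) ∨
      Waits t τ R h z := by
  have hok := hR.ok _ _ _ _ h1
  have hg := hG _ _ _ _ h1
  obtain ⟨T, rfl⟩ := Multiset.exists_cons_of_mem h1
  cases h with
  | nil =>
    have hh : ¬ EHolds τ (eraseRHist ([] : List (RItem St V))) := by simp [EHolds]
    have hz : Spawned E τ z := by
      by_contra hz
      exact hφ.ne_empty (hok.idle hz hh)
    have hsp : .sp ∈ φ := by
      obtain ⟨r, hr⟩ := hφ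
      cases r with
      | chk τ' =>
        obtain rfl := hok.chks _ hr
        exact absurd hr (hg hz hh).1
      | tag ℓ =>
        obtain ⟨_, _, h2⟩ := hok.tags _ hr
        simp [since, back] at h2
      | sp => exact hr
    refine .inl ⟨_, .sp hsp, hG.of_cons.cons ?_, .inr ⟨by simp [lenW], ?_⟩⟩
    · exact fun hz hh => ⟨fun h => (hg hz hh).1 h.1, by simp⟩
    · simp [missingW, hsp]
  | cons a h =>
  cases a with
  | seq s' =>
    refine .inl ⟨_, .seq hφ, hG.of_cons.cons ?_, .inl (by simp [lenW])⟩
    exact fun hz hh => ⟨(hg hz hh).1, fun _ => (hg hz hh).2 (by simp)⟩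
  | check τ' s' =>
    have hok' : RProcOK p τ E (.check τ' s' :: eraseRHist h) z s φ := hok
    by_cases hτ : τ' = τ
    · subst hτ
      by_cases hsp : Spawned E τ' z ∧ .sp ∉ φ
      · exact .inr (.inl ⟨since_check _ _ _, hsp⟩)
      · refine .inl ⟨_, .check hφ, hG.of_cons.cons ?_, .inl (by simp [lenW])⟩
        intro hz _
        refine ⟨by simp, fun _ => ⟨?_, by simp⟩⟩
        by_contra h
        exact hsp ⟨hz, h⟩
    · refine .inl ⟨_, .check hφ, hG.of_cons.cons ?_, .inl (by simp [lenW])⟩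
      intro hz hh
      have h2 : ¬ EHolds τ (eraseRHist (.check τ' s' :: h)) := by
        change ¬ EHolds τ (.check τ' s' :: eraseRHist h)
        rw [eholds_cons]
        rintro (⟨s, h⟩ | h)
        · cases h
          exact hτ rfl
        · exact hh h
      exact ⟨fun h => (hg hz h2).1 h.1, fun _ => ⟨(hg hz h2).2 (by simp), by simp⟩⟩
  | recv s' y q ℓ v =>
    have hok' : RProcOK p τ E (.recv y q ℓ v :: eraseRHist h) z s φ := hok
    obtain ⟨hh, -⟩ := hok'.pop hE hφ (by simp)
    obtain ⟨e₀, s₀, h2, h3, -⟩ := hok'.orig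
    obtain rfl := hE.recv_dst _ _ _ _ _ _ _ h2 (h3.subset List.mem_cons_self)
    exact .inl ⟨_, .receive hφ, Guided.cons (guide_of_holds hh) hG.of_cons.cons_msg,
      .inl (by simp [lenW])⟩
  | send s' q ℓ =>
    have hok' : RProcOK p τ E (.send q ℓ :: eraseRHist h) z s φ := hok
    obtain ⟨hh, -⟩ := hok'.pop hE hφ (by simp)
    by_cases hm : ∃ v, RComp.msg z q ℓ v ∈ T
    · obtain ⟨v, hm⟩ := hm
      obtain ⟨T, rfl⟩ := Multiset.exists_cons_of_mem hm
      exact .inl ⟨_, .send1 hφ, hG.of_cons.of_cons.cons (guide_of_holds hh), .inl (by simp [lenW])⟩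
    · push Not at hm
      obtain ⟨h', s₁, φ₁, v, h2, h3⟩ := hR.received hE h1 hφ (by simpa using hm)
      have h4 := (hR.ok _ _ _ _ h2).past
      have h5 := (since_subset _ _).subset h3
      have h6 := ht.recv hok'.past h4 h5
      -- Only a request that was not made before decreases `missingW`.
      by_cases hℓ : .tag ℓ ∈ φ₁
      · exact .inr (.inr ⟨List.cons_ne_nil _ _, h', q, s₁, φ₁, h2, ⟨_, hℓ⟩,
          .inl (List.ne_nil_of_mem h3), fun _ => h6⟩)
      · left
        rcases Multiset.mem_cons.1 h2 with h7 | h7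
        · cases h7
          exact absurd h6 (lt_irrefl _)
        · obtain ⟨T, rfl⟩ := Multiset.exists_cons_of_mem h7
          refine ⟨_, .send2 hφ (by simpa using hm),
            (hG.of_cons.of_cons.cons (guide_of_holds (eholds_of_mem_since h3))).cons hg,
            .inr ⟨by simp [lenW], ?_⟩⟩
          simp only [wsum_cons]
          have := missingW_request_tag (τ := τ) (z' := q) (s := s₁) h5 hℓ
          omega
  | spawn s' q =>
    have hok' : RProcOK p τ E (.spawn q :: eraseRHist h) z s φ := hok
    obtain ⟨hh, -, hs⟩ := hok'.pop hE hφ (by simp)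
    have hq : Spawned E τ q := ⟨z, hs⟩
    obtain ⟨h', s₁, φ₁, h2⟩ : ∃ h' s₁ φ₁,
        RComp.proc h' q s₁ φ₁ ∈ RComp.proc (.spawn s' q :: h) z s φ ::ₘ T := by
      refine RInv.exists_proc (lt_of_lt_of_le ?_ (hR.bal.spawn_le q))
      refine lt_of_lt_of_le ?_ (le_wsum (Multiset.mem_map_of_mem RComp.erase h1))
      have : since τ (eraseRHist (.spawn s' q :: h)) = .spawn q :: since τ (eraseRHist h) :=
        since_cons (by simp) hh
      simp only [RComp.erase, spawnW, this, List.count_pos_iff]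
      exact List.mem_filterMap.2 ⟨_, List.mem_cons_self, rfl⟩
    have h4 := (hR.ok _ _ _ _ h2).past
    have h6 := ht.spawn hok'.past h4
    rcases Multiset.mem_cons.1 h2 with h7 | h7
    · cases h7
      exact absurd (h6 (List.cons_ne_nil _ _)) (lt_irrefl _)
    obtain ⟨T, rfl⟩ := Multiset.exists_cons_of_mem h7
    by_cases hsp : .sp ∈ φ₁
    · exact .inr (.inr ⟨List.cons_ne_nil _ _, h', q, s₁, φ₁, h2, ⟨_, hsp⟩, .inr hsp, h6⟩)
    left
    -- A spawned process without `sp` has, at its beginning, no request at all, as `spawn1` demands;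
    -- with history left, guidedness makes it still hold `τ`, so that the new requests keep it
    -- guided.
    cases h' with
    | nil =>
      have hh' : ¬ EHolds τ (eraseRHist ([] : List (RItem St V))) := by simp [EHolds]
      have hφ₁ : φ₁ = ∅ := by
        rw [Set.eq_empty_iff_forall_notMem]
        rintro (τ' | ℓ | _) hr
        · obtain rfl := (hR.ok _ _ _ _ h2).chks _ hr
          exact (hG _ _ _ _ h2 hq hh').1 hr
        · obtain ⟨_, _, h8⟩ := (hR.ok _ _ _ _ h2).tags _ hr
          simp [since, back] at h8
        · exact hsp hr
      subst hφ₁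
      exact ⟨_, .spawn1 hφ, hG.of_cons.of_cons.cons (guide_of_holds hh), .inl (by simp [lenW])⟩
    | cons b h' =>
      have hb : EHolds τ (eraseRHist (b :: h')) := by
        by_contra hb
        exact hsp ((hG _ _ _ _ h2 hq hb).2 (by simp))
      refine ⟨_, .spawn2 hφ (by simp), (hG.of_cons.of_cons.cons (guide_of_holds hb)).cons hg,
        .inr ⟨by simp [lenW], ?_⟩⟩
      simp only [wsum_cons]
      have := missingW_request_sp (τ := τ) (h := b :: h') (z := q) (s := s₁) (by simp) hsp
      omega

/-- When no guided step is possible, there are no requests. -/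
theorem RInv.noRequests (hE : CompleteRecord p τ E) {R : RSys St V} (hR : RInv p τ E R)
    (hG : Guided E τ R) (hn : ∀ R', ¬ Advances E τ R R') : NoRequests R := by
  obtain ⟨t, ht⟩ := hE.exists_clock
  let f : RComp St V → ℕ
    | .proc h z _ _ => t z ((eraseRHist h).length - 1)
    | .msg _ _ _ _ => 0
  -- A chain of waiting processes goes strictly forward in time, and all times involved are bounded
  -- by `wsum f R`; so nobody waits.
  have hw : ∀ k h z s φ, RComp.proc h z s φ ∈ R →
      wsum f R - t z ((eraseRHist h).length - 1) = k → ¬ Waits t τ R h z := by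
    intro k
    induction k using Nat.strong_induction_on with
    | _ k ih =>
    rintro h z s φ h1 rfl ⟨h2, h', q, s', φ', h3, h4, h5, h6⟩
    rcases (hR.exists_step hE ht hG h3 h4).resolve_left fun ⟨R', h⟩ => hn R' h with h7 | h7
    · rcases h5 with h5 | h5
      · exact h5 h7.1
      · exact h7.2.2 h5
    · have h8 := h6 h7.1
      have h9 : t q ((eraseRHist h').length - 1) ≤ wsum f R := le_wsum (f := f) h3
      exact ih _ (by omega) _ _ _ _ h3 rfl h7
  have hb : ∀ h z s φ, RComp.proc h z s φ ∈ R → φ.Nonempty →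
      since τ (eraseRHist h) = [] ∧ Spawned E τ z := by
    intro h z s φ h1 h2
    rcases hR.exists_step hE ht hG h1 h2 with ⟨R', h3⟩ | h3 | h3
    · exact absurd h3 (hn R')
    · exact ⟨h3.1, h3.2.1⟩
    · exact absurd h3 (hw _ _ _ _ _ h1 rfl)
  -- Any requested process would thus be spawned, with nothing newer than `τ` left; but when this
  -- holds for all requested processes, no spawned process exists.
  intro h z s φ h1
  by_contra h2
  exact hR.not_spawned hE (fun h z s φ h1 h2 => (hb h z s φ h1 h2).1) h1
    (hb _ _ _ _ h1 (Set.nonempty_iff_ne_empty.2 h2)).2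

/-- All requests can be satisfied. -/
theorem RInv.exists_derivation (hE : CompleteRecord p τ E) {R : RSys St V} (hR : RInv p τ E R)
    (hG : Guided E τ R) :
    ∃ R', Relation.ReflTransGen (ControlledStep τ) R R' ∧ RInv p τ E R' ∧ NoRequests R' := by
  -- Lexicographic descent: total length of histories, then missing requests.
  induction hn : wsum lenW R using Nat.strong_induction_on generalizing R with
  | _ n ih =>
  induction hm : wsum missingW R using Nat.strong_induction_on generalizing R with
  | _ m ih' =>
  subst hn hm
  by_cases h : ∃ R', Advances E τ R R'
  · obtain ⟨R', h1, h2, h3⟩ := h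
    have h4 := hR.step hE h1
    obtain ⟨R'', h5, h6⟩ : ∃ R'', Relation.ReflTransGen (ControlledStep τ) R' R'' ∧
        RInv p τ E R'' ∧ NoRequests R'' := by
      rcases h3 with h3 | ⟨h3, h5⟩
      · exact ih _ h3 h4 h2 rfl
      · exact ih' _ h5 h4 h2 h3 rfl
    exact ⟨R'', .head h1 h5, h6⟩
  · push Not at h
    exact ⟨R, .refl, hR, hR.noRequests hE hG h⟩

end

section

variable {p : Pid} {τ : Chk} {E : Multiset (EComp St V)}

/-! ### Comparison of the two kinds of derivations -/

theorem allMsgs_of_chk {Δ : List (Item St V)} {x : Extract St V} (h : chk τ Δ = some x) :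
    AllMsgs x.msgs := by
  obtain ⟨n, -, -, -, -, h1⟩ := back_eraseHist_of_chk h
  exact h1

theorem Start.cons_note {S : Sys St V} (hS : Start p τ E S) {y pτ : Pid}
    (h : pτ = p ∨ ∀ e s, EComp.proc e pτ s ∉ E) :
    Start p τ E (.note y p (.roll pτ τ) ::ₘ S) := by
  refine ⟨?_, fun Δ q s m h => ?_, fun q q' n hm => ?_, hS.mem⟩
  · rw [filterMap_erase_cons_note, hS.erase_eq]
  · exact hS.normal Δ q s m (by simpa using h)
  · rcases Multiset.mem_cons.1 hm with hm | hm
    · cases hm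
      exact .inr ⟨rfl, _, rfl, h⟩
    · exact hS.notes _ _ _ hm

theorem NoOngoingRollback.start {Δ : List (Item St V)} {s : Option St} {S : Sys St V}
    (hS : NoOngoingRollback S) :
    Start p τ ((Comp.proc Δ p s .normal ::ₘ S).filterMap Comp.erase)
      (.proc Δ p s .normal ::ₘ S) := by
  refine ⟨rfl, fun Δ' q s' m h => ?_, fun q q' n h => ?_, ?_⟩
  · rcases Multiset.mem_cons.1 h with h | h
    · cases h
      rfl
    · exact hS.1 _ _ _ _ h
  · exact .inl (hS.2 q q' n (by simpa using h))
  · exact ⟨eraseHist Δ, s, by simp⟩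

theorem not_mem_of_pids {S : Sys St V} {Δ : List (Item St V)} {s : Option St} {z : Pid}
    (hz : z ∉ pids S) : z = p ∨ ∀ e s',
      EComp.proc e z s' ∉ (Comp.proc Δ p s .normal ::ₘ S).filterMap Comp.erase := by
  by_cases h : z = p
  · exact .inl h
  · refine .inr fun e s' hm => ?_
    obtain ⟨Δ', m, h1, -⟩ := proc_mem_erase.1 hm
    rcases Multiset.mem_cons.1 h1 with h1 | h1
    · cases h1
      exact h rfl
    · exact hz ((Multiset.mem_filterMap _ _).2 ⟨_, h1, rfl⟩)

theorem RollbackRequested.start {rollbackStep : St → Chk → St → Prop} {Δ : List (Item St V)}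
    {s : St} {S : Sys St V} (h : RollbackRequested rollbackStep p τ s S) :
    Start p τ ((Comp.proc Δ p (some s) .normal ::ₘ S).filterMap Comp.erase)
      (.proc Δ p (some s) .normal ::ₘ S) := by
  cases h with
  | user _ h => exact h.start
  | @propagated T pr pτ h hp =>
    rw [Multiset.cons_swap, filterMap_erase_cons_note]
    exact h.start.cons_note (not_mem_of_pids hp)

/-- Rule Rollback acts as Roll1 would after adding a request of `p` to itself, so both ways of
starting reduce to a `Start` system and Roll1. -/
theorem RollbackRequested.exists_initStep {rollbackStep : St → Chk → St → Prop}
    {Δ : List (Item St V)} {s : St} {S : Sys St V} (h : RollbackRequested rollbackStep p τ s S)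
    {x : Extract St V} (hx : chk τ Δ = some x) :
    ∃ pτ pr T, Start p τ ((Comp.proc Δ p (some s) .normal ::ₘ S).filterMap Comp.erase)
        (rollLhs pr p pτ τ Δ (some s) + T) ∧
      InitStep rollbackStep (.proc Δ p (some s) .normal ::ₘ S) (rollRhs pr p pτ τ x + T) := by
  have hstart := h.start (Δ := Δ)
  cases h with
  | user hs _ =>
    refine ⟨p, p, S, ?_, _, _, S, .inl (.rollback hs hx), by simp, rfl⟩
    have := hstart.cons_note (y := p) (pτ := p) (.inl rfl)
    simpa [rollLhs] using this
  | @propagated T pr pτ _ _ =>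
    refine ⟨pτ, pr, T, ?_, _, _, T, .inr (.roll1 (s := some s) hx), ?_, rfl⟩
    · rw [Multiset.cons_swap] at hstart ⊢
      simpa [rollLhs] using hstart
    · rw [Multiset.cons_swap]
      simp

/-- A first step which makes `p` roll back to `τ` is a propagation step, possibly after the addition
of a request of `p` to itself. -/
theorem Start.exists_propStep {rollbackStep : St → Chk → St → Prop} {S S' : Sys St V}
    (hS : Start p τ E S) (h : InitStep rollbackStep S S') {Δ' sτ pτ pr L P}
    (hp : Comp.proc Δ' p sτ (.rolling τ pτ pr L P) ∈ S') :
    ∃ S'', Start p τ E S'' ∧ PropStep S'' S' ∧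
      ∃ Δ s, Comp.proc Δ p s .normal ∈ S ∧ EHolds τ (eraseHist Δ) := by
  obtain ⟨A, B, T, h1, rfl, rfl⟩ := h
  have hT : Comp.proc Δ' p sτ (.rolling τ pτ pr L P) ∉ T := by
    intro h
    have := hS.normal _ _ _ _ (Multiset.mem_add.2 (.inr h))
    cases this
  have hB := (Multiset.mem_add.1 hp).resolve_right hT
  have key : ∀ {z pτ' y τ'} {Δ : List (Item St V)} {x}, chk τ' Δ = some x →
      Comp.proc Δ' p sτ (.rolling τ pτ pr L P) ∈ rollRhs y z pτ' τ' x → z = p ∧ τ' = τ := by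
    intro z pτ' y τ' Δ x hx hm
    rcases Multiset.mem_cons.1 hm with hm | hm
    · cases hm
      exact ⟨rfl, rfl⟩
    · rcases Multiset.mem_add.1 hm with hm | hm
      · obtain ⟨_, _, hm⟩ := Multiset.mem_map.1 hm
        cases hm
      · obtain ⟨_, _, _, _, _, hm⟩ := allMsgs_of_chk hx _ hm
        cases hm
  have hold : ∀ {Δ : List (Item St V)} {x}, chk τ Δ = some x → EHolds τ (eraseHist Δ) := by
    intro Δ x hx
    by_contra hh
    rw [chk_eq_none_iff.2 hh] at hx
    cases hx
  rcases h1 with h1 | h1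
  · cases h1 with
    | @rollback Δ z s s' τ' x hs hx =>
      obtain ⟨rfl, rfl⟩ := key hx hB
      refine ⟨_, hS.cons_note (y := z) (pτ := z) (.inl rfl),
        ⟨_, _, T, .inl (.roll1 (p' := z) (pτ := z) (s := some s) hx), ?_, rfl⟩,
        Δ, some s, by simp, hold hx⟩
      simp
  · have h2 := h1
    cases h1 with
    | @roll1 Δ z s y pτ' τ' x hx =>
      obtain ⟨rfl, rfl⟩ := key hx hB
      exact ⟨_, hS, ⟨_, _, T, .inl h2, rfl, rfl⟩, Δ, s, by simp, hold hx⟩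

/-- This expresses the history and state of `p` by `E` alone; with its counterpart for `RInv`, two
derivations of different kinds agree on `p`. -/
theorem Inv.restore_eq (hE : CompleteRecord p τ E) {S : Sys St V} (hS : Inv p τ E S)
    {Δ s τ' pτ pr L P} (h : Comp.proc Δ p s (.rolling τ' pτ pr L P) ∈ S) {e₀ s₀}
    (h₀ : EComp.proc e₀ p s₀ ∈ E) : restore τ e₀ s₀ = (eraseHist Δ, s) := by
  have h1 := hS.proc_ok h
  obtain ⟨e₁, s₁, h2, h3, -⟩ := h1.orig
  obtain ⟨rfl, rfl⟩ := hE.unique h₀ h2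
  rw [← h3, restore_of_not (h1.not_holds (by simp))]

theorem RInv.restore_eq (hE : CompleteRecord p τ E) {R : RSys St V} (hR : RInv p τ E R)
    {h s} (h1 : RComp.proc h p s ∅ ∈ R) {e₀ s₀} (h₀ : EComp.proc e₀ p s₀ ∈ E) :
    restore τ e₀ s₀ = (eraseRHist h, s) := by
  have h2 := hR.ok _ _ _ _ h1
  obtain ⟨e₁, s₁, h3, -, h4, -⟩ := h2.orig
  obtain ⟨rfl, rfl⟩ := hE.unique h₀ h3
  have h5 : ¬ EHolds τ (eraseRHist h) := by
    intro hh
    rcases h2.active hh with h6 | h6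
    · exact h6
    · exact h6.2 rfl
  rw [← h4 fun hp => hE.spawned_ne hp rfl, restore_of_not h5]

/-- Apart from `p`, both systems have the erased image `undoneSys p τ E E`. -/
theorem approx_of_invariants (hE : CompleteRecord p τ E) {Δ : List (Item St V)}
    {h : List (RItem St V)} {s : Option St} {τ' pτ pr : ℕ} {S : Sys St V} {R : RSys St V}
    (hS : Inv p τ E (.proc Δ p s (.rolling τ' pτ pr ∅ ∅) ::ₘ S))
    (hR : RInv p τ E (.proc h p s ∅ ::ₘ R)) (hn : NoRequests R)
    (he : eraseHist Δ = eraseRHist h) :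
    Approx (.proc Δ p s (.rolling τ' pτ pr ∅ ∅) ::ₘ S) (.proc h p s ∅ ::ₘ R) := by
  constructor
  · intro h' z s' φ hm
    rcases Multiset.mem_cons.1 hm with hm | hm
    · cases hm
      rfl
    · exact hn _ _ _ _ hm
  · rw [filterMap_erase_cons_proc, Multiset.map_cons, hS.final hE, hR.final hE hn, he]
    rfl

theorem CompleteRecord.guided {R : RSys St V} (hE : CompleteRecord p τ E)
    (hR : R.map RComp.erase = E) : Guided E τ R := by
  intro h z s φ hm hz hh
  have h1 : EComp.proc (eraseRHist h) z s ∈ E := hR ▸ Multiset.mem_map_of_mem RComp.erase hm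
  exact absurd (hE.spawned_holds h1 hz).2.1 hh

end

end RollbackRecovery
-- The correspondence theorem
theorem mainTheorem2 {St V : Type*} (rollbackStep : St → Chk → St → Prop)
    (p : Pid) (τ : Chk) (s : St)
    (Δ : List (Item St V)) (S₁ : Sys St V)
    (h : List (RItem St V)) (R₁ : RSys St V)
    (hreq : RollbackRequested rollbackStep p τ s S₁)
    (hcomplete : CompleteHistories p τ (.proc Δ p (some s) .normal ::ₘ S₁))
    (happrox : Approx (.proc Δ p (some s) .normal ::ₘ S₁) (.proc h p (some s) ∅ ::ₘ R₁)) :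
    -- every rollback derivation is matched by a controlled backward derivation
    (∀ (Δ' : List (Item St V)) (sτ : Option St) (pτ pr : Pid) (S₂ : Sys St V),
      RollbackDerivation rollbackStep (.proc Δ p (some s) .normal ::ₘ S₁) τ Δ' p sτ pτ pr S₂ →
      ∃ (h' : List (RItem St V)) (R₂ : RSys St V),
        Relation.ReflTransGen (ControlledStep τ)
          (.proc h p (some s) {.chk τ} ::ₘ R₁) (.proc h' p sτ ∅ ::ₘ R₂) ∧
        Approx (.proc Δ' p sτ (.rolling τ pτ pr ∅ ∅) ::ₘ S₂) (.proc h' p sτ ∅ ::ₘ R₂)) ∧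
    -- and conversely; the final systems are related once no request is pending in the latter
    (∀ (h' : List (RItem St V)) (sτ : Option St) (R₂ : RSys St V),
      Relation.ReflTransGen (ControlledStep τ)
        (.proc h p (some s) {.chk τ} ::ₘ R₁) (.proc h' p sτ ∅ ::ₘ R₂) →
      ∃ (Δ' : List (Item St V)) (pτ pr : Pid) (S₂ : Sys St V),
        RollbackDerivation rollbackStep (.proc Δ p (some s) .normal ::ₘ S₁) τ Δ' p sτ pτ pr S₂ ∧
        (NoRequests R₂ →
          Approx (.proc Δ' p sτ (.rolling τ pτ pr ∅ ∅) ::ₘ S₂) (.proc h' p sτ ∅ ::ₘ R₂))) := by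
  have hE := hcomplete.completeRecord
  have hmem : EComp.proc (eraseHist Δ) p (some s) ∈
      (Comp.proc Δ p (some s) .normal ::ₘ S₁).filterMap Comp.erase := by simp
  have hstart := hreq.start (Δ := Δ)
  have hinit := fun x (hx : chk τ Δ = some x) => hreq.exists_initStep hx
  have hR₁ : NoRequests R₁ := fun h' z s' φ hm => happrox.1 h' z s' φ (Multiset.mem_cons_of_mem hm)
  have hR := fun hE' hh => RInv.start (p := p) (τ := τ) (h := h) (s := some s) hR₁ hE' hh
  have hmemR : EComp.proc (eraseRHist h) p (some s) ∈
      (RComp.proc h p (some s) ∅ ::ₘ R₁).map RComp.erase :=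
    Multiset.mem_map_of_mem RComp.erase (Multiset.mem_cons_self _ _)
  have hmap : (RComp.proc h p (some s) {.chk τ} ::ₘ R₁).map RComp.erase =
      (RComp.proc h p (some s) ∅ ::ₘ R₁).map RComp.erase := by simp [RComp.erase]
  rw [← happrox.2] at hR hmemR hmap
  -- From here on the two initial systems are compared only through their common image `E`.
  generalize (Comp.proc Δ p (some s) .normal ::ₘ S₁).filterMap Comp.erase = E
    at hE hmem hstart hinit hR hmemR hmap
  obtain ⟨heq, -⟩ := hE.unique hmem hmemR
  constructor
  · rintro Δ' sτ pτ pr S₂ ⟨L, P, T, h1, h2⟩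
    obtain ⟨S, h3, h4, Δ₁, s₁, h5, h6⟩ := hstart.exists_propStep h1 (Multiset.mem_cons_self _ _)
    obtain ⟨rfl, -⟩ := (hstart.inv hE).proc_unique h5 (Multiset.mem_cons_self _ _)
    have hS := ((h3.inv hE).propStep hE h4).propSteps hE h2
    -- The given derivation is not followed: any backward derivation that satisfies all requests has
    -- the right end.
    obtain ⟨R', h7, h8, h9⟩ :=
      (hR hE (heq ▸ h6)).exists_derivation hE (hE.guided hmap)
    obtain ⟨h', s', φ, h10⟩ := RInv.exists_proc h8.bal.pid_pos
    obtain rfl := h9 _ _ _ _ h10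
    obtain ⟨R₂, rfl⟩ := Multiset.exists_cons_of_mem h10
    have h11 := hS.restore_eq hE (Multiset.mem_cons_self _ _) hmem
    have h12 := h8.restore_eq hE h10 hmem
    rw [h11, Prod.mk.injEq] at h12
    obtain ⟨h12, rfl⟩ := h12
    exact ⟨h', R₂, h7, approx_of_invariants hE hS h8
      (fun h' z s' φ hm => h9 h' z s' φ (Multiset.mem_cons_of_mem hm)) h12⟩
  · intro h' sτ R₂ h1
    -- Otherwise `p` could never get rid of its request.
    have hh : EHolds τ (eraseRHist h) := by
      by_contra hh
      refine (unfinished_of_not_holds h1 ?_ h' sτ ∅ (Multiset.mem_cons_self _ _)).1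
      intro h₁ s₁ φ₁ hm
      rcases Multiset.mem_cons.1 hm with hm | hm
      · cases hm
        exact ⟨rfl, hh⟩
      · have h2 := hE.pid_le p
        have h3 := le_wsum (f := pidW p) (Multiset.mem_map_of_mem RComp.erase hm)
        rw [← hmap, Multiset.map_cons, wsum_cons] at h2
        simp only [RComp.erase, pidW, if_true] at h2 h3
        omega
    have h2 := (hR hE hh).steps hE h1
    obtain ⟨x, hx⟩ : ∃ x, chk τ Δ = some x := by
      rw [← Option.ne_none_iff_exists', Ne, chk_eq_none_iff, heq, not_not]
      exact hh
    obtain ⟨pτ, pr, T, h3, h4⟩ := hinit x hx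
    obtain ⟨S₂, h5⟩ := h3.exists_derivation hE hx
    have h6 : PropStep (rollLhs pr p pτ τ Δ (some s) + T) (rollRhs pr p pτ τ x + T) :=
      ⟨_, _, T, .inl (.roll1 hx), rfl, rfl⟩
    have hS := ((h3.inv hE).propStep hE h6).propSteps hE h5
    have h7 := hS.restore_eq hE (Multiset.mem_cons_self _ _) hmem
    have h8 := h2.restore_eq hE (Multiset.mem_cons_self _ _) hmem
    rw [h7, Prod.mk.injEq] at h8
    obtain ⟨h8, rfl⟩ := h8
    rw [rollRhs, Multiset.cons_add] at h4 h5
    exact ⟨x.hist, pτ, pr, S₂, ⟨x.tags, x.deps, _, h4, h5⟩,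
      fun hn => approx_of_invariants hE hS h2 hn h8⟩
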